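/- Let $k\ge 3$ be an integer, let $C>0$ be a real number and let $\beta_1,\gamma_1\in(0,0.1)$ be constants. For $n,m\in\mathbb N$ let $G_{n,m}^{\delta\ge k}$ be a graph chosen uniformly at random from all simple graphs on the vertex set $\{1,\dots,n\}$ with exactly $m$ edges and minimum degree at least $k$. For $x>0$ and $j\ge 0$ let $f_j(x)=e^{x}-\sum_{i=0}^{j-1}x^i/i!$. Let $m=cn$, where $c=c(n)$ satisfies $k/2<c\le C$, let $\lambda>0$ be the positive real number determined by $$\frac{\lambda f_{k-1}(\lambda)}{f_k(\lambda)}=\frac{2m}{n}=2c,$$ and assume that $$\frac{9e^{1+\lambda}\lambda^2}{c f_k(\lambda)}\Big(\frac{\gamma_1\lambda^2}{c}\Big)^{0.1}<\frac12\qquad\text{and}\qquad \big[2(k+\lambda)-\log_2(\beta_1\gamma_1)+3\big]\beta_1<2(1-\beta_1).$$ Then with probability $1-o(n^{-1})$ (where the error term is uniform over all such $c$, i.e. depends only on $n,k,C,\beta_1,\gamma_1$) the graph $G=G_{n,m}^{\delta\ge k}$ satisfies all of the following: (i) every set $S\subset V(G)$ with $|S|\le\gamma_1 n$ spans fewer than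 $1.1|S|+1$ edges, i.e. fewer than $1.1|S|+1$ edges of $G$ have both endpoints in $S$; (ii) every set $S\subset V(G)$ with $|S|\le\beta_1\gamma_1 n$ is incident to fewer than $2(1-\beta_1)\gamma_1 n$ edges, i.e. fewer than $2(1-\beta_1)\gamma_1n$ edges of $G$ have at least one endpoint in $S$; (iii) $G$ does not contain $2n/(\log\log n)^6$ or more pairwise vertex-disjoint cycles. -/

import Mathlib

namespace MinDegGraph

/-- `f_k(x) = e^x - ∑_{i<k} x^i / i!`. -/
noncomputable def truncExp (k : ℕ) (x : ℝ) : ℝ :=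
  Real.exp x - ∑ i ∈ Finset.range k, x ^ i / (i.factorial : ℝ)

/-- The simple graphs on `n` labelled vertices with exactly `m` edges and minimum degree
at least `k`. -/
def family (n m k : ℕ) : Set (SimpleGraph (Fin n)) :=
  {G | G.edgeSet.ncard = m ∧ ∀ v, k ≤ (G.neighborSet v).ncard}

/-- The probability that a graph chosen uniformly at random from `family n m k` has the
property `P`. -/
noncomputable def prob (n m k : ℕ) (P : SimpleGraph (Fin n) → Prop) : ℝ :=
  ({G | G ∈ family n m k ∧ P G}.ncard : ℝ) / ((family n m k).ncard : ℝ)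

/-- The number of edges of `G` with both endpoints in `S`. -/
noncomputable def edgesSpanned {V : Type*} (G : SimpleGraph V) (S : Finset V) : ℕ :=
  {e | e ∈ G.edgeSet ∧ ∀ v ∈ e, v ∈ S}.ncard

/-- The number of edges of `G` with at least one endpoint in `S`. -/
noncomputable def edgesIncident {V : Type*} (G : SimpleGraph V) (S : Finset V) : ℕ :=
  {e | e ∈ G.edgeSet ∧ ∃ v ∈ e, v ∈ S}.ncard

/-- `G` contains `t` pairwise vertex-disjoint cycles. -/
def HasDisjointCycles {V : Type*} (G : SimpleGraph V) (t : ℕ) : Prop :=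
  ∃ (v : Fin t → V) (p : ∀ i, G.Walk (v i) (v i)),
    (∀ i, (p i).IsCycle) ∧
      ∀ i j, i ≠ j → List.Disjoint (p i).support (p j).support

end MinDegGraph

/-! The proof works in the configuration model. A word assigns a vertex to each of the N = 2m
half-edges, with every vertex used at least k times. Words with no loop and no repeated edge encode
exactly the graphs of the family, each one m!·2^m times, so probabilities are proportions among
`simpleWords` (`prob_eq`). Unwanted events are counted in the set of all words and the count is then
compared with the number of simple words.

Upper bounds. A sum over words of a weight multiplicative in the letter counts is N! times a
coefficient of a product of exponential generating functions, hence at most N! lam^(-N) times that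
product evaluated at lam. The common yardstick is `poissonMass`, the value for weight one. Tilting
the weight of a letter, or prescribing some positions, changes it by explicit factors.

Lower bounds. The equation for lam makes it the saddle point of f_k(x)^n / x^N. The coefficients of
f_k^n are log-concave (Cauchy–Binet), so the saddle-point bound is sharp up to a factor e(N+1)
(`truncExp_pow_le_coeff`). At least half of the words have all multiplicities at most D = ⌈log² n⌉
and a linear sum of squared multiplicities. In these the mean number of bad edges is bounded, so
Markov leaves at most B of them in half of the words, and switchings remove them one at a time at a
cost O(D²) each. Hence simple words are at least a fraction n^(-1/2) of all words, and `poissonMass`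
is at most n³ times their number (`eventually_card_words_le`).

An atypical simple word falls into one of five classes, each of proportion o(1/n). A multiplicity
above D, or a set of at most βγn vertices with large total multiplicity, is excluded by exponential
moments. Dense sets of more than D vertices are excluded by a first moment at most 2^(-s) for size
s, which is what the density condition provides. Dense sets of at most D vertices would not survive
the loss n³; there exchangeability of the positions gives probability about n^(-1.7) relative to all
words, and only n^(1/2) is lost. Finally, many disjoint cycles force many short cycles of one common
length l ≤ L = ⌊(log log n)^6⌋; the sixth factorial moment of their number is n^(o(1)) relative to
`poissonMass`, against about n^5.4 ordered choices of six of them. -/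

set_option linter.unusedSectionVars false

namespace MinDegGraph
open Finset

/-! ### Letter counts and exponential generating functions. -/

section Counting
variable {I V : Type*} [Fintype I] [DecidableEq I] [Fintype V] [DecidableEq V]

/-- The number of occurrences of the letter `v` in the word `x`. -/
def cnt (x : I → V) (v : V) : ℕ := #{p | x p = v}

theorem prod_comp_eq_prod_pow_cnt {M : Type*} [CommMonoid M] (x : I → V) (f : V → M) :
    ∏ p, f (x p) = ∏ v, f v ^ cnt x v := by
  rw [← Finset.prod_fiberwise_of_maps_to (fun p _ => Finset.mem_univ (x p))]
  refine Finset.prod_congr rfl fun v _ => ?_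
  rw [Finset.prod_congr rfl (g := fun _ => f v), Finset.prod_const, cnt]
  intro p hp
  rw [(Finset.mem_filter.1 hp).2]

/-- The multinomial theorem for a power of the sum of the variables, followed by the linear
functional that sends the monomial with exponent d to g d. -/
theorem sum_comp_cnt (g : (V → ℕ) → ℝ) :
    ∑ x : I → V, g (cnt x) =
      ∑ d ∈ piAntidiag univ (Fintype.card I), (Nat.multinomial univ d : ℝ) * g d := by
  let L : MvPolynomial V ℝ →ₗ[ℝ] ℝ :=
    (MvPolynomial.basisMonomials V ℝ).constr ℝ (fun d => g d)
  have hL : ∀ d : V → ℕ, L (∏ v, MvPolynomial.X v ^ d v) = g d := by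
    intro d
    have : (∏ v, MvPolynomial.X v ^ d v : MvPolynomial V ℝ)
        = MvPolynomial.basisMonomials V ℝ (Finsupp.equivFunOnFinite.symm d) := by
      rw [MvPolynomial.coe_basisMonomials]
      change _ = MvPolynomial.monomial _ 1
      rw [MvPolynomial.monomial_eq, Finsupp.prod_fintype]
      · simp
      · simp
    rw [this, Module.Basis.constr_basis]
    rfl
  have h1 : (∑ v : V, MvPolynomial.X v : MvPolynomial V ℝ) ^ Fintype.card I
      = ∑ x : I → V, ∏ v, MvPolynomial.X v ^ cnt x v := by
    have := Finset.prod_univ_sum (fun _ : I => (univ : Finset V))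
      (fun _ v => (MvPolynomial.X v : MvPolynomial V ℝ))
    simp only [Finset.prod_const, Finset.card_univ, Fintype.piFinset_univ] at this
    rw [this]
    exact Finset.sum_congr rfl fun x _ => prod_comp_eq_prod_pow_cnt x _
  have h2 := congrArg L h1
  rw [Finset.sum_pow_eq_sum_piAntidiag, map_sum, map_sum] at h2
  simp only [hL] at h2
  rw [← h2]
  refine Finset.sum_congr rfl fun d _ => ?_
  rw [← nsmul_eq_mul, map_nsmul, hL, nsmul_eq_mul]

/-- For a multiplicative weight the factorials in the multinomial coefficient distribute over the
letters, which leaves a coefficient of a product of exponential generating functions. -/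
theorem sum_prod_cnt (φ : V → ℕ → ℝ) :
    ∑ x : I → V, ∏ v, φ v (cnt x v) = (Fintype.card I).factorial *
      ∑ d ∈ piAntidiag univ (Fintype.card I), ∏ v, φ v (d v) / (d v).factorial := by
  rw [sum_comp_cnt (fun d => ∏ v, φ v (d v)), Finset.mul_sum]
  refine Finset.sum_congr rfl fun d hd => ?_
  have hs : ∑ v, d v = Fintype.card I := (mem_piAntidiag.1 hd).1
  have := Nat.multinomial_spec univ d
  rw [hs] at this
  rw [← this, Finset.prod_div_distrib]
  push_cast
  have h0 : (∏ v, ((d v).factorial : ℝ)) ≠ 0 :=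
    Finset.prod_ne_zero_iff.2 fun v _ => by exact_mod_cast (d v).factorial_ne_zero
  field_simp

/-- Exponential-generating-function bound for a multiplicative weight of the letter counts. -/
theorem sum_prod_cnt_le (φ : V → ℕ → ℝ) (hφ : ∀ v j, 0 ≤ φ v j) {lam : ℝ} (hl : 0 < lam)
    (B : V → ℝ)
    (hB : ∀ v L, ∑ j ∈ range L, φ v j * lam ^ j / j.factorial ≤ B v) :
    ∑ x : I → V, ∏ v, φ v (cnt x v) ≤
      (Fintype.card I).factorial / lam ^ (Fintype.card I) * ∏ v, B v := by
  rw [sum_prod_cnt, div_mul_eq_mul_div, mul_div_assoc]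
  refine mul_le_mul_of_nonneg_left ?_ (by positivity)
  rw [le_div_iff₀ (by positivity), Finset.sum_mul]
  set N := Fintype.card I
  have h1 : ∀ d ∈ piAntidiag (univ : Finset V) N,
      (∏ v, φ v (d v) / (d v).factorial) * lam ^ N
        = ∏ v, φ v (d v) * lam ^ (d v) / (d v).factorial := by
    intro d hd
    rw [← (mem_piAntidiag.1 hd).1, ← Finset.prod_pow_eq_pow_sum, ← Finset.prod_mul_distrib]
    exact Finset.prod_congr rfl fun v _ => by ring
  rw [Finset.sum_congr rfl h1]
  -- Dropping the constraint that the counts add up to N enlarges the sum of nonnegative terms to a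
  -- box, where it factorises.
  calc _ ≤ ∑ d ∈ Fintype.piFinset (fun _ : V => range (N + 1)),
        ∏ v, φ v (d v) * lam ^ (d v) / (d v).factorial := by
        refine Finset.sum_le_sum_of_subset_of_nonneg ?_ ?_
        · intro d hd
          rw [Fintype.mem_piFinset]
          intro v
          rw [Finset.mem_range, Nat.lt_succ_iff, ← (mem_piAntidiag.1 hd).1]
          exact Finset.single_le_sum (f := d) (fun _ _ => Nat.zero_le _) (mem_univ v)
        · intro d _ _
          exact Finset.prod_nonneg fun v _ => by have := hφ v (d v); positivity
    _ = ∏ v, ∑ j ∈ range (N + 1), φ v j * lam ^ j / j.factorial := by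
        rw [Finset.prod_univ_sum]
    _ ≤ ∏ v, B v := by
        refine Finset.prod_le_prod (fun v _ => ?_) (fun v _ => hB v _)
        exact Finset.sum_nonneg fun j _ => by have := hφ v j; positivity

end Counting

/-! ### Truncated exponential series and the saddle point. -/

theorem hasSum_truncExp (k : ℕ) (x : ℝ) :
    HasSum (fun j : ℕ => if k ≤ j then x ^ j / j.factorial else 0) (truncExp k x) := by
  have h := NormedSpace.expSeries_div_hasSum_exp (𝔸 := ℝ) x
  rw [← Real.exp_eq_exp_ℝ] at h
  have h2 : HasSum (fun j : ℕ => if j ∈ range k then x ^ j / (j.factorial : ℝ) else 0)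
      (∑ i ∈ range k, x ^ i / (i.factorial : ℝ)) := by
    have e : ∑ i ∈ range k, x ^ i / (i.factorial : ℝ) =
        ∑ j ∈ range k, if j ∈ range k then x ^ j / (j.factorial : ℝ) else 0 :=
      Finset.sum_congr rfl fun i hi => (if_pos hi).symm
    rw [e]
    exact hasSum_sum_of_ne_finset_zero (fun b hb => if_neg hb)
  have e : (fun j : ℕ => if k ≤ j then x ^ j / (j.factorial : ℝ) else 0) = fun j : ℕ =>
      x ^ j / (j.factorial : ℝ) - if j ∈ range k then x ^ j / (j.factorial : ℝ) else 0 := by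
    funext j
    by_cases hj : k ≤ j
    · simp [hj, not_lt.2 hj]
    · simp [hj, not_le.1 hj]
  rw [e]
  exact h.sub h2

/-- The first moment of the Poisson law truncated below k; it identifies x f_{k-1}(x) / f_k(x) as
the mean of that law. -/
theorem hasSum_mul_truncExp {k : ℕ} (hk : 1 ≤ k) (x : ℝ) :
    HasSum (fun j : ℕ => if k ≤ j then (j : ℝ) * (x ^ j / j.factorial) else 0)
      (x * truncExp (k - 1) x) := by
  rw [← hasSum_nat_add_iff' 1]
  have e1 : x * truncExp (k - 1) x - ∑ i ∈ range 1,
      (if k ≤ i then (i : ℝ) * (x ^ i / i.factorial) else 0) = x * truncExp (k - 1) x := by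
    simp
  have e2 : (fun j : ℕ => if k ≤ j + 1 then ((j + 1 : ℕ) : ℝ) *
      (x ^ (j + 1) / (j + 1).factorial) else 0) =
      fun j : ℕ => x * if k - 1 ≤ j then x ^ j / (j.factorial : ℝ) else 0 := by
    funext j
    by_cases h : k ≤ j + 1
    · rw [if_pos h, if_pos (by omega), Nat.factorial_succ]
      have : (j.factorial : ℝ) ≠ 0 := by exact_mod_cast j.factorial_ne_zero
      push_cast
      field_simp
      ring
    · rw [if_neg h, if_neg (by omega), mul_zero]
  rw [e1, e2]
  exact (hasSum_truncExp (k - 1) x).mul_left x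

theorem truncExp_pos (k : ℕ) {x : ℝ} (hx : 0 < x) : 0 < truncExp k x := by
  have h := hasSum_truncExp k x
  have h0 : ∀ j : ℕ, 0 ≤ (if k ≤ j then x ^ j / (j.factorial : ℝ) else 0) := by
    intro j; split_ifs <;> positivity
  refine lt_of_lt_of_le ?_ (h.summable.le_tsum k (fun j _ => h0 j) |>.trans_eq h.tsum_eq)
  rw [if_pos le_rfl]; positivity

theorem truncExp_anti {j k : ℕ} (h : j ≤ k) {x : ℝ} (hx : 0 ≤ x) :
    truncExp k x ≤ truncExp j x := by
  refine hasSum_le (fun i => ?_) (hasSum_truncExp k x) (hasSum_truncExp j x)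
  by_cases h1 : k ≤ i
  · rw [if_pos h1, if_pos (h.trans h1)]
  · rw [if_neg h1]; split_ifs <;> positivity

theorem truncExp_zero (x : ℝ) : truncExp 0 x = Real.exp x := by simp [truncExp]

theorem truncExp_le_exp (k : ℕ) {x : ℝ} (hx : 0 ≤ x) : truncExp k x ≤ Real.exp x := by
  rw [← truncExp_zero]; exact truncExp_anti (Nat.zero_le _) hx

theorem sum_range_le_truncExp (k : ℕ) {x : ℝ} (hx : 0 ≤ x) (L : ℕ) :
    ∑ j ∈ range L, (if k ≤ j then x ^ j / (j.factorial : ℝ) else 0) ≤ truncExp k x := by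
  refine sum_le_hasSum _ (fun j _ => ?_) (hasSum_truncExp k x)
  split_ifs <;> positivity

theorem truncExp_zero_right {k : ℕ} (hk : 1 ≤ k) : truncExp k 0 = 0 := by
  obtain ⟨k, rfl⟩ : ∃ j, k = j + 1 := ⟨k - 1, by omega⟩
  simp [truncExp, Finset.sum_range_succ']

theorem hasDerivAt_truncExp (k : ℕ) (x : ℝ) :
    HasDerivAt (truncExp (k + 1)) (truncExp k x) x := by
  unfold truncExp
  refine (Real.hasDerivAt_exp x).sub ?_
  have : HasDerivAt (fun x : ℝ => ∑ i ∈ range (k + 1), x ^ i / (i.factorial : ℝ))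
      (∑ i ∈ range (k + 1), (i * x ^ (i - 1)) / (i.factorial : ℝ)) x := by
    refine HasDerivAt.fun_sum fun i _ => ?_
    exact (hasDerivAt_pow i x).div_const _
  refine this.congr_deriv ?_
  rw [Finset.sum_range_succ']
  simp only [Nat.cast_zero, zero_mul, zero_div, add_zero, Nat.add_sub_cancel]
  refine Finset.sum_congr rfl fun i _ => ?_
  rw [Nat.factorial_succ]
  have : (i.factorial : ℝ) ≠ 0 := by exact_mod_cast i.factorial_ne_zero
  push_cast
  field_simp

/-- Induction on k: the two sides vanish at 0 for positive k, and differentiation lowers the index.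
The factor y^k e^((y-1)x) is the price of tilting one letter by y; it stays bounded as x tends to 0.
-/
theorem truncExp_mul_le (k : ℕ) {y : ℝ} (hy : 1 ≤ y) {x : ℝ} (hx : 0 ≤ x) :
    truncExp k (y * x) ≤ y ^ k * Real.exp ((y - 1) * x) * truncExp k x := by
  induction k generalizing x with
  | zero =>
    rw [truncExp_zero, truncExp_zero, pow_zero, one_mul, ← Real.exp_add]
    apply le_of_eq; congr 1; ring
  | succ k ih =>
    let g : ℝ → ℝ := fun x =>
      y ^ (k + 1) * Real.exp ((y - 1) * x) * truncExp (k + 1) x - truncExp (k + 1) (y * x)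
    have hd : ∀ x : ℝ, HasDerivAt g ((y ^ (k + 1) * (Real.exp ((y - 1) * x) * (y - 1)))
          * truncExp (k + 1) x
          + y ^ (k + 1) * Real.exp ((y - 1) * x) * truncExp k x - truncExp k (y * x) * y) x := by
      intro x
      have h1 : HasDerivAt (fun x : ℝ => (y - 1) * x) (y - 1) x := by
        simpa using (hasDerivAt_id x).const_mul (y - 1)
      have h2 : HasDerivAt (fun x : ℝ => y * x) y x := by
        simpa using (hasDerivAt_id x).const_mul y
      exact ((h1.exp.const_mul (y ^ (k + 1))).mul (hasDerivAt_truncExp k x)).sub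
        ((hasDerivAt_truncExp k (y * x)).comp x h2)
    have hmono : MonotoneOn g (Set.Ici 0) := by
      refine monotoneOn_of_deriv_nonneg (convex_Ici 0)
        (fun x _ => (hd x).continuousAt.continuousWithinAt)
        (fun x _ => (hd x).differentiableAt.differentiableWithinAt) ?_
      intro x hx
      rw [interior_Ici, Set.mem_Ioi] at hx
      rw [(hd x).deriv]
      have h1 := ih hx.le
      have h2 := truncExp_pos (k + 1) hx
      have h3 : 0 ≤ (y ^ (k + 1) * (Real.exp ((y - 1) * x) * (y - 1))) * truncExp (k + 1) x := by
        have : 0 ≤ y - 1 := by linarith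
        positivity
      have h4 := mul_le_mul_of_nonneg_right h1 (by linarith : (0 : ℝ) ≤ y)
      have h5 : y ^ k * Real.exp ((y - 1) * x) * truncExp k x * y
        = y ^ (k + 1) * Real.exp ((y - 1) * x) * truncExp k x := by ring
      linarith
    have h := hmono (Set.mem_Ici.2 le_rfl) (Set.mem_Ici.2 hx) hx
    simp only [g, mul_zero, truncExp_zero_right (Nat.le_add_left 1 k), sub_zero] at h
    linarith

/-- The point `lam` with `lam f_{k-1}(lam) / f_k(lam) = b` minimises `f_k(x) / x ^ b`. -/
theorem truncExp_saddle {k : ℕ} (hk : 1 ≤ k) {lam b : ℝ} (hl : 0 < lam)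
    (hb : lam * truncExp (k - 1) lam / truncExp k lam = b) {y : ℝ} (hy : 0 < y) :
    truncExp k lam * y ^ b ≤ truncExp k (y * lam) := by
  have hf := truncExp_pos k hl
  have h1 := hasSum_truncExp k lam
  have h2 := hasSum_mul_truncExp hk lam
  rw [div_eq_iff hf.ne'] at hb
  -- Jensen's inequality for the truncated Poisson law. With e^u ≥ 1 + u applied to u = (j - b) log
  -- y, the linear term sums to zero because b is the mean.
  have h3 := ((h2.sub (h1.mul_left b)).mul_left (Real.log y)).add h1 |>.mul_left (y ^ b)
  rw [hb, sub_self, mul_zero, zero_add, mul_comm] at h3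
  refine hasSum_le (fun j => ?_) h3 (hasSum_truncExp k (y * lam))
  by_cases hj : k ≤ j
  · simp only [if_pos hj]
    have e1 : y ^ j = y ^ b * Real.exp (((j : ℝ) - b) * Real.log y) := by
      rw [Real.rpow_def_of_pos hy, ← Real.exp_add, ← Real.rpow_natCast,
        Real.rpow_def_of_pos hy]
      congr 1; ring
    have e2 := Real.add_one_le_exp (((j : ℝ) - b) * Real.log y)
    have hyb : 0 < y ^ b := Real.rpow_pos_of_pos hy b
    rw [mul_pow, e1]
    have h4 : 0 ≤ y ^ b * (lam ^ j / (j.factorial : ℝ)) := by positivity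
    have h5 := mul_le_mul_of_nonneg_left e2 h4
    calc _ = y ^ b * (lam ^ j / (j.factorial : ℝ)) * (((j : ℝ) - b) * Real.log y + 1) := by ring
      _ ≤ _ := h5
      _ = _ := by ring
  · simp [hj]

/-! ### Log-concavity of the coefficients of powers of the truncated exponential. -/

/-- Log-concavity without internal zeros, in the form that is stable under convolution. -/
def PF2 (a : ℕ → ℝ) : Prop := ∀ i j d : ℕ, i ≤ j → a i * a (j + d) ≤ a (i + d) * a j

/-- The lower triangular Toeplitz kernel of a sequence. -/
def toeplitz (a : ℕ → ℝ) (x u : ℕ) : ℝ := if u ≤ x then a (x - u) else 0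

/-- When all four entries lie in the triangle, the minor inequality is an instance of `PF2`;
otherwise the entry at (x, v) is zero and only nonnegativity is needed. -/
theorem toeplitz_minor_nonneg {a : ℕ → ℝ} (h0 : ∀ i, 0 ≤ a i) (ha : PF2 a) {x y u v : ℕ}
    (hxy : x ≤ y) (huv : u ≤ v) :
    toeplitz a x v * toeplitz a y u ≤ toeplitz a x u * toeplitz a y v := by
  unfold toeplitz
  by_cases h : v ≤ x
  · rw [if_pos h, if_pos (by omega), if_pos (by omega), if_pos (by omega)]
    have := ha (x - v) (y - v) (v - u) (by omega)
    rwa [show y - v + (v - u) = y - u by omega, show x - v + (v - u) = x - u by omega] at this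
  · rw [if_neg h, zero_mul]
    split_ifs <;> first | exact mul_nonneg (h0 _) (h0 _) | simp

/-- Toeplitz kernels multiply as matrices, so minors of the kernel of a product can be computed from
those of the factors. -/
theorem sum_toeplitz_mul (P Q : PowerSeries ℝ) (n w M : ℕ) (hM : n + w < M) :
    ∑ u ∈ range M, toeplitz (fun j => P.coeff j) (n + w) u * toeplitz (fun j => Q.coeff j) u w
      = (P * Q).coeff n := by
  rw [PowerSeries.coeff_mul, eq_comm]
  refine Finset.sum_of_injOn (fun p => p.2 + w) ?_ ?_ ?_ ?_
  · intro p hp q hq h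
    rw [Finset.mem_coe, HasAntidiagonal.mem_antidiagonal] at hp hq
    simp only [add_left_inj] at h
    ext <;> omega
  · intro p hp
    rw [Finset.mem_coe, HasAntidiagonal.mem_antidiagonal] at hp
    simp only [coe_range, Set.mem_Iio]
    omega
  · intro u hu hu2
    unfold toeplitz
    by_cases h1 : u ≤ n + w
    · by_cases h2 : w ≤ u
      · exact absurd ⟨(n + w - u, u - w), by simp; omega, by simp; omega⟩ hu2
      · rw [if_neg h2, mul_zero]
    · rw [if_neg h1, zero_mul]
  · intro p hp
    rw [HasAntidiagonal.mem_antidiagonal] at hp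
    unfold toeplitz
    rw [if_pos (by omega), if_pos (by omega), show n + w - (p.2 + w) = p.1 by omega,
      Nat.add_sub_cancel]

/-- Cauchy–Binet: a 2×2 minor of a product of kernels is a sum of products of 2×2 minors of the
factors. The minor used has rows i + d, j + d and columns 0, d. -/
theorem PF2.mul {P Q : PowerSeries ℝ} (hP0 : ∀ j, 0 ≤ P.coeff j) (hQ0 : ∀ j, 0 ≤ Q.coeff j)
    (hP : PF2 fun j => P.coeff j) (hQ : PF2 fun j => Q.coeff j) :
    PF2 fun j => (P * Q).coeff j := by
  intro i j d hij
  set A := toeplitz (fun j => P.coeff j)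
  set B := toeplitz (fun j => Q.coeff j)
  set M := j + d + 1
  have key : (∑ u ∈ range M, A (i + d) u * B u d) * (∑ v ∈ range M, A (j + d) v * B v 0) ≤
      (∑ u ∈ range M, A (i + d) u * B u 0) * (∑ v ∈ range M, A (j + d) v * B v d) := by
    rw [Finset.sum_mul_sum, Finset.sum_mul_sum, ← sub_nonneg]
    -- Symmetrising the double sum in u and v turns each summand into a product of a minor of A and
    -- a minor of B. The two minors have the same sign, whichever of u and v is larger.
    have e1 : ∀ f : ℕ → ℕ → ℝ, ∑ u ∈ range M, ∑ v ∈ range M, f u v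
        = (∑ u ∈ range M, ∑ v ∈ range M, (f u v + f v u)) / 2 := by
      intro f
      have : ∑ u ∈ range M, ∑ v ∈ range M, f v u = ∑ u ∈ range M, ∑ v ∈ range M, f u v :=
        Finset.sum_comm
      simp only [Finset.sum_add_distrib]
      linarith
    simp only [← Finset.sum_sub_distrib]
    rw [e1]
    refine div_nonneg (Finset.sum_nonneg fun u _ => Finset.sum_nonneg fun v _ => ?_) (by norm_num)
    have e2 : A (i + d) u * B u 0 * (A (j + d) v * B v d)
        - A (i + d) u * B u d * (A (j + d) v * B v 0)
        + (A (i + d) v * B v 0 * (A (j + d) u * B u d)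
        - A (i + d) v * B v d * (A (j + d) u * B u 0))
        = (A (i + d) u * A (j + d) v - A (i + d) v * A (j + d) u)
          * (B u 0 * B v d - B u d * B v 0) := by ring
    rw [e2]
    rcases le_total u v with h | h
    · have h1 := toeplitz_minor_nonneg hP0 hP (show i + d ≤ j + d by omega) h
      have h2 := toeplitz_minor_nonneg hQ0 hQ h (Nat.zero_le d)
      exact mul_nonneg (by linarith) (by linarith)
    · have h1 := toeplitz_minor_nonneg hP0 hP (show i + d ≤ j + d by omega) h
      have h2 := toeplitz_minor_nonneg hQ0 hQ h (Nat.zero_le d)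
      exact mul_nonneg_of_nonpos_of_nonpos (by linarith) (by linarith)
  have h1 := sum_toeplitz_mul P Q i d M (by omega)
  have h2 := sum_toeplitz_mul P Q (j + d) 0 M (by omega)
  have h3 := sum_toeplitz_mul P Q (i + d) 0 M (by omega)
  have h4 := sum_toeplitz_mul P Q j d M (by omega)
  simp only [add_zero] at h2 h3
  rw [h1, h2, h3, h4] at key
  exact key

/-- The power series of `truncExp k`. -/
noncomputable def expTail (k : ℕ) : PowerSeries ℝ :=
  PowerSeries.mk fun j => if k ≤ j then 1 / (j.factorial : ℝ) else 0

theorem coeff_expTail (k j : ℕ) :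
    (expTail k).coeff j = if k ≤ j then 1 / (j.factorial : ℝ) else 0 :=
  PowerSeries.coeff_mk _ _

theorem coeff_expTail_nonneg (k j : ℕ) : 0 ≤ (expTail k).coeff j := by
  rw [coeff_expTail]; split_ifs <;> positivity

/-- Reciprocal factorials are log-concave, and deleting an initial segment creates no internal zero.
-/
theorem PF2_expTail (k : ℕ) : PF2 fun j => (expTail k).coeff j := by
  intro i j d hij
  simp only [coeff_expTail]
  by_cases h : k ≤ i
  · rw [if_pos h, if_pos (by omega), if_pos (by omega), if_pos (by omega)]
    rw [div_mul_div_comm, div_mul_div_comm]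
    have : (i + d).factorial * j.factorial ≤ i.factorial * (j + d).factorial := by
      induction d with
      | zero => simp
      | succ d ih =>
        rw [← add_assoc, ← add_assoc, Nat.factorial_succ, Nat.factorial_succ]
        calc _ = (i + d + 1) * ((i + d).factorial * j.factorial) := by ring
          _ ≤ (j + d + 1) * (i.factorial * (j + d).factorial) :=
            Nat.mul_le_mul (by omega) ih
          _ = _ := by ring
    refine div_le_div_of_nonneg_left (by norm_num) (by positivity) ?_
    exact_mod_cast this
  · rw [if_neg h, zero_mul]
    split_ifs <;> positivity

theorem coeff_expTail_pow_nonneg (k n j : ℕ) : 0 ≤ (expTail k ^ n).coeff j := by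
  induction n generalizing j with
  | zero => rw [pow_zero, PowerSeries.coeff_one]; split_ifs <;> norm_num
  | succ n ih =>
    rw [pow_succ, PowerSeries.coeff_mul]
    exact Finset.sum_nonneg fun p _ => mul_nonneg (ih _) (coeff_expTail_nonneg _ _)

theorem PF2_expTail_pow (k n : ℕ) : PF2 fun j => (expTail k ^ n).coeff j := by
  induction n with
  | zero =>
    intro i j d hij
    simp only [pow_zero, PowerSeries.coeff_one]
    by_cases h : i = 0
    · by_cases h2 : j + d = 0
      · have : i + d = 0 := by omega
        have : j = 0 := by omega
        simp_all
      · rw [if_neg h2, mul_zero]; split_ifs <;> norm_num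
    · rw [if_neg h, zero_mul]; split_ifs <;> norm_num
  | succ n ih =>
    rw [pow_succ]
    exact PF2.mul (coeff_expTail_pow_nonneg k n) (coeff_expTail_nonneg k) ih (PF2_expTail k)

theorem coeff_expTail_pow_pos (k n j : ℕ) (h : k * (n + 1) ≤ j) :
    0 < (expTail k ^ (n + 1)).coeff j := by
  induction n generalizing j with
  | zero =>
    rw [zero_add, pow_one, coeff_expTail, if_pos (by omega)]
    positivity
  | succ n ih =>
    rw [pow_succ, PowerSeries.coeff_mul]
    rw [mul_add, mul_one] at h
    refine Finset.sum_pos' (fun p _ => mul_nonneg (coeff_expTail_pow_nonneg _ _ _)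
      (coeff_expTail_nonneg _ _)) ⟨(j - k, k), ?_, ?_⟩
    · rw [HasAntidiagonal.mem_antidiagonal]; omega
    · refine mul_pos (ih _ (by omega)) ?_
      rw [coeff_expTail, if_pos le_rfl]
      positivity

theorem hasSum_coeff_expTail_pow (k n : ℕ) {x : ℝ} (hx : 0 ≤ x) :
    HasSum (fun j => (expTail k ^ n).coeff j * x ^ j) (truncExp k x ^ n) := by
  induction n with
  | zero =>
    have e : (fun j => (expTail k ^ 0).coeff j * x ^ j) = fun j => if j = 0 then (1 : ℝ) else 0 := by
      funext j
      rw [pow_zero, PowerSeries.coeff_one]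
      by_cases h : j = 0 <;> simp [h]
    rw [e, pow_zero]
    exact hasSum_ite_eq 0 1
  | succ n ih =>
    have h1 : HasSum (fun j => (expTail k).coeff j * x ^ j) (truncExp k x) := by
      have e : (fun j => (expTail k).coeff j * x ^ j) =
          fun j : ℕ => if k ≤ j then x ^ j / (j.factorial : ℝ) else 0 := by
        funext j
        rw [coeff_expTail]
        split_ifs <;> ring
      rw [e]
      exact hasSum_truncExp k x
    have e : ∀ j, (expTail k ^ (n + 1)).coeff j * x ^ j = ∑ p ∈ antidiagonal j,
        ((expTail k ^ n).coeff p.1 * x ^ p.1) * ((expTail k).coeff p.2 * x ^ p.2) := by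
      intro j
      rw [pow_succ, PowerSeries.coeff_mul, Finset.sum_mul]
      refine Finset.sum_congr rfl fun p hp => ?_
      rw [← HasAntidiagonal.mem_antidiagonal.1 hp, pow_add]
      ring
    have n1 : Summable fun j => ‖(expTail k ^ n).coeff j * x ^ j‖ := by
      refine ih.summable.congr fun j => ?_
      rw [Real.norm_of_nonneg (mul_nonneg (coeff_expTail_pow_nonneg _ _ _) (pow_nonneg hx _))]
    have n2 : Summable fun j => ‖(expTail k).coeff j * x ^ j‖ := by
      refine h1.summable.congr fun j => ?_
      rw [Real.norm_of_nonneg (mul_nonneg (coeff_expTail_nonneg _ _) (pow_nonneg hx _))]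
    have h2 := tsum_mul_tsum_eq_tsum_sum_antidiagonal_of_summable_norm n1 n2
    rw [ih.tsum_eq, h1.tsum_eq, ← pow_succ] at h2
    rw [h2]
    simp only [e]
    exact (summable_norm_sum_mul_antidiagonal_of_summable_norm n1 n2).of_norm.hasSum

/-- A log-concave sequence lies below the geometric sequence through two consecutive terms. -/
theorem PF2.le_geometric {c : ℕ → ℝ} (hc : PF2 c) {M : ℕ} (h0 : 0 < c M) (h1 : 0 < c (M + 1))
    (j : ℕ) : c j * (c (M + 1) / c M) ^ M ≤ c M * (c (M + 1) / c M) ^ j := by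
  set r := c (M + 1) / c M with hr
  have hr0 : 0 < r := div_pos h1 h0
  have hrM : c (M + 1) = r * c M := by rw [hr, div_mul_cancel₀ _ h0.ne']
  rcases le_total M j with h | h
  · induction j, h using Nat.le_induction with
    | base => exact le_rfl
    | succ j hj ih =>
      have := hc M j 1 hj
      rw [hrM] at this
      have h2 : c (j + 1) ≤ r * c j := by
        have : c M * c (j + 1) ≤ c M * (r * c j) := by linarith
        exact le_of_mul_le_mul_left this h0
      calc c (j + 1) * r ^ M ≤ r * c j * r ^ M := by gcongr
        _ = r * (c j * r ^ M) := by ring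
        _ ≤ r * (c M * r ^ j) := by gcongr
        _ = _ := by ring
  · induction h using Nat.decreasingInduction with
    | self => exact le_rfl
    | of_succ j hj ih =>
      have := hc j M 1 (by omega)
      rw [hrM] at this
      have h2 : r * c j ≤ c (j + 1) := by
        have : c M * (r * c j) ≤ c M * c (j + 1) := by linarith
        exact le_of_mul_le_mul_left this h0
      have h3 : r * (c j * r ^ M) ≤ r * (c M * r ^ j) := by
        calc r * (c j * r ^ M) = r * c j * r ^ M := by ring
          _ ≤ c (j + 1) * r ^ M := by gcongr
          _ ≤ c M * r ^ (j + 1) := ih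
          _ = _ := by ring
      exact le_of_mul_le_mul_left h3 hr0

/-- A saddle point lower bound for the coefficients of `truncExp k ^ n`. -/
theorem truncExp_pow_le_coeff {k n M : ℕ} (hk : 1 ≤ k) (hn : 1 ≤ n) (hM : k * n ≤ M)
    {lam : ℝ} (hl : 0 < lam)
    (hb : lam * truncExp (k - 1) lam / truncExp k lam = (M : ℝ) / n) :
    truncExp k lam ^ n / lam ^ M ≤
      Real.exp 1 * (M + 1) * (expTail k ^ n).coeff M := by
  obtain ⟨n, rfl⟩ : ∃ i, n = i + 1 := ⟨n - 1, by omega⟩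
  have hM0 : 0 < M := lt_of_lt_of_le (Nat.mul_pos (by omega) (by omega)) hM
  set c : ℕ → ℝ := fun j => (expTail k ^ (n + 1)).coeff j with hcdef
  have h0 : 0 < c M := coeff_expTail_pow_pos k n M hM
  have h1 : 0 < c (M + 1) := coeff_expTail_pow_pos k n (M + 1) (by omega)
  set r := c (M + 1) / c M with hr
  have hr0 : 0 < r := div_pos h1 h0
  -- At the point z / r the log-concave series is dominated by a geometric series of ratio z. The
  -- choice z = M / (M + 1) makes that series sum to M + 1 while z^M remains at least 1/e; these two
  -- numbers give the final factor e(M + 1).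
  set z : ℝ := M / (M + 1) with hz
  have hMR : (0 : ℝ) < M := by exact_mod_cast hM0
  have hz0 : 0 < z := by positivity
  have hz1 : z < 1 := by rw [hz, div_lt_one (by positivity)]; linarith
  have hgeo := PF2.le_geometric (PF2_expTail_pow k (n + 1)) h0 h1
  have hx : 0 < z / r := by positivity
  have hs := hasSum_coeff_expTail_pow k (n + 1) hx.le
  have hg := (hasSum_geometric_of_lt_one hz0.le hz1).mul_left (c M / r ^ M)
  have hle : truncExp k (z / r) ^ (n + 1) ≤ c M / r ^ M * (1 - z)⁻¹ := by
    refine hasSum_le (fun j => ?_) hs hg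
    have := hgeo j
    change c j * r ^ M ≤ c M * r ^ j at this
    change c j * (z / r) ^ j ≤ _
    rw [div_pow, div_mul_eq_mul_div, le_div_iff₀ (by positivity), mul_div_assoc',
      div_mul_eq_mul_div, div_le_iff₀ (by positivity)]
    calc c j * z ^ j * r ^ M = c j * r ^ M * z ^ j := by ring
      _ ≤ c M * r ^ j * z ^ j := by gcongr
      _ = _ := by ring
  -- The value of f_k at z / r is unknown, since r is; the saddle-point inequality bounds it below
  -- by f_k(lam) times a power, and r^M then cancels.
  have hsad := truncExp_saddle hk hl hb (show 0 < z / r / lam by positivity)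
  rw [div_mul_cancel₀ _ hl.ne'] at hsad
  have hsad2 : truncExp k lam ^ (n + 1) * (z / r / lam) ^ M ≤ truncExp k (z / r) ^ (n + 1) := by
    have hpos := truncExp_pos k hl
    have := pow_le_pow_left₀ (by positivity) hsad (n + 1)
    rw [mul_pow, ← Real.rpow_natCast (_ ^ (_ : ℝ)), ← Real.rpow_mul (by positivity),
      div_mul_cancel₀ _ (by positivity), Real.rpow_natCast] at this
    exact this
  have h1z : (1 - z)⁻¹ = M + 1 := by
    rw [hz]; field_simp; ring
  have hzM : 1 ≤ Real.exp 1 * z ^ M := by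
    have : (1 / z) ^ M ≤ Real.exp 1 := by
      have h2 : 1 / z = 1 / M + 1 := by rw [hz]; field_simp; ring
      have h3 := Real.add_one_le_exp (1 / (M : ℝ))
      rw [h2]
      calc _ ≤ Real.exp (1 / (M : ℝ)) ^ M := pow_le_pow_left₀ (by positivity) h3 M
        _ = Real.exp 1 := by rw [← Real.exp_nat_mul]; congr 1; field_simp
    rw [one_div, inv_pow, inv_le_iff_one_le_mul₀ (by positivity)] at this
    linarith
  have hfin := hsad2.trans hle
  rw [h1z, div_pow, div_pow] at hfin
  have hpos := truncExp_pos k hl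
  have e1 : truncExp k lam ^ (n + 1) * (z ^ M / r ^ M / lam ^ M)
      = (truncExp k lam ^ (n + 1) / lam ^ M) * z ^ M / r ^ M := by ring
  have e2 : c M / r ^ M * ((M : ℝ) + 1) = c M * (M + 1) / r ^ M := by ring
  rw [e1, e2, div_le_div_iff_of_pos_right (by positivity)] at hfin
  have hT : 0 ≤ truncExp k lam ^ (n + 1) / lam ^ M := by positivity
  calc truncExp k lam ^ (n + 1) / lam ^ M
      ≤ truncExp k lam ^ (n + 1) / lam ^ M * (Real.exp 1 * z ^ M) :=
        le_mul_of_one_le_right hT hzM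
    _ = Real.exp 1 * (truncExp k lam ^ (n + 1) / lam ^ M * z ^ M) := by ring
    _ ≤ Real.exp 1 * (c M * (M + 1)) := by gcongr
    _ = _ := by ring

/-! ### Words with minimum multiplicity k, their number and their exponential moments. -/

section Words
variable {I V : Type*} [Fintype I] [DecidableEq I] [Fintype V] [DecidableEq V]

variable (I V) in
/-- The words in which every letter occurs at least `k` times. -/
def words (k : ℕ) : Finset (I → V) := {x | ∀ v, k ≤ cnt x v}

theorem mem_words {k : ℕ} {x : I → V} : x ∈ words I V k ↔ ∀ v, k ≤ cnt x v := by
  simp [words]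

theorem sum_words_prod (k : ℕ) (φ : V → ℕ → ℝ) :
    ∑ x ∈ words I V k, ∏ v, φ v (cnt x v) =
      ∑ x : I → V, ∏ v, if k ≤ cnt x v then φ v (cnt x v) else 0 := by
  rw [words, Finset.sum_filter]
  refine Finset.sum_congr rfl fun x _ => ?_
  by_cases h : ∀ v, k ≤ cnt x v
  · rw [if_pos h]
    exact Finset.prod_congr rfl fun v _ => (if_pos (h v)).symm
  · rw [if_neg h]
    push Not at h
    obtain ⟨v, hv⟩ := h
    exact (Finset.prod_eq_zero (mem_univ v) (if_neg (not_le.2 hv))).symm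

theorem card_words (k : ℕ) : (#(words I V k) : ℝ) =
    (Fintype.card I).factorial * (expTail k ^ Fintype.card V).coeff (Fintype.card I) := by
  have h := sum_words_prod (I := I) (V := V) k (fun _ _ => (1 : ℝ))
  simp only [Finset.prod_const_one, Finset.sum_const, nsmul_eq_mul, mul_one] at h
  rw [h, sum_prod_cnt (fun (_ : V) j => if k ≤ j then (1 : ℝ) else 0)]
  congr 1
  have h2 := PowerSeries.coeff_prod (fun _ : V => expTail k) (Fintype.card I) univ
  rw [Finset.prod_const, Finset.card_univ] at h2
  rw [h2]
  symm
  refine Finset.sum_bij (fun d _ => (d : V → ℕ)) ?_ ?_ ?_ ?_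
  · intro d hd
    rw [mem_finsuppAntidiag] at hd
    rw [mem_piAntidiag]
    exact ⟨hd.1, fun i _ => mem_univ i⟩
  · intro d _ e _ h
    exact DFunLike.coe_injective h
  · intro d hd
    rw [mem_piAntidiag] at hd
    refine ⟨Finsupp.equivFunOnFinite.symm d, ?_, rfl⟩
    rw [mem_finsuppAntidiag]
    exact ⟨hd.1, subset_univ _⟩
  · intro d _
    refine Finset.prod_congr rfl fun v _ => ?_
    rw [coeff_expTail]
    split_ifs <;> simp

/-- The total Poisson weight `N! lam ^ (-N) f_k(lam) ^ n`. -/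
noncomputable def poissonMass (k N n : ℕ) (lam : ℝ) : ℝ :=
  (N.factorial : ℝ) / lam ^ N * truncExp k lam ^ n

theorem poissonMass_pos (k N n : ℕ) {lam : ℝ} (hl : 0 < lam) : 0 < poissonMass k N n lam := by
  have := truncExp_pos k hl
  unfold poissonMass
  positivity

/-- The ratio of the two sides is the probability that n independent truncated Poisson variables add
up to their mean N. This event costs only a polynomial factor. -/
theorem poissonMass_le_card_words {k : ℕ} (hk : 1 ≤ k) (hn : 1 ≤ Fintype.card V)
    (hN : k * Fintype.card V ≤ Fintype.card I) {lam : ℝ} (hl : 0 < lam)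
    (hb : lam * truncExp (k - 1) lam / truncExp k lam = (Fintype.card I : ℝ) / Fintype.card V) :
    poissonMass k (Fintype.card I) (Fintype.card V) lam ≤
      Real.exp 1 * (Fintype.card I + 1) * #(words I V k) := by
  have h := truncExp_pow_le_coeff hk hn hN hl hb
  rw [card_words, poissonMass, div_mul_eq_mul_div, mul_div_assoc]
  calc _ ≤ ((Fintype.card I).factorial : ℝ) * (Real.exp 1 * (Fintype.card I + 1) *
        (expTail k ^ Fintype.card V).coeff (Fintype.card I)) := by gcongr
    _ = _ := by ring

theorem sum_words_prod_le (k : ℕ) (φ : V → ℕ → ℝ) (hφ : ∀ v j, 0 ≤ φ v j) {lam : ℝ}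
    (hl : 0 < lam) (B : V → ℝ)
    (hB : ∀ v L, ∑ j ∈ range L, (if k ≤ j then φ v j * lam ^ j / j.factorial else 0) ≤ B v) :
    ∑ x ∈ words I V k, ∏ v, φ v (cnt x v) ≤
      (Fintype.card I).factorial / lam ^ (Fintype.card I) * ∏ v, B v := by
  rw [sum_words_prod]
  refine sum_prod_cnt_le (fun v j => if k ≤ j then φ v j else 0) ?_ hl B ?_
  · intro v j

    split_ifs
    · exact hφ v j
    · exact le_rfl
  · intro v L
    refine le_trans (le_of_eq (Finset.sum_congr rfl fun j _ => ?_)) (hB v L)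
    split_ifs <;> simp

theorem prod_ite_mem_const (S : Finset V) (a b : ℝ) :
    ∏ v, (if v ∈ S then a else b) = a ^ #S * b ^ (Fintype.card V - #S) := by
  rw [Finset.prod_ite, Finset.prod_const, Finset.prod_const]
  congr 2
  · congr 1; ext; simp
  · rw [← Finset.card_compl]; congr 1; ext; simp

/-- Giving the letters of S the weight y^j replaces f_k(lam) by f_k(y lam) in their factors, and
`truncExp_mul_le` bounds the quotient. -/
theorem sum_words_pow_le (k : ℕ) {lam : ℝ} (hl : 0 < lam) {y : ℝ} (hy : 1 ≤ y) (S : Finset V) :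
    ∑ x ∈ words I V k, y ^ (∑ v ∈ S, cnt x v) ≤
      poissonMass k (Fintype.card I) (Fintype.card V) lam *
        (y ^ k * Real.exp ((y - 1) * lam)) ^ #S := by
  have hf := truncExp_pos k hl
  have h := sum_words_prod_le (I := I) k (fun v j => if v ∈ S then y ^ j else 1)
    (fun v j => by split_ifs <;> positivity) hl
    (fun v => if v ∈ S then truncExp k (y * lam) else truncExp k lam) (by
      intro v L
      by_cases hv : v ∈ S
      · simp only [if_pos hv]
        refine le_trans (le_of_eq (Finset.sum_congr rfl fun j _ => ?_))
          (sum_range_le_truncExp k (by positivity) L)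
        rw [mul_pow]
      · simp only [if_neg hv, one_mul]
        exact sum_range_le_truncExp k hl.le L)
  rw [prod_ite_mem_const] at h
  have e : ∀ x : I → V, ∏ v, (if v ∈ S then y ^ cnt x v else 1) = y ^ (∑ v ∈ S, cnt x v) := by
    intro x
    rw [Finset.prod_ite_mem, Finset.univ_inter, Finset.prod_pow_eq_pow_sum]
  simp only [e] at h
  refine h.trans ?_
  have h2 := truncExp_mul_le k hy hl.le
  have hc : #S ≤ Fintype.card V := Finset.card_le_univ S
  have h3 : truncExp k (y * lam) ^ #S ≤
      (y ^ k * Real.exp ((y - 1) * lam) * truncExp k lam) ^ #S :=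
    pow_le_pow_left₀ (truncExp_pos k (by positivity)).le h2 _
  calc _ ≤ (Fintype.card I).factorial / lam ^ (Fintype.card I) *
        ((y ^ k * Real.exp ((y - 1) * lam) * truncExp k lam) ^ #S
          * truncExp k lam ^ (Fintype.card V - #S)) := by gcongr
    _ = (Fintype.card I).factorial / lam ^ (Fintype.card I) *
        (truncExp k lam ^ (#S + (Fintype.card V - #S))
          * (y ^ k * Real.exp ((y - 1) * lam)) ^ #S) := by
        rw [mul_pow _ (truncExp k lam), pow_add]; ring
    _ = _ := by rw [Nat.add_sub_cancel' hc, poissonMass]; ring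

/-- Chernoff bound for the total multiplicity of the letters of `S`. -/
theorem card_words_ge_le (k : ℕ) {lam : ℝ} (hl : 0 < lam) (S : Finset V) (H : ℝ) :
    (#{x ∈ words I V k | H ≤ ((∑ v ∈ S, cnt x v : ℕ) : ℝ)} : ℝ) ≤
      poissonMass k (Fintype.card I) (Fintype.card V) lam *
        (2 ^ k * Real.exp lam) ^ #S * (2 : ℝ) ^ (-H) := by
  have h := sum_words_pow_le (I := I) k hl (one_le_two) S
  rw [show ((2 : ℝ) - 1) * lam = lam by ring] at h
  rw [Real.rpow_neg (by norm_num), ← div_eq_mul_inv, le_div_iff₀ (by positivity)]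
  refine le_trans ?_ h
  rw [← nsmul_eq_mul, ← Finset.sum_const]
  refine (Finset.sum_le_sum fun x hx => ?_).trans
    (Finset.sum_le_sum_of_subset_of_nonneg (Finset.filter_subset _ _) fun _ _ _ => by positivity)
  rw [← Real.rpow_natCast 2]
  exact Real.rpow_le_rpow_of_exponent_le (by norm_num) (Finset.mem_filter.1 hx).2

/-- Words with a prescribed part: the prescribed letters lie in `S`. -/
theorem card_words_prescribed_le (k : ℕ) {lam : ℝ} (hl : 0 < lam) (Q : Finset I) (τ : I → V)
    (S : Finset V) (hτ : ∀ p ∈ Q, τ p ∈ S) :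
    (#{x ∈ words I V k | ∀ p ∈ Q, x p = τ p} : ℝ) ≤
      (Fintype.card I - #Q).factorial / lam ^ (Fintype.card I - #Q) *
        (Real.exp lam ^ #S * truncExp k lam ^ (Fintype.card V - #S)) := by
  -- Only the free positions are summed over. A letter of S may receive its required occurrences
  -- from the prescribed positions, so its lower bound k is dropped and its factor becomes e^lam
  -- instead of f_k(lam).
  have h := sum_prod_cnt_le (I := {p // p ∉ Q}) (fun (v : V) j => if v ∈ S then (1 : ℝ) else
      if k ≤ j then 1 else 0) (fun v j => by split_ifs <;> norm_num) hl
    (fun v => if v ∈ S then Real.exp lam else truncExp k lam) (by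
      intro v L
      by_cases hv : v ∈ S
      · simp only [if_pos hv, one_mul]
        refine le_trans (le_of_eq (Finset.sum_congr rfl fun j _ => ?_))
          ((sum_range_le_truncExp 0 hl.le L).trans_eq (truncExp_zero lam))
        rw [if_pos (Nat.zero_le j)]
      · simp only [if_neg hv]
        refine le_trans (le_of_eq (Finset.sum_congr rfl fun j _ => ?_))
          (sum_range_le_truncExp k hl.le L)
        split_ifs <;> simp)
  have hc : Fintype.card {p // p ∉ Q} = Fintype.card I - #Q := by
    rw [Fintype.card_subtype_compl, Fintype.card_coe]
  rw [prod_ite_mem_const, hc] at h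
  refine le_trans ?_ h
  have e : ∀ y : {p // p ∉ Q} → V, ∏ v, (if v ∈ S then (1 : ℝ) else if k ≤ cnt y v then 1 else 0)
      = if ∀ v, v ∉ S → k ≤ cnt y v then 1 else 0 := by
    intro y
    split_ifs with hy
    · refine Finset.prod_eq_one fun v _ => ?_
      by_cases hv : v ∈ S
      · rw [if_pos hv]
      · rw [if_neg hv, if_pos (hy v hv)]
    · push Not at hy
      obtain ⟨v, hv, hv2⟩ := hy
      refine Finset.prod_eq_zero (mem_univ v) ?_
      rw [if_neg hv, if_neg (not_le.2 hv2)]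
  simp only [e]
  rw [Finset.sum_boole]
  norm_cast
  refine Finset.card_le_card_of_injOn (fun x p => x p.1) ?_ ?_
  · intro x hx
    rw [Finset.mem_coe, Finset.mem_filter, mem_words] at hx
    rw [Finset.mem_coe, Finset.mem_filter]
    refine ⟨mem_univ _, fun v hv => (hx.1 v).trans ?_⟩
    unfold cnt
    refine Finset.card_le_card_of_surjOn (fun p => p.1) ?_
    intro p hp
    rw [Finset.mem_coe, Finset.mem_filter] at hp
    have hpQ : p ∉ Q := fun hq => hv (by rw [← hp.2, hx.2 p hq]; exact hτ p hq)
    exact ⟨⟨p, hpQ⟩, by simpa using hp.2, rfl⟩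
  · intro x hx y hy hxy
    rw [Finset.mem_coe, Finset.mem_filter] at hx hy
    funext p
    by_cases hp : p ∈ Q
    · rw [hx.2 p hp, hy.2 p hp]
    · exact congrFun hxy ⟨p, hp⟩

/-- Words with large letter multiplicities in the mean square sense, none above `D`. -/
theorem card_words_sq_le (k : ℕ) {lam : ℝ} (hl : 0 < lam) {D : ℕ} (hD : 1 ≤ D) (A : ℝ) :
    (#{x ∈ words I V k | (∀ v, cnt x v ≤ D) ∧ A * Fintype.card V < ((∑ v, cnt x v ^ 2 : ℕ) : ℝ)} : ℝ)
      ≤ poissonMass k (Fintype.card I) (Fintype.card V) lam *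
        Real.exp ((Real.exp 2 ^ k * Real.exp ((Real.exp 2 - 1) * lam) - A) *
          Fintype.card V / D) := by
  have hf := truncExp_pos k hl
  have hD0 : (0 : ℝ) < D := by exact_mod_cast hD
  set K := Real.exp 2 ^ k * Real.exp ((Real.exp 2 - 1) * lam)
  set n := Fintype.card V
  have hj : ∀ j : ℕ, (j : ℝ) ^ 2 ≤ Real.exp j := by
    intro j
    have h0 : (0 : ℝ) ≤ j := Nat.cast_nonneg j
    have h1 := Real.add_one_le_exp ((j : ℝ) / 2 - 1)
    have h2 : (j : ℝ) / 2 * Real.exp 1 ≤ Real.exp (j / 2) := by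
      calc (j : ℝ) / 2 * Real.exp 1 ≤ Real.exp (j / 2 - 1) * Real.exp 1 := by
            gcongr; linarith
        _ = _ := by rw [← Real.exp_add]; congr 1; ring
    have h3 : (j : ℝ) ≤ Real.exp (j / 2) := by
      have := Real.add_one_le_exp (1 : ℝ)
      nlinarith
    calc (j : ℝ) ^ 2 ≤ Real.exp (j / 2) ^ 2 := pow_le_pow_left₀ h0 h3 2
      _ = _ := by rw [← Real.exp_nat_mul]; congr 1; push_cast; ring
  -- Exponential Markov for the sum of squares at scale 1/D. The cut-off j ≤ D makes j²/D at most j,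
  -- so e^(j²/D) ≤ 1 + e^(2j)/D, and a letter contributes at most f_k(lam)(1 + K/D).
  have h := sum_words_prod_le (I := I) k
    (fun (_ : V) j => if j ≤ D then Real.exp ((j : ℝ) ^ 2 / D) else 0)
    (fun v j => by split_ifs <;> positivity) hl
    (fun _ => truncExp k lam + truncExp k (Real.exp 2 * lam) / D) (by
      intro v L
      have hterm : ∀ j ∈ range L,
          (if k ≤ j then (if j ≤ D then Real.exp ((j : ℝ) ^ 2 / D) else 0) * lam ^ j / j.factorial
            else 0) ≤ (if k ≤ j then lam ^ j / (j.factorial : ℝ) else 0) +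
            (if k ≤ j then (Real.exp 2 * lam) ^ j / (j.factorial : ℝ) else 0) / D := by
        intro j _
        by_cases hk : k ≤ j
        · simp only [if_pos hk]
          have hφ : (if j ≤ D then Real.exp ((j : ℝ) ^ 2 / D) else 0) ≤
              1 + Real.exp 2 ^ j / D := by
            split_ifs with hjD
            · set u := (j : ℝ) ^ 2 / D with hu
              have hu0 : 0 ≤ u := by positivity
              have h1 : Real.exp u ≤ 1 + u * Real.exp u := by
                have := Real.add_one_le_exp (-u)
                have h2 : Real.exp (-u) * Real.exp u = 1 := by rw [← Real.exp_add]; simp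
                nlinarith [Real.exp_pos u]
              have hle : (j : ℝ) ≤ D := by exact_mod_cast hjD
              have h2 : u ≤ j := by
                rw [hu, div_le_iff₀ hD0, sq]
                exact mul_le_mul_of_nonneg_left hle (Nat.cast_nonneg j)
              have h3 : u * Real.exp u ≤ Real.exp 2 ^ j / D := by
                calc u * Real.exp u ≤ Real.exp j / D * Real.exp j := by
                      rw [hu]
                      have := hj j
                      gcongr
                  _ = _ := by
                      rw [div_mul_eq_mul_div, ← Real.exp_add, ← Real.exp_nat_mul]
                      congr 2; ring
              linarith
            · positivity
          rw [mul_pow, mul_div_assoc]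
          calc _ ≤ (1 + Real.exp 2 ^ j / D) * (lam ^ j / (j.factorial : ℝ)) := by gcongr
            _ = _ := by ring
        · simp [if_neg hk]
      refine (Finset.sum_le_sum hterm).trans ?_
      rw [Finset.sum_add_distrib, ← Finset.sum_div]
      gcongr
      · exact sum_range_le_truncExp k hl.le L
      · exact sum_range_le_truncExp k (by positivity) L)
  rw [Finset.prod_const, Finset.card_univ] at h
  have hB : (truncExp k lam + truncExp k (Real.exp 2 * lam) / D) ^ n ≤
      truncExp k lam ^ n * Real.exp (K * n / D) := by
    have h1 := truncExp_mul_le k (Real.one_le_exp (by norm_num : (0 : ℝ) ≤ 2)) hl.le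
    have h2 : truncExp k lam + truncExp k (Real.exp 2 * lam) / D ≤
        truncExp k lam * Real.exp (K / D) := by
      have h3 := Real.add_one_le_exp (K / D)
      calc _ ≤ truncExp k lam + K * truncExp k lam / D := by gcongr
        _ = truncExp k lam * (K / D + 1) := by ring
        _ ≤ _ := by gcongr
    calc _ ≤ (truncExp k lam * Real.exp (K / D)) ^ n :=
          pow_le_pow_left₀ (by have := truncExp_pos k (mul_pos (Real.exp_pos 2) hl); positivity) h2 n
      _ = _ := by rw [mul_pow, ← Real.exp_nat_mul]; congr 2; ring
  have hlow : (#{x ∈ words I V k | (∀ v, cnt x v ≤ D) ∧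
      A * n < ((∑ v, cnt x v ^ 2 : ℕ) : ℝ)} : ℝ) * Real.exp (A * n / D) ≤
      ∑ x ∈ words I V k, ∏ v, (if cnt x v ≤ D then Real.exp ((cnt x v : ℝ) ^ 2 / D) else 0) := by
    rw [← nsmul_eq_mul, ← Finset.sum_const]
    refine (Finset.sum_le_sum fun x hx => ?_).trans
      (Finset.sum_le_sum_of_subset_of_nonneg (Finset.filter_subset _ _) fun x _ _ =>
        Finset.prod_nonneg fun v _ => by split_ifs <;> positivity)
    have hx2 := (Finset.mem_filter.1 hx).2
    rw [Finset.prod_congr rfl fun v _ => if_pos (hx2.1 v), ← Real.exp_sum, ← Finset.sum_div]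
    refine Real.exp_le_exp.2 ?_
    gcongr
    have := hx2.2.le
    push_cast at this
    exact this
  have h4 := (hlow.trans h).trans (mul_le_mul_of_nonneg_left hB (by positivity))
  rw [← le_div_iff₀ (Real.exp_pos _)] at h4
  refine h4.trans_eq ?_
  rw [poissonMass, sub_mul, sub_div, Real.exp_sub]
  ring

end Words

/-! ### Exchangeability of the positions. -/

section Perm
variable {I V : Type*} [Fintype I] [DecidableEq I] [Fintype V] [DecidableEq V]

/-- A set of words closed under permuting the positions. -/
def PermInvariant (W : Finset (I → V)) : Prop :=
  ∀ σ : Equiv.Perm I, ∀ x ∈ W, x ∘ σ ∈ W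

theorem cnt_comp_perm (x : I → V) (σ : Equiv.Perm I) : cnt (x ∘ σ) = cnt x := by
  funext v
  unfold cnt
  exact Finset.card_bij (fun p _ => σ p) (by simp) (fun _ _ _ _ h => σ.injective h)
    (fun p hp => ⟨σ.symm p, by simpa using hp, by simp⟩)

/-- Positions are prescribed one at a time. Swapping the new position p with a position q outside Q
frees p and plants the letter τ p at q. There are at least R choices of q, while in the resulting
word at most D positions carry τ p, so each prescription costs D/R. -/
theorem card_prescribed_mul_le {W : Finset (I → V)} (hW : PermInvariant W) {D : ℕ}
    (hD : ∀ x ∈ W, ∀ v, cnt x v ≤ D) (Q : Finset I) (τ : I → V) (R : ℕ)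
    (hR : R + #Q ≤ Fintype.card I) :
    #{x ∈ W | ∀ p ∈ Q, x p = τ p} * R ^ #Q ≤ D ^ #Q * #W := by
  induction Q using Finset.induction_on with
  | empty => simp
  | insert p Q hp ih =>
    rw [Finset.card_insert_of_notMem hp] at hR ⊢
    have ih := ih (by omega)
    have key : #{x ∈ W | ∀ q ∈ insert p Q, x q = τ q} * R ≤
        #{x ∈ W | ∀ q ∈ Q, x q = τ q} * D := by
      have h1 : #{x ∈ W | ∀ q ∈ insert p Q, x q = τ q} * R ≤
          #({x ∈ W | ∀ q ∈ insert p Q, x q = τ q} ×ˢ Qᶜ) := by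
        rw [Finset.card_product, Finset.card_compl]
        exact Nat.mul_le_mul_left _ (by omega)
      refine h1.trans ?_
      have h2 : #(({x ∈ W | ∀ q ∈ Q, x q = τ q}).sigma
          fun y => ({q | y q = τ p} : Finset I)) ≤ #{x ∈ W | ∀ q ∈ Q, x q = τ q} * D := by
        rw [Finset.card_sigma, ← smul_eq_mul]
        exact Finset.sum_le_card_nsmul _ _ _ fun y hy => hD y (Finset.mem_filter.1 hy).1 (τ p)
      refine le_trans ?_ h2
      refine Finset.card_le_card_of_injOn
        (fun z => ⟨z.1 ∘ Equiv.swap p z.2, z.2⟩) ?_ ?_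
      · rintro ⟨x, q⟩ hz
        simp only [Finset.coe_product, Set.mem_prod, Finset.mem_coe, Finset.mem_filter,
          Finset.mem_compl] at hz
        simp only [Finset.coe_sigma, Set.mem_sigma_iff, Finset.mem_coe, Finset.mem_filter,
          Finset.mem_univ, true_and]
        refine ⟨⟨hW _ _ hz.1.1, fun r hr => ?_⟩, ?_⟩
        · have h1 : r ≠ p := fun h => hp (h ▸ hr)
          have h2 : r ≠ q := fun h => hz.2 (h ▸ hr)
          rw [Function.comp_apply, Equiv.swap_apply_of_ne_of_ne h1 h2]
          exact hz.1.2 r (Finset.mem_insert_of_mem hr)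
        · rw [Function.comp_apply, Equiv.swap_apply_right]
          exact hz.1.2 p (Finset.mem_insert_self _ _)
      · rintro ⟨x, q⟩ _ ⟨y, r⟩ _ h
        simp only [Sigma.mk.injEq, heq_eq_eq] at h
        obtain ⟨h1, rfl⟩ := h
        congr 1
        funext s
        have := congrFun h1 (Equiv.swap p q s)
        simpa using this
    calc _ = #{x ∈ W | ∀ q ∈ insert p Q, x q = τ q} * R * R ^ #Q := by ring
      _ ≤ #{x ∈ W | ∀ q ∈ Q, x q = τ q} * D * R ^ #Q := Nat.mul_le_mul_right _ key
      _ = (#{x ∈ W | ∀ q ∈ Q, x q = τ q} * R ^ #Q) * D := by ring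
      _ ≤ D ^ #Q * #W * D := Nat.mul_le_mul_right _ ih
      _ = _ := by ring

/-- The count does not depend on the chosen positions, because permutations act transitively on
embeddings of `Fin a`; averaging over all embeddings then exchanges positions for a statistic of
each single word. -/
theorem card_pattern_mul_eq {W : Finset (I → V)} (hW : PermInvariant W) {a : ℕ}
    (R : (Fin a → V) → Prop) [DecidablePred R] (η : Fin a ↪ I) :
    #{x ∈ W | R (x ∘ η)} * (Fintype.card I).descFactorial a =
      ∑ x ∈ W, #{θ : Fin a ↪ I | R (x ∘ θ)} := by
  have h1 : ∀ θ : Fin a ↪ I, #{x ∈ W | R (x ∘ θ)} = #{x ∈ W | R (x ∘ η)} := by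
    have : ∀ θ η : Fin a ↪ I, #{x ∈ W | R (x ∘ θ)} ≤ #{x ∈ W | R (x ∘ η)} := by
      intro θ η
      obtain ⟨σ, hσ⟩ := (Equiv.Perm.isMultiplyPretransitive I a).exists_smul_eq η θ
      have hσ' : ∀ i, σ (η i) = θ i := fun i => by
        have := DFunLike.congr_fun hσ i
        simpa using this
      refine Finset.card_le_card_of_injOn (fun x => x ∘ σ) ?_ ?_
      · intro x hx
        rw [Finset.mem_coe, Finset.mem_filter] at hx ⊢
        refine ⟨hW σ x hx.1, ?_⟩
        have : (x ∘ σ) ∘ η = x ∘ θ := by funext i; simp [hσ' i]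
        rw [this]; exact hx.2
      · intro x _ y _ h
        exact σ.surjective.injective_comp_right h
    exact fun θ => le_antisymm (this θ η) (this η θ)
  have h2 : ∑ x ∈ W, #{θ : Fin a ↪ I | R (x ∘ θ)} =
      ∑ θ : Fin a ↪ I, #{x ∈ W | R (x ∘ θ)} := by
    simp only [Finset.card_filter]
    exact Finset.sum_comm
  rw [h2, Finset.sum_congr rfl fun θ _ => h1 θ, Finset.sum_const, Finset.card_univ,
    Fintype.card_embedding_eq, Fintype.card_fin, smul_eq_mul, mul_comm]

theorem card_pairs_eq (x : I → V) : #{p : I × I | x p.1 = x p.2} = ∑ v, cnt x v ^ 2 := by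
  have h : ({p : I × I | x p.1 = x p.2} : Finset (I × I)) =
      (univ : Finset V).biUnion fun v => ({p | x p = v} : Finset I) ×ˢ ({p | x p = v} : Finset I) := by
    ext p
    simp [eq_comm]
  rw [h, Finset.card_biUnion]
  · refine Finset.sum_congr rfl fun v _ => ?_
    rw [Finset.card_product, sq]; rfl
  · intro v _ w _ hvw
    rw [Function.onFun, Finset.disjoint_left]
    intro p hp hq
    simp only [Finset.mem_product, Finset.mem_filter, Finset.mem_univ, true_and] at hp hq
    exact hvw (hp.1.symm.trans hq.1)

theorem card_eq_pair_mul_le {W : Finset (I → V)} (hW : PermInvariant W) {T : ℕ}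
    (hT : ∀ x ∈ W, ∑ v, cnt x v ^ 2 ≤ T) {p q : I} (hpq : p ≠ q) :
    #{x ∈ W | x p = x q} * (Fintype.card I).descFactorial 2 ≤ T * #W := by
  let η : Fin 2 ↪ I := ⟨![p, q], by
    intro i j; fin_cases i <;> fin_cases j <;> simp [hpq, hpq.symm]⟩
  have h := card_pattern_mul_eq hW (fun u : Fin 2 → V => u 0 = u 1) η
  have e : #{x ∈ W | x p = x q} = #{x ∈ W | (x ∘ η) 0 = (x ∘ η) 1} := rfl
  rw [e, h, mul_comm, ← smul_eq_mul]
  refine Finset.sum_le_card_nsmul _ _ _ fun x hx => le_trans ?_ (hT x hx)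
  rw [← card_pairs_eq]
  refine Finset.card_le_card_of_injOn (fun θ => (θ 0, θ 1)) ?_ ?_
  · intro θ hθ
    simpa using hθ
  · intro θ _ θ' _ h
    simp only [Prod.mk.injEq] at h
    ext i; fin_cases i
    · exact h.1
    · exact h.2

/-- Within a word the number of quadruples with both coincidences is at most the square of the
number of coinciding pairs, once the distinctness between the two pairs is forgotten. -/
theorem card_eq_two_pairs_mul_le {W : Finset (I → V)} (hW : PermInvariant W) {T : ℕ}
    (hT : ∀ x ∈ W, ∑ v, cnt x v ^ 2 ≤ T) {p q r s : I} (hpq : p ≠ q) (hpr : p ≠ r) (hps : p ≠ s)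
    (hqr : q ≠ r) (hqs : q ≠ s) (hrs : r ≠ s) :
    #{x ∈ W | x p = x q ∧ x r = x s} * (Fintype.card I).descFactorial 4 ≤ T ^ 2 * #W := by
  let η : Fin 4 ↪ I := ⟨![p, q, r, s], by
    intro i j; fin_cases i <;> fin_cases j <;>
      simp [hpq, hpr, hps, hqr, hqs, hrs, hpq.symm, hpr.symm, hps.symm, hqr.symm, hqs.symm,
        hrs.symm]⟩
  have h := card_pattern_mul_eq hW (fun u : Fin 4 → V => u 0 = u 1 ∧ u 2 = u 3) η
  have e : #{x ∈ W | x p = x q ∧ x r = x s} =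
    #{x ∈ W | (x ∘ η) 0 = (x ∘ η) 1 ∧ (x ∘ η) 2 = (x ∘ η) 3} := rfl
  rw [e, h, mul_comm (T ^ 2), ← smul_eq_mul]
  refine Finset.sum_le_card_nsmul _ _ _ fun x hx => le_trans ?_ (Nat.pow_le_pow_left (hT x hx) 2)
  rw [← card_pairs_eq, sq, ← Finset.card_product]
  refine Finset.card_le_card_of_injOn (fun θ => ((θ 0, θ 1), (θ 2, θ 3))) ?_ ?_
  · intro θ hθ
    simpa using hθ
  · intro θ _ θ' _ h
    simp only [Prod.mk.injEq] at h
    ext i; fin_cases i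
    · exact h.1.1
    · exact h.1.2
    · exact h.2.1
    · exact h.2.2

end Perm

/-! ### Loops and repeated edges: their mean number. -/

section Bad
variable {ι V : Type*} [Fintype ι] [DecidableEq ι] [Fintype V] [DecidableEq V]

/-- The `i`-th edge of the multigraph encoded by a word. -/
def edge (x : ι × Bool → V) (i : ι) : Sym2 V := s(x (i, false), x (i, true))

/-- The indices of the loops and of the repeated edges. -/
def badSet (x : ι × Bool → V) : Finset ι :=
  {i | x (i, false) = x (i, true) ∨ ∃ j, j ≠ i ∧ edge x j = edge x i}

theorem mem_badSet {x : ι × Bool → V} {i : ι} : i ∈ badSet x ↔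
    x (i, false) = x (i, true) ∨ ∃ j, j ≠ i ∧ edge x j = edge x i := by
  simp [badSet]

theorem sum_card_badSet_le (W : Finset (ι × Bool → V)) :
    ∑ x ∈ W, #(badSet x) ≤
      ∑ i : ι, (#{x ∈ W | x (i, false) = x (i, true)} +
        ∑ j ∈ univ.erase i, (#{x ∈ W | x (i, false) = x (j, false) ∧ x (i, true) = x (j, true)} +
          #{x ∈ W | x (i, false) = x (j, true) ∧ x (i, true) = x (j, false)})) := by
  have h1 : ∀ x ∈ W, #(badSet x) ≤ ∑ i : ι, ((if x (i, false) = x (i, true) then 1 else 0) +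
      ∑ j ∈ univ.erase i, ((if x (i, false) = x (j, false) ∧ x (i, true) = x (j, true) then 1 else 0)
        + (if x (i, false) = x (j, true) ∧ x (i, true) = x (j, false) then 1 else 0))) := by
    intro x _
    rw [badSet, Finset.card_filter]
    refine Finset.sum_le_sum fun i _ => ?_
    split_ifs with h h2 h2
    · exact Nat.le_add_right _ _
    · obtain ⟨j, hj, he⟩ := h.resolve_left h2
      rw [zero_add]
      have hm : j ∈ univ.erase i := Finset.mem_erase.2 ⟨hj, mem_univ _⟩
      refine le_trans ?_ (Finset.single_le_sum (f := fun j =>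
        ((if x (i, false) = x (j, false) ∧ x (i, true) = x (j, true) then 1 else 0)
        + (if x (i, false) = x (j, true) ∧ x (i, true) = x (j, false) then 1 else 0)))
        (fun _ _ => Nat.zero_le _) hm)
      simp only [edge, Sym2.eq_iff] at he
      rcases he with he | he
      · rw [if_pos ⟨he.1.symm, he.2.symm⟩]; omega
      · rw [if_pos (⟨he.2.symm, he.1.symm⟩ : x (i, false) = x (j, true) ∧ x (i, true) = x (j, false))]
        omega
    · exact Nat.zero_le _
    · exact Nat.zero_le _
  refine (Finset.sum_le_sum h1).trans (le_of_eq ?_)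
  rw [Finset.sum_comm]
  refine Finset.sum_congr rfl fun i _ => ?_
  rw [Finset.sum_add_distrib, Finset.sum_comm, Finset.card_filter]
  congr 1
  refine Finset.sum_congr rfl fun j _ => ?_
  rw [Finset.sum_add_distrib, Finset.card_filter, Finset.card_filter]

/-- The mean number of bad indices is bounded. -/
theorem mean_card_badSet_le {W : Finset (ι × Bool → V)} (hW : PermInvariant W) {T : ℕ}
    (hT : ∀ x ∈ W, ∑ v, cnt x v ^ 2 ≤ T) (hm : 2 ≤ Fintype.card ι) {A : ℝ} (hA : 0 ≤ A)
    (hTA : (T : ℝ) ≤ A * (2 * Fintype.card ι)) :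
    ((∑ x ∈ W, #(badSet x) : ℕ) : ℝ) ≤ (A + 6 * A ^ 2) * #W := by
  set m := Fintype.card ι with hmdef
  have hI : Fintype.card (ι × Bool) = 2 * m := by simp [hmdef, mul_comm]
  have hmR : (2 : ℝ) ≤ m := by exact_mod_cast hm
  have hd2 : (((2 * m).descFactorial 2 : ℕ) : ℝ) = 2 * m * (2 * m - 1) := by
    obtain ⟨u, hu⟩ : ∃ u, 2 * m = u + 2 := ⟨2 * m - 2, by omega⟩
    have hu' : (2 * m : ℝ) = u + 2 := by exact_mod_cast hu
    rw [hu, hu']; simp [Nat.descFactorial]; ring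
  have hd4 : (((2 * m).descFactorial 4 : ℕ) : ℝ) = 2 * m * (2 * m - 1) * (2 * m - 2) * (2 * m - 3) := by
    obtain ⟨u, hu⟩ : ∃ u, 2 * m = u + 4 := ⟨2 * m - 4, by omega⟩
    have hu' : (2 * m : ℝ) = u + 4 := by exact_mod_cast hu
    rw [hu, hu']; simp [Nat.descFactorial]; ring
  have hW0 : (0 : ℝ) ≤ #W := Nat.cast_nonneg _
  have hT0 : (0 : ℝ) ≤ T := Nat.cast_nonneg _
  have hloop : ∀ i : ι, (#{x ∈ W | x (i, false) = x (i, true)} : ℝ) ≤ A * #W / m := by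
    intro i
    have h := card_eq_pair_mul_le hW hT (p := (i, false)) (q := (i, true)) (by simp)
    rw [hI] at h
    have h' : (#{x ∈ W | x (i, false) = x (i, true)} : ℝ) * (2 * m * (2 * m - 1)) ≤ T * #W := by
      rw [← hd2]; exact_mod_cast h
    rw [le_div_iff₀ (by linarith)]
    set c : ℝ := (#{x ∈ W | x (i, false) = x (i, true)} : ℝ)
    have hc : 0 ≤ c := Nat.cast_nonneg _
    have h1 : c * m * (2 * m) ≤ A * #W * (2 * m) := by
      calc c * m * (2 * m) ≤ c * (2 * m * (2 * m - 1)) := by nlinarith [mul_nonneg hc (by linarith : (0:ℝ) ≤ m)]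
        _ ≤ T * #W := h'
        _ ≤ A * (2 * m) * #W := by gcongr
        _ = _ := by ring
    exact le_of_mul_le_mul_right h1 (by linarith)
  have hfour : ∀ c : ℕ, c * (2 * m).descFactorial 4 ≤ T ^ 2 * #W → (c : ℝ) ≤ 3 * A ^ 2 * #W / m ^ 2 := by
    intro c h
    have h' : (c : ℝ) * (2 * m * (2 * m - 1) * (2 * m - 2) * (2 * m - 3)) ≤ T ^ 2 * #W := by
      rw [← hd4]; exact_mod_cast h
    rw [le_div_iff₀ (by positivity)]
    have hc : (0 : ℝ) ≤ c := Nat.cast_nonneg _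
    -- The bound 4/3 against T² ≤ 4A²m² is what produces the constant 3; the smallest factor 2m - 3
    -- ≥ m/2 uses m ≥ 2.
    have h2 : (m : ℝ) ^ 4 * (4 / 3) ≤ 2 * m * (2 * m - 1) * (2 * m - 2) * (2 * m - 3) := by
      have a1 : (3 / 2 : ℝ) * m ≤ 2 * m - 1 := by linarith
      have a2 : (m : ℝ) ≤ 2 * m - 2 := by linarith
      have a3 : (1 / 2 : ℝ) * m ≤ 2 * m - 3 := by linarith
      calc (m : ℝ) ^ 4 * (4 / 3) ≤ 2 * m * (3 / 2 * m) * m * (1 / 2 * m) := by nlinarith [pow_pos (by linarith : (0:ℝ) < m) 4]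
        _ ≤ _ := by
          have b1 : (0 : ℝ) ≤ 2 * m - 1 := by linarith
          have b2 : (0 : ℝ) ≤ 2 * m - 2 := by linarith
          gcongr
    have h1 : (c : ℝ) * m ^ 2 * ((m : ℝ) ^ 2 * (4 / 3)) ≤ 3 * A ^ 2 * #W * ((m : ℝ) ^ 2 * (4 / 3)) := by
      calc (c : ℝ) * m ^ 2 * ((m : ℝ) ^ 2 * (4 / 3)) = (c : ℝ) * ((m : ℝ) ^ 4 * (4 / 3)) := by ring
        _ ≤ (c : ℝ) * (2 * m * (2 * m - 1) * (2 * m - 2) * (2 * m - 3)) := by gcongr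
        _ ≤ (T : ℝ) ^ 2 * #W := h'
        _ ≤ (A * (2 * m)) ^ 2 * #W := by gcongr
        _ = 3 * A ^ 2 * #W * ((m : ℝ) ^ 2 * (4 / 3)) := by ring
    exact le_of_mul_le_mul_right h1 (by positivity)
  have h := sum_card_badSet_le W
  have h' : ((∑ x ∈ W, #(badSet x) : ℕ) : ℝ) ≤ _ := Nat.cast_le.2 h
  refine h'.trans ?_
  push_cast
  have hin : ∀ i : ι, ((#{x ∈ W | x (i, false) = x (i, true)} : ℝ) +
        ∑ j ∈ univ.erase i, ((#{x ∈ W | x (i, false) = x (j, false) ∧ x (i, true) = x (j, true)} : ℝ) +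
          (#{x ∈ W | x (i, false) = x (j, true) ∧ x (i, true) = x (j, false)} : ℝ))) ≤
      A * #W / m + m * (6 * A ^ 2 * #W / m ^ 2) := by
    intro i
    refine add_le_add (hloop i) ?_
    have hterm : ∀ j ∈ univ.erase i,
        ((#{x ∈ W | x (i, false) = x (j, false) ∧ x (i, true) = x (j, true)} : ℝ) +
          (#{x ∈ W | x (i, false) = x (j, true) ∧ x (i, true) = x (j, false)} : ℝ))
          ≤ 6 * A ^ 2 * #W / m ^ 2 := by
      intro j hj
      have hne : i ≠ j := (Finset.mem_erase.1 hj).1.symm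
      have h1 := card_eq_two_pairs_mul_le hW hT (p := (i, false)) (q := (j, false))
        (r := (i, true)) (s := (j, true)) (by simp [hne]) (by simp) (by simp) (by simp)
        (by simp) (by simp [hne])
      have h2 := card_eq_two_pairs_mul_le hW hT (p := (i, false)) (q := (j, true))
        (r := (i, true)) (s := (j, false)) (by simp) (by simp) (by simp [hne]) (by simp [hne.symm])
        (by simp) (by simp)
      rw [hI] at h1 h2
      have h3 := hfour _ h1
      have h4 := hfour _ h2
      calc _ ≤ 3 * A ^ 2 * #W / m ^ 2 + 3 * A ^ 2 * #W / m ^ 2 := add_le_add h3 h4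
        _ = _ := by ring
    refine (Finset.sum_le_card_nsmul _ _ _ hterm).trans ?_
    rw [nsmul_eq_mul]
    have : (#(univ.erase i) : ℝ) ≤ m := by
      exact_mod_cast (Finset.card_le_univ _)
    gcongr
  refine (Finset.sum_le_card_nsmul _ _ _ fun i _ => hin i).trans (le_of_eq ?_)
  rw [nsmul_eq_mul, Finset.card_univ, ← hmdef]
  field_simp

end Bad

/-! ### Switchings that remove bad edges. -/

section Switch
variable {ι V : Type*} [Fintype ι] [DecidableEq ι] [Fintype V] [DecidableEq V]

/-- The neighbours of `a` in the multigraph encoded by `x`. -/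
def nbr (x : ι × Bool → V) (a : V) : Finset V :=
  ({p | x p = a} : Finset (ι × Bool)).image fun p => x (p.1, !p.2)

theorem card_nbr_le (x : ι × Bool → V) (a : V) : #(nbr x a) ≤ cnt x a := Finset.card_image_le

theorem mem_nbr_of_edge_eq {x : ι × Bool → V} {i : ι} {a v : V} (h : edge x i = s(a, v)) :
    v ∈ nbr x a := by
  rw [edge, Sym2.eq_iff] at h
  rw [nbr, Finset.mem_image]
  rcases h with h | h
  · exact ⟨(i, false), by simpa using h.1, h.2⟩
  · exact ⟨(i, true), by simpa using h.2, h.1⟩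

theorem card_letter_mem_le (x : ι × Bool → V) (U : Finset V) (b : Bool) {D : ℕ}
    (hD : ∀ v, cnt x v ≤ D) : #{j : ι | x (j, b) ∈ U} ≤ #U * D := by
  have h1 : #{j : ι | x (j, b) ∈ U} ≤ ∑ u ∈ U, #{p : ι × Bool | x p = u} := by
    rw [← Finset.card_biUnion]
    · refine Finset.card_le_card_of_injOn (fun j => (j, b)) ?_ ?_
      · intro j hj
        simpa using hj
      · intro j _ j' _ h
        exact (Prod.mk.inj h).1
    · intro u _ w _ huw
      rw [Function.onFun, Finset.disjoint_left]
      intro p hp hq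
      simp only [Finset.mem_filter, Finset.mem_univ, true_and] at hp hq
      exact huw (hp.symm.trans hq)
  refine h1.trans ?_
  rw [← smul_eq_mul]
  exact Finset.sum_le_card_nsmul _ _ _ fun u _ => hD u

/-- Exchanging one endpoint of the edges `i` and `j`. -/
def switchWord (x : ι × Bool → V) (i j : ι) : ι × Bool → V :=
  x ∘ Equiv.swap (i, true) (j, false)

section
variable {x : ι × Bool → V} {i j : ι}

theorem switchWord_left_false (hij : i ≠ j) : switchWord x i j (i, false) = x (i, false) := by
  rw [switchWord, Function.comp_apply, Equiv.swap_apply_of_ne_of_ne] <;> simp [hij]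

theorem switchWord_right_true (hij : i ≠ j) : switchWord x i j (j, true) = x (j, true) := by
  rw [switchWord, Function.comp_apply, Equiv.swap_apply_of_ne_of_ne] <;> simp [hij.symm]

theorem switchWord_left_true : switchWord x i j (i, true) = x (j, false) := by
  rw [switchWord, Function.comp_apply, Equiv.swap_apply_left]

theorem switchWord_right_false : switchWord x i j (j, false) = x (i, true) := by
  rw [switchWord, Function.comp_apply, Equiv.swap_apply_right]

theorem switchWord_other {l : ι} (h1 : l ≠ i) (h2 : l ≠ j) (b : Bool) :
    switchWord x i j (l, b) = x (l, b) := by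
  rw [switchWord, Function.comp_apply, Equiv.swap_apply_of_ne_of_ne] <;> simp [h1, h2]

/-- Edges ab and cd become ac and bd. The letter c avoids a and its neighbours, and d avoids b and
its neighbours, so neither new edge is a loop or repeats an old edge. They differ from each other
because c ≠ b and cd is not a loop. The remaining edges can only lose parallel copies. -/
theorem badSet_switchWord_subset (hij : i ≠ j) (hj : j ∉ badSet x)
    (h1 : x (j, false) ∉ insert (x (i, false)) (insert (x (i, true)) (nbr x (x (i, false)))))
    (h2 : x (j, true) ∉ insert (x (i, true)) (nbr x (x (i, true)))) :
    badSet (switchWord x i j) ⊆ (badSet x).erase i := by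
  simp only [Finset.mem_insert, not_or] at h1 h2
  rw [mem_badSet, not_or, not_exists] at hj
  have ei : edge (switchWord x i j) i = s(x (i, false), x (j, false)) := by
    rw [edge, switchWord_left_false hij, switchWord_left_true]
  have ej : edge (switchWord x i j) j = s(x (i, true), x (j, true)) := by
    rw [edge, switchWord_right_false, switchWord_right_true hij]
  have el : ∀ l, l ≠ i → l ≠ j → edge (switchWord x i j) l = edge x l := fun l hi hj => by
    rw [edge, edge, switchWord_other hi hj, switchWord_other hi hj]
  have hne : edge (switchWord x i j) i ≠ edge (switchWord x i j) j := by
    rw [ei, ej]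
    intro h
    rw [Sym2.eq_iff] at h
    rcases h with h | h
    · exact hj.1 h.2
    · exact h1.2.1 h.2
  have hni : ∀ l, edge x l ≠ edge (switchWord x i j) i := fun l h => h1.2.2 (mem_nbr_of_edge_eq (h.trans ei))
  have hnj : ∀ l, edge x l ≠ edge (switchWord x i j) j := fun l h => h2.2 (mem_nbr_of_edge_eq (h.trans ej))
  intro l hl
  rw [mem_badSet] at hl
  rw [Finset.mem_erase]
  by_cases hli : l = i
  · subst hli
    exfalso
    rcases hl with hl | ⟨l', hl', he⟩
    · rw [switchWord_left_false hij, switchWord_left_true] at hl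
      exact h1.1 hl.symm
    · by_cases h : l' = j
      · subst h; exact hne he.symm
      · rw [el l' hl' h] at he; exact hni _ he
  · refine ⟨hli, ?_⟩
    by_cases hlj : l = j
    · subst hlj
      exfalso
      rcases hl with hl | ⟨l', hl', he⟩
      · rw [switchWord_right_false, switchWord_right_true hij] at hl
        exact h2.1 hl.symm
      · by_cases h : l' = i
        · subst h; exact hne he
        · rw [el l' h hl'] at he; exact hnj _ he
    · rw [mem_badSet]
      rcases hl with hl | ⟨l', hl', he⟩
      · left
        rwa [switchWord_other hli hlj, switchWord_other hli hlj] at hl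
      · right
        rw [el l hli hlj] at he
        by_cases h : l' = i
        · subst h; exact absurd he.symm (hni _)
        · by_cases h' : l' = j
          · subst h'; exact absurd he.symm (hnj _)
          · exact ⟨l', hl', by rwa [el l' h h'] at he⟩

/-- This limits the inverse switchings. If i was a loop, the moved letter equals the one kept at i;
if i was repeated, another copy survives and makes it a neighbour of that letter. So, given the new
word and i, there are at most (D + 1)D choices of j. -/
theorem switchWord_reverse (hij : i ≠ j) (hi : i ∈ badSet x) (hj : j ∉ badSet x) :
    switchWord x i j (j, false) ∈
      insert (switchWord x i j (i, false)) (nbr (switchWord x i j) (switchWord x i j (i, false))) := by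
  rw [switchWord_right_false, switchWord_left_false hij, Finset.mem_insert]
  rw [mem_badSet] at hi hj
  rcases hi with hi | ⟨l, hl, he⟩
  · exact Or.inl hi.symm
  · right
    have hlj : l ≠ j := fun h => by
      subst h; exact hj (Or.inr ⟨i, hij, he.symm⟩)
    refine mem_nbr_of_edge_eq (i := l) ?_
    rw [edge, switchWord_other hl hlj, switchWord_other hl hlj]
    exact he
end

/-- Double counting of switchings. For one selected bad index, at least half of all j are
admissible, since the excluded letters occupy O(D²) places. Conversely a word is reached from at
most m(D + 1)D pairs (i, j), and the factors m cancel. -/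
theorem card_bad_eq_succ_le {W : Finset (ι × Bool → V)} (hW : PermInvariant W) {D : ℕ}
    (hD : ∀ x ∈ W, ∀ v, cnt x v ≤ D) (b : ℕ)
    (hm : 2 * (b + 1 + (D + 2) * D + (D + 1) * D) ≤ Fintype.card ι) :
    #{x ∈ W | #(badSet x) = b + 1} ≤ 2 * ((D + 1) * D) * #{x ∈ W | #(badSet x) ≤ b} := by
  classical
  set m := Fintype.card ι with hmdef
  -- A bad index is selected for every word; for words without exactly b + 1 bad indices the value
  -- is arbitrary and never used.
  have hch : ∀ x : ι × Bool → V, ∃ i, #(badSet x) = b + 1 → i ∈ badSet x := by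
    intro x
    by_cases h : #(badSet x) = b + 1
    · obtain ⟨i, hi⟩ := Finset.card_pos.1 (show 0 < #(badSet x) by omega)
      exact ⟨i, fun _ => hi⟩
    · have : Nonempty ι := Fintype.card_pos_iff.1 (by omega)
      exact ⟨Classical.arbitrary ι, fun h' => absurd h' h⟩
  choose i₀ hi₀ using hch
  let J : (ι × Bool → V) → Finset ι := fun x =>
    {j | j ∉ badSet x ∧
      x (j, false) ∉ insert (x (i₀ x, false)) (insert (x (i₀ x, true)) (nbr x (x (i₀ x, false)))) ∧
      x (j, true) ∉ insert (x (i₀ x, true)) (nbr x (x (i₀ x, true)))}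
  have hJ : ∀ x ∈ W, #(badSet x) = b + 1 → m ≤ 2 * #(J x) := by
    intro x hx hb
    have hD' := hD x hx
    have hcov : (univ : Finset ι) ⊆ J x ∪ (badSet x ∪
        (({j : ι | x (j, false) ∈ insert (x (i₀ x, false)) (insert (x (i₀ x, true))
          (nbr x (x (i₀ x, false))))} : Finset ι) ∪
        ({j : ι | x (j, true) ∈ insert (x (i₀ x, true)) (nbr x (x (i₀ x, true)))} : Finset ι))) := by
      intro j _
      simp only [J, Finset.mem_union, Finset.mem_filter, Finset.mem_univ, true_and]
      tauto
    have h1 := (Finset.card_le_card hcov).trans ((Finset.card_union_le _ _).trans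
      (Nat.add_le_add_left ((Finset.card_union_le _ _).trans
        (Nat.add_le_add_left (Finset.card_union_le _ _) _)) _))
    have h2 := card_letter_mem_le x (insert (x (i₀ x, false)) (insert (x (i₀ x, true))
          (nbr x (x (i₀ x, false))))) false hD'
    have h3 := card_letter_mem_le x (insert (x (i₀ x, true)) (nbr x (x (i₀ x, true)))) true hD'
    have h4 : #(insert (x (i₀ x, false)) (insert (x (i₀ x, true))
          (nbr x (x (i₀ x, false))))) ≤ D + 2 :=
      (Finset.card_insert_le _ _).trans (Nat.add_le_add_right ((Finset.card_insert_le _ _).trans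
        (Nat.add_le_add_right ((card_nbr_le _ _).trans (hD' _)) 1)) 1)
    have h5 : #(insert (x (i₀ x, true)) (nbr x (x (i₀ x, true)))) ≤ D + 1 :=
      (Finset.card_insert_le _ _).trans (Nat.add_le_add_right ((card_nbr_le _ _).trans (hD' _)) 1)
    have h6 := Nat.mul_le_mul_right D h4
    have h7 := Nat.mul_le_mul_right D h5
    rw [Finset.card_univ, ← hmdef] at h1
    omega
  have hleft : #{x ∈ W | #(badSet x) = b + 1} * m ≤
      2 * #(({x ∈ W | #(badSet x) = b + 1}).sigma J) := by
    rw [Finset.card_sigma, Finset.mul_sum, ← smul_eq_mul]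
    exact Finset.card_nsmul_le_sum _ _ _ fun x hx => by
      rw [Finset.mem_filter] at hx
      exact hJ x hx.1 hx.2
  have hright : #(({x ∈ W | #(badSet x) ≤ b}).sigma fun y => (univ : Finset ι).sigma fun i =>
      ({j : ι | y (j, false) ∈ insert (y (i, false)) (nbr y (y (i, false)))} : Finset ι)) ≤
      #{x ∈ W | #(badSet x) ≤ b} * (m * ((D + 1) * D)) := by
    rw [Finset.card_sigma, ← smul_eq_mul]
    refine Finset.sum_le_card_nsmul _ _ _ fun y hy => ?_
    have hD' := hD y (Finset.mem_filter.1 hy).1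
    rw [Finset.card_sigma, hmdef, ← Finset.card_univ, ← smul_eq_mul]
    refine Finset.sum_le_card_nsmul _ _ _ fun i _ => ?_
    refine (card_letter_mem_le y _ false hD').trans (Nat.mul_le_mul_right D ?_)
    exact (Finset.card_insert_le _ _).trans
      (Nat.add_le_add_right ((card_nbr_le _ _).trans (hD' _)) 1)
  have hmid : #(({x ∈ W | #(badSet x) = b + 1}).sigma J) ≤
      #(({x ∈ W | #(badSet x) ≤ b}).sigma fun y => (univ : Finset ι).sigma fun i =>
      ({j : ι | y (j, false) ∈ insert (y (i, false)) (nbr y (y (i, false)))} : Finset ι)) := by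
    refine Finset.card_le_card_of_injOn (fun z => ⟨switchWord z.1 (i₀ z.1) z.2, i₀ z.1, z.2⟩) ?_ ?_
    · rintro ⟨x, j⟩ hz
      simp only [Finset.coe_sigma, Set.mem_sigma_iff, Finset.mem_coe, Finset.mem_filter, J,
        Finset.mem_univ, true_and] at hz ⊢
      obtain ⟨⟨hxW, hb⟩, hj, h1, h2⟩ := hz
      have hi := hi₀ x hb
      have hij : i₀ x ≠ j := fun h => hj (h ▸ hi)
      refine ⟨⟨hW _ _ hxW, ?_⟩, switchWord_reverse hij hi hj⟩
      have h3 := Finset.card_le_card (badSet_switchWord_subset hij hj h1 h2)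
      rw [Finset.card_erase_of_mem hi] at h3
      omega
    · rintro ⟨x, j⟩ _ ⟨x', j'⟩ _ h
      simp only [Sigma.mk.injEq, heq_eq_eq] at h
      obtain ⟨h1, h2, rfl⟩ := h
      rw [← h2] at h1
      congr 1
      exact (Equiv.swap (i₀ x, true) (j, false)).surjective.injective_comp_right h1
  have hm0 : 0 < m := by omega
  refine Nat.le_of_mul_le_mul_right ?_ hm0
  calc _ ≤ 2 * #(({x ∈ W | #(badSet x) = b + 1}).sigma J) := hleft
    _ ≤ 2 * (#{x ∈ W | #(badSet x) ≤ b} * (m * ((D + 1) * D))) :=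
      Nat.mul_le_mul_left 2 (hmid.trans hright)
    _ = _ := by ring

theorem card_bad_le_le {W : Finset (ι × Bool → V)} (hW : PermInvariant W) {D : ℕ}
    (hD : ∀ x ∈ W, ∀ v, cnt x v ≤ D) (b : ℕ)
    (hm : 2 * (b + (D + 2) * D + (D + 1) * D) ≤ Fintype.card ι) :
    #{x ∈ W | #(badSet x) ≤ b} ≤ (2 * ((D + 1) * D) + 1) ^ b * #{x ∈ W | badSet x = ∅} := by
  induction b with
  | zero => simp
  | succ b ih =>
    have h1 := card_bad_eq_succ_le hW hD b hm
    have h2 := ih (by omega)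
    have h3 : #{x ∈ W | #(badSet x) ≤ b + 1} ≤
        #{x ∈ W | #(badSet x) = b + 1} + #{x ∈ W | #(badSet x) ≤ b} := by
      refine le_trans (Finset.card_le_card ?_) (Finset.card_union_le _ _)
      intro x hx
      simp only [Finset.mem_union, Finset.mem_filter] at hx ⊢
      rcases hx.2.eq_or_lt with h | h
      · exact Or.inl ⟨hx.1, h⟩
      · exact Or.inr ⟨hx.1, by omega⟩
    calc _ ≤ 2 * ((D + 1) * D) * #{x ∈ W | #(badSet x) ≤ b} + #{x ∈ W | #(badSet x) ≤ b} :=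
          h3.trans (Nat.add_le_add_right h1 _)
      _ = (2 * ((D + 1) * D) + 1) * #{x ∈ W | #(badSet x) ≤ b} := by ring
      _ ≤ (2 * ((D + 1) * D) + 1) * ((2 * ((D + 1) * D) + 1) ^ b * #{x ∈ W | badSet x = ∅}) :=
          Nat.mul_le_mul_left _ h2
      _ = _ := by ring

end Switch

/-! ### Simple graphs encoded by words. -/

section Graph
variable {ι V : Type*} [Fintype ι] [DecidableEq ι] [Fintype V] [DecidableEq V]

/-- The graph encoded by a word. -/
def graphOf (x : ι × Bool → V) : SimpleGraph V := SimpleGraph.fromEdgeSet (Set.range (edge x))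

theorem edge_injective {x : ι × Bool → V} (hx : badSet x = ∅) : Function.Injective (edge x) := by
  intro i j h
  by_contra hne
  have : j ∈ badSet x := mem_badSet.2 (Or.inr ⟨i, hne, h⟩)
  rw [hx] at this
  simp at this

theorem edge_not_loop {x : ι × Bool → V} (hx : badSet x = ∅) (i : ι) :
    x (i, false) ≠ x (i, true) := by
  intro h
  have : i ∈ badSet x := mem_badSet.2 (Or.inl h)
  rw [hx] at this
  simp at this

theorem edgeSet_graphOf {x : ι × Bool → V} (hx : badSet x = ∅) :
    (graphOf x).edgeSet = Set.range (edge x) := by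
  rw [graphOf, SimpleGraph.edgeSet_fromEdgeSet, sdiff_eq_left, Set.disjoint_left]
  rintro _ ⟨i, rfl⟩ h
  exact edge_not_loop hx i (by simpa [edge] using h)

theorem ncard_edgeSet_graphOf {x : ι × Bool → V} (hx : badSet x = ∅) :
    (graphOf x).edgeSet.ncard = Fintype.card ι := by
  rw [edgeSet_graphOf hx, ← Set.image_univ, Set.ncard_image_of_injective _ (edge_injective hx),
    Set.ncard_univ, Nat.card_eq_fintype_card]

theorem edge_eq_of_position (x : ι × Bool → V) (p : ι × Bool) :
    edge x p.1 = s(x p, x (p.1, !p.2)) := by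
  obtain ⟨i, b⟩ := p
  cases b
  · rfl
  · exact Sym2.eq_swap

/-- Sending an occurrence of v to the letter at the other end of its edge is injective: repeated
edges are excluded for different indices, and loops for the same one. -/
theorem ncard_neighborSet_graphOf {x : ι × Bool → V} (hx : badSet x = ∅) (v : V) :
    ((graphOf x).neighborSet v).ncard = cnt x v := by
  have h : (graphOf x).neighborSet v =
      (fun p : ι × Bool => x (p.1, !p.2)) '' (({p | x p = v} : Finset (ι × Bool)) : Set _) := by
    ext w
    rw [SimpleGraph.mem_neighborSet, ← SimpleGraph.mem_edgeSet, edgeSet_graphOf hx]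
    constructor
    · rintro ⟨i, hi⟩
      rw [edge, Sym2.eq_iff] at hi
      rcases hi with hi | hi
      · exact ⟨(i, false), by simpa using hi.1, hi.2⟩
      · exact ⟨(i, true), by simpa using hi.2, hi.1⟩
    · rintro ⟨p, hp, rfl⟩
      refine ⟨p.1, ?_⟩
      rw [edge_eq_of_position, show x p = v by simpa using hp]
  rw [h, Set.InjOn.ncard_image, Set.ncard_coe_finset, cnt]
  intro p hp q hq hpq
  simp only [Finset.coe_filter, Finset.mem_univ, true_and, Set.mem_ofPred_eq] at hp hq
  have h1 : edge x p.1 = edge x q.1 := by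
    rw [edge_eq_of_position, edge_eq_of_position, hp, hq]
    simp only at hpq
    rw [hpq]
  have h2 := edge_injective hx h1
  obtain ⟨i, b⟩ := p
  obtain ⟨j, c⟩ := q
  obtain rfl : i = j := h2
  by_contra hne
  have hbc : b ≠ c := fun h => hne (by rw [h])
  have := edge_not_loop hx i
  cases b <;> cases c <;> simp_all

theorem card_sym2_mk_eq {e : Sym2 V} (he : ¬ e.IsDiag) : #{p : V × V | s(p.1, p.2) = e} = 2 := by
  induction e with
  | h a b =>
    have hab : a ≠ b := by simpa using he
    have : ({p : V × V | s(p.1, p.2) = s(a, b)} : Finset (V × V)) = {(a, b), (b, a)} := by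
      ext ⟨c, d⟩
      simp
    rw [this, Finset.card_pair]
    intro h
    exact hab (Prod.mk.inj h).1

/-- Every graph is encoded by the same number of words. -/
theorem card_graphOf_eq [DecidableEq (SimpleGraph V)] (G : SimpleGraph V) (hG : G.edgeSet.ncard = Fintype.card ι) :
    #{x : ι × Bool → V | badSet x = ∅ ∧ graphOf x = G} =
      (Fintype.card ι).factorial * 2 ^ Fintype.card ι := by
  classical
  have : Fintype G.edgeSet := Fintype.ofFinite _
  have hcard : Fintype.card G.edgeSet = Fintype.card ι := by
    rw [← hG, ← Nat.card_coe_set_eq, Nat.card_eq_fintype_card]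
  -- An encoding of G amounts to a numbering β of its edges together with an orientation of each
  -- edge; there are m! numberings and 2^m orientations.
  have hU : ({x : ι × Bool → V | badSet x = ∅ ∧ graphOf x = G} : Finset _) =
      (univ : Finset (ι ≃ G.edgeSet)).biUnion
        fun β => {x : ι × Bool → V | ∀ i, edge x i = (β i : Sym2 V)} := by
    ext x
    simp only [Finset.mem_filter, Finset.mem_univ, true_and, Finset.mem_biUnion]
    constructor
    · rintro ⟨hx, rfl⟩
      have hmem : ∀ i, edge x i ∈ (graphOf x).edgeSet := fun i => by
        rw [edgeSet_graphOf hx]; exact ⟨i, rfl⟩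
      refine ⟨Equiv.ofBijective (fun i => ⟨edge x i, hmem i⟩) ⟨?_, ?_⟩, fun i => rfl⟩
      · intro i j h
        exact edge_injective hx (Subtype.ext_iff.1 h)
      · rintro ⟨e, he⟩
        rw [edgeSet_graphOf hx] at he
        obtain ⟨i, hi⟩ := he
        exact ⟨i, Subtype.ext hi⟩
    · rintro ⟨β, hβ⟩
      have hx : badSet x = ∅ := by
        rw [Finset.eq_empty_iff_forall_notMem]
        intro i hi
        rcases mem_badSet.1 hi with h | ⟨j, hj, h⟩
        · refine G.not_isDiag_of_mem_edgeSet (β i).2 ?_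
          rw [← hβ i, edge, h]; simp
        · rw [hβ, hβ] at h
          exact hj (β.injective (Subtype.ext h))
      refine ⟨hx, ?_⟩
      rw [← SimpleGraph.edgeSet_inj, edgeSet_graphOf hx]
      ext e
      constructor
      · rintro ⟨i, rfl⟩
        rw [hβ]; exact (β i).2
      · intro he
        exact ⟨β.symm ⟨e, he⟩, by rw [hβ]; simp⟩
  rw [hU, Finset.card_biUnion]
  · have hB : ∀ β : ι ≃ G.edgeSet,
        #{x : ι × Bool → V | ∀ i, edge x i = (β i : Sym2 V)} = 2 ^ Fintype.card ι := by
      intro β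
      have h1 : #{x : ι × Bool → V | ∀ i, edge x i = (β i : Sym2 V)} =
          #(Fintype.piFinset fun i => ({p : V × V | s(p.1, p.2) = (β i : Sym2 V)} : Finset _)) := by
        refine Finset.card_bij (fun x _ i => (x (i, false), x (i, true))) ?_ ?_ ?_
        · intro x hx
          rw [Fintype.mem_piFinset]
          intro i
          simpa [edge] using (Finset.mem_filter.1 hx).2 i
        · intro x _ y _ h
          funext ⟨i, b⟩
          have := Prod.mk.inj (congrFun h i)
          cases b
          · exact this.1
          · exact this.2
        · intro f hf
          rw [Fintype.mem_piFinset] at hf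
          refine ⟨fun p => if p.2 then (f p.1).2 else (f p.1).1, ?_, ?_⟩
          · rw [Finset.mem_filter]
            refine ⟨mem_univ _, fun i => ?_⟩
            simpa [edge] using hf i
          · funext i; simp
      rw [h1, Fintype.card_piFinset,
        Finset.prod_congr rfl fun i _ => card_sym2_mk_eq (G.not_isDiag_of_mem_edgeSet (β i).2),
        Finset.prod_const, Finset.card_univ]
    rw [Finset.sum_congr rfl fun β _ => hB β, Finset.sum_const, Finset.card_univ,
      Fintype.card_equiv (Fintype.equivOfCardEq hcard.symm), smul_eq_mul]
  · intro β _ γ _ hne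
    rw [Function.onFun, Finset.disjoint_left]
    intro x hx hx'
    rw [Finset.mem_filter] at hx hx'
    refine hne (Equiv.ext fun i => Subtype.ext ?_)
    rw [← hx.2 i, ← hx'.2 i]

variable (ι V) in
/-- The words that encode simple graphs of minimum degree at least `k`. -/
def simpleWords (k : ℕ) : Finset (ι × Bool → V) := {x ∈ words (ι × Bool) V k | badSet x = ∅}

theorem mem_simpleWords {k : ℕ} {x : ι × Bool → V} :
    x ∈ simpleWords ι V k ↔ x ∈ words (ι × Bool) V k ∧ badSet x = ∅ := by
  simp [simpleWords]

theorem card_simpleWords_eq (n m k : ℕ) (P : SimpleGraph (Fin n) → Prop)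
    [DecidablePred P] :
    #{x ∈ simpleWords (Fin m) (Fin n) k | P (graphOf x)} =
      m.factorial * 2 ^ m * {G | G ∈ family n m k ∧ P G}.ncard := by
  classical
  rw [Set.ncard_eq_toFinset_card']
  have h := Finset.card_eq_sum_card_fiberwise (f := fun x : Fin m × Bool → Fin n => graphOf x)
    (s := {x ∈ simpleWords (Fin m) (Fin n) k | P (graphOf x)})
    (t := {G | G ∈ family n m k ∧ P G}.toFinset) (by
      intro x hx
      rw [Finset.mem_coe, Finset.mem_filter, mem_simpleWords, mem_words] at hx
      rw [Finset.mem_coe, Set.mem_toFinset]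
      refine ⟨⟨?_, fun v => ?_⟩, hx.2⟩
      · rw [ncard_edgeSet_graphOf hx.1.2, Fintype.card_fin]
      · rw [ncard_neighborSet_graphOf hx.1.2]; exact hx.1.1 v)
  rw [h, mul_comm, ← smul_eq_mul]
  refine Finset.sum_eq_card_nsmul fun G hG => ?_
  rw [Set.mem_toFinset] at hG
  obtain ⟨⟨hG1, hG2⟩, hG3⟩ := hG
  have h2 := card_graphOf_eq (ι := Fin m) G (by rw [hG1, Fintype.card_fin])
  rw [Fintype.card_fin] at h2
  rw [← h2]
  congr 1
  ext x
  simp only [Finset.mem_filter, mem_simpleWords, mem_words, Finset.mem_univ, true_and]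
  constructor
  · rintro ⟨⟨⟨_, hx⟩, _⟩, rfl⟩
    exact ⟨hx, rfl⟩
  · rintro ⟨hx, rfl⟩
    exact ⟨⟨⟨fun v => by rw [← ncard_neighborSet_graphOf hx]; exact hG2 v, hx⟩, hG3⟩, rfl⟩

/-- The common number of encodings cancels. If the family is empty, both quotients are 0 by
convention. -/
theorem prob_eq (n m k : ℕ) (P : SimpleGraph (Fin n) → Prop) [DecidablePred P] :
    prob n m k P = (#{x ∈ simpleWords (Fin m) (Fin n) k | P (graphOf x)} : ℝ) /
      #(simpleWords (Fin m) (Fin n) k) := by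
  have h1 := card_simpleWords_eq n m k P
  have h2 := card_simpleWords_eq n m k (fun _ => True)
  simp only [Finset.filter_true, and_true, Set.ofPred_mem_eq] at h2
  rw [h1, h2, prob]
  push_cast
  rw [mul_div_mul_left]
  positivity

theorem edgesSpanned_graphOf_le {x : ι × Bool → V} (hx : badSet x = ∅) (S : Finset V) :
    edgesSpanned (graphOf x) S ≤ #{i | x (i, false) ∈ S ∧ x (i, true) ∈ S} := by
  rw [edgesSpanned, edgeSet_graphOf hx]
  refine (Set.ncard_le_ncard (t := edge x '' (({i | x (i, false) ∈ S ∧ x (i, true) ∈ S} :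
    Finset ι) : Set ι)) ?_ (Set.toFinite _)).trans ((Set.ncard_image_le (Set.toFinite _)).trans_eq
      (Set.ncard_coe_finset _))
  rintro _ ⟨⟨i, rfl⟩, h⟩
  refine ⟨i, ?_, rfl⟩
  simp only [Finset.coe_filter, Finset.mem_univ, true_and, Set.mem_ofPred_eq]
  exact ⟨h _ (Sym2.mem_mk_left _ _), h _ (Sym2.mem_mk_right _ _)⟩

theorem edgesIncident_graphOf_le {x : ι × Bool → V} (hx : badSet x = ∅) (S : Finset V) :
    edgesIncident (graphOf x) S ≤ ∑ v ∈ S, cnt x v := by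
  have h1 : ∑ v ∈ S, cnt x v = #{p | x p ∈ S} := by
    rw [Finset.card_eq_sum_card_fiberwise (f := x) (t := S) (fun p hp => by simpa using hp)]
    refine Finset.sum_congr rfl fun v hv => ?_
    rw [cnt]; congr 1; ext p; simp only [Finset.mem_filter, Finset.mem_univ, true_and]
    exact ⟨fun h => ⟨h ▸ hv, h⟩, fun h => h.2⟩
  rw [h1, edgesIncident, edgeSet_graphOf hx]
  refine (Set.ncard_le_ncard (t := (fun p : ι × Bool => edge x p.1) '' (({p | x p ∈ S} :
    Finset (ι × Bool)) : Set _)) ?_ (Set.toFinite _)).trans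
      ((Set.ncard_image_le (Set.toFinite _)).trans_eq (Set.ncard_coe_finset _))
  rintro _ ⟨⟨i, rfl⟩, v, hv, hvS⟩
  rw [edge, Sym2.mem_iff] at hv
  rcases hv with rfl | rfl
  · exact ⟨(i, false), by simpa using hvS, rfl⟩
  · exact ⟨(i, true), by simpa using hvS, rfl⟩

end Graph

/-! ### Lower bound for the number of simple words. -/

section SimpleLower
variable {ι V : Type*} [Fintype ι] [DecidableEq ι] [Fintype V] [DecidableEq V]

/-- A positive proportion, up to a power of `D`, of the words encode simple graphs. -/
theorem card_words_le_card_simpleWords {k D T B : ℕ} {A : ℝ} (hA : 0 ≤ A)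
    (hTA : (T : ℝ) ≤ A * (2 * Fintype.card ι)) (hB : 2 * (A + 6 * A ^ 2) ≤ B + 1)
    (hm : 2 * (B + (D + 2) * D + (D + 1) * D) ≤ Fintype.card ι) (hm2 : 2 ≤ Fintype.card ι)
    (hgood : #(words (ι × Bool) V k) ≤
      2 * #{x ∈ words (ι × Bool) V k | (∀ v, cnt x v ≤ D) ∧ ∑ v, cnt x v ^ 2 ≤ T}) :
    #(words (ι × Bool) V k) ≤ 4 * (2 * ((D + 1) * D) + 1) ^ B * #(simpleWords ι V k) := by
  set W := words (ι × Bool) V k with hWdef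
  set W' := {x ∈ W | (∀ v, cnt x v ≤ D) ∧ ∑ v, cnt x v ^ 2 ≤ T} with hW'
  have hinv : PermInvariant W' := by
    intro σ x hx
    rw [hW', Finset.mem_filter, hWdef, mem_words] at hx ⊢
    rw [cnt_comp_perm]
    exact hx
  have hD : ∀ x ∈ W', ∀ v, cnt x v ≤ D := fun x hx => (Finset.mem_filter.1 hx).2.1
  have hT : ∀ x ∈ W', ∑ v, cnt x v ^ 2 ≤ T := fun x hx => (Finset.mem_filter.1 hx).2.2
  have hmean := mean_card_badSet_le hinv hT hm2 hA hTA
  -- Markov: B + 1 is at least twice the mean number of bad indices, so at most half of the words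
  -- have more than B.
  have hmk : #W' ≤ 2 * #{x ∈ W' | #(badSet x) ≤ B} := by
    have h1 : #{x ∈ W' | ¬ #(badSet x) ≤ B} * (B + 1) ≤ ∑ x ∈ W', #(badSet x) := by
      rw [← smul_eq_mul]
      refine (Finset.card_nsmul_le_sum _ (fun x => #(badSet x)) _ fun x hx => ?_).trans
        (Finset.sum_le_sum_of_subset (Finset.filter_subset _ _))
      have := (Finset.mem_filter.1 hx).2
      omega
    have h2 := Finset.card_filter_add_card_filter_not (s := W') (fun x => #(badSet x) ≤ B)
    have h3 : ((#{x ∈ W' | ¬ #(badSet x) ≤ B} * (B + 1) : ℕ) : ℝ) ≤ (B + 1) / 2 * #W' := by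
      refine (Nat.cast_le.2 h1).trans (hmean.trans ?_)
      gcongr
      linarith
    push_cast at h3
    have h4 : (2 * #{x ∈ W' | ¬ #(badSet x) ≤ B} : ℝ) ≤ #W' := by
      have : ((B : ℝ) + 1) * (2 * #{x ∈ W' | ¬ #(badSet x) ≤ B}) ≤ ((B : ℝ) + 1) * #W' := by
        linarith
      exact le_of_mul_le_mul_left this (by positivity)
    have h5 : 2 * #{x ∈ W' | ¬ #(badSet x) ≤ B} ≤ #W' := by exact_mod_cast h4
    omega
  have hsw := card_bad_le_le hinv hD B hm
  have hsub : #{x ∈ W' | badSet x = ∅} ≤ #(simpleWords ι V k) := by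
    refine Finset.card_le_card fun x hx => ?_
    rw [Finset.mem_filter] at hx
    exact mem_simpleWords.2 ⟨(Finset.mem_filter.1 hx.1).1, hx.2⟩
  calc #W ≤ 2 * #W' := hgood
    _ ≤ 2 * (2 * #{x ∈ W' | #(badSet x) ≤ B}) := Nat.mul_le_mul_left _ hmk
    _ ≤ 2 * (2 * ((2 * ((D + 1) * D) + 1) ^ B * #(simpleWords ι V k))) :=
      Nat.mul_le_mul_left _ (Nat.mul_le_mul_left _ (hsw.trans (Nat.mul_le_mul_left _ hsub)))
    _ = _ := by ring

end SimpleLower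

/-! ### Dense sets, large multiplicities and sets of large total multiplicity. -/

section Events
variable {ι V : Type*} [Fintype ι] [DecidableEq ι] [Fintype V] [DecidableEq V]

theorem pow_mul_factorial_sub_le {N R q : ℕ} (h : R + q ≤ N) :
    R ^ q * (N - q).factorial ≤ N.factorial := by
  have h1 := Nat.pow_sub_le_descFactorial N q
  have h2 := Nat.factorial_mul_descFactorial (show q ≤ N by omega)
  calc _ ≤ N.descFactorial q * (N - q).factorial :=
        Nat.mul_le_mul_right _ ((Nat.pow_le_pow_left (by omega) q).trans h1)
    _ = _ := by rw [mul_comm]; exact h2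

theorem card_words_prescribed_le_poissonMass {I : Type*} [Fintype I] [DecidableEq I]
    (k : ℕ) {lam : ℝ} (hl : 0 < lam) (Q : Finset I) (τ : I → V)
    (S : Finset V) (hτ : ∀ p ∈ Q, τ p ∈ S) {R : ℕ} (hR0 : 0 < R) (hR : R + #Q ≤ Fintype.card I) :
    (#{x ∈ words I V k | ∀ p ∈ Q, x p = τ p} : ℝ) ≤
      poissonMass k (Fintype.card I) (Fintype.card V) lam * (lam / R) ^ #Q *
        (Real.exp lam / truncExp k lam) ^ #S := by
  refine (card_words_prescribed_le k hl Q τ S hτ).trans ?_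
  have hf := truncExp_pos k hl
  have hS : #S ≤ Fintype.card V := Finset.card_le_univ S
  set N := Fintype.card I
  set n := Fintype.card V
  have hRR : (0 : ℝ) < R := by exact_mod_cast hR0
  have h1 : ((N - #Q).factorial : ℝ) ≤ N.factorial / (R : ℝ) ^ #Q := by
    rw [le_div_iff₀ (by positivity), mul_comm]
    exact_mod_cast pow_mul_factorial_sub_le hR
  have e1 : lam ^ N = lam ^ (N - #Q) * lam ^ #Q := by rw [← pow_add]; congr 1; omega
  have e2 : truncExp k lam ^ n = truncExp k lam ^ (n - #S) * truncExp k lam ^ #S := by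
    rw [← pow_add]; congr 1; omega
  calc _ ≤ (N.factorial / (R : ℝ) ^ #Q) / lam ^ (N - #Q) *
        (Real.exp lam ^ #S * truncExp k lam ^ (n - #S)) := by gcongr
    _ = _ := by
      rw [poissonMass, e1, e2, div_pow, div_pow]
      field_simp

/-- Union bound over the positions and the values of `t` edges inside `S`. -/
theorem card_spanning_le (X : Finset (ι × Bool → V)) (S : Finset V) (t : ℕ) {M : ℝ}
    (hM : ∀ (Q : Finset (ι × Bool)) (τ : ι × Bool → V), #Q = 2 * t → (∀ p ∈ Q, τ p ∈ S) →
      (#{x ∈ X | ∀ p ∈ Q, x p = τ p} : ℝ) ≤ M) (hM0 : 0 ≤ M) :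
    (#{x ∈ X | t ≤ #{i | x (i, false) ∈ S ∧ x (i, true) ∈ S}} : ℝ) ≤
      (Fintype.card ι).choose t * (#S : ℝ) ^ (2 * t) * M := by
  have h1 : #{x ∈ X | t ≤ #{i | x (i, false) ∈ S ∧ x (i, true) ∈ S}} ≤
      ∑ P ∈ powersetCard t (univ : Finset ι),
        #{x ∈ X | ∀ p ∈ P ×ˢ (univ : Finset Bool), x p ∈ S} := by
    refine le_trans (Finset.card_le_card ?_) Finset.card_biUnion_le
    intro x hx
    rw [Finset.mem_filter] at hx
    obtain ⟨P, hP, hPc⟩ := Finset.exists_subset_card_eq hx.2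
    rw [Finset.mem_biUnion]
    refine ⟨P, Finset.mem_powersetCard.2 ⟨subset_univ _, hPc⟩, Finset.mem_filter.2 ⟨hx.1, ?_⟩⟩
    rintro ⟨i, b⟩ hp
    have hi := hP (Finset.mem_product.1 hp).1
    simp only [Finset.mem_filter, Finset.mem_univ, true_and] at hi
    cases b
    · exact hi.1
    · exact hi.2
  have h2 : ∀ P ∈ powersetCard t (univ : Finset ι),
      (#{x ∈ X | ∀ p ∈ P ×ˢ (univ : Finset Bool), x p ∈ S} : ℝ) ≤ (#S : ℝ) ^ (2 * t) * M := by
    intro P hP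
    set Q := P ×ˢ (univ : Finset Bool)
    have hQ : #Q = 2 * t := by
      rw [Finset.card_product, (Finset.mem_powersetCard.1 hP).2]; simp [mul_comm]
    have h3 := Finset.card_eq_sum_card_fiberwise (f := fun (x : ι × Bool → V) (p : Q) => x p)
      (s := {x ∈ X | ∀ p ∈ Q, x p ∈ S}) (t := Fintype.piFinset fun _ : Q => S) (by
        intro x hx
        rw [Finset.mem_coe, Fintype.mem_piFinset]
        exact fun p => (Finset.mem_filter.1 hx).2 p p.2)
    rw [h3]
    push_cast
    have h4 : ∀ σ ∈ Fintype.piFinset fun _ : Q => S,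
        (#{x ∈ {x ∈ X | ∀ p ∈ Q, x p ∈ S} | (fun p : Q => x p) = σ} : ℝ) ≤ M := by
      intro σ _
      -- The bound M takes a prescription defined on all positions; any word of the fibre supplies
      -- one, and an empty fibre is harmless.
      rcases Finset.eq_empty_or_nonempty
        {x ∈ {x ∈ X | ∀ p ∈ Q, x p ∈ S} | (fun p : Q => x p) = σ} with h | ⟨y, hy⟩
      · rw [h]; simpa using hM0
      · rw [Finset.mem_filter, Finset.mem_filter] at hy
        refine le_trans (Nat.cast_le.2 (Finset.card_le_card ?_)) (hM Q y hQ hy.1.2)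
        intro x hx
        rw [Finset.mem_filter, Finset.mem_filter] at hx
        refine Finset.mem_filter.2 ⟨hx.1.1, fun p hp => ?_⟩
        have := congrFun (hx.2.trans hy.2.symm) ⟨p, hp⟩
        exact this
    refine (Finset.sum_le_card_nsmul _ _ _ h4).trans_eq ?_
    rw [nsmul_eq_mul, Fintype.card_piFinset, Finset.prod_const, Finset.card_univ,
      Fintype.card_coe, hQ]
    push_cast
    rfl
  refine (Nat.cast_le.2 h1).trans ?_
  push_cast
  refine (Finset.sum_le_card_nsmul _ _ _ h2).trans_eq ?_
  rw [nsmul_eq_mul, Finset.card_powersetCard, Finset.card_univ]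
  ring

theorem card_spanning_le_poissonMass (k : ℕ) {lam : ℝ} (hl : 0 < lam) (S : Finset V) (t : ℕ)
    {R : ℕ} (hR0 : 0 < R) (hR : R + 2 * t ≤ 2 * Fintype.card ι) :
    (#{x ∈ words (ι × Bool) V k | t ≤ #{i | x (i, false) ∈ S ∧ x (i, true) ∈ S}} : ℝ) ≤
      (Fintype.card ι).choose t * (#S : ℝ) ^ (2 * t) *
        (poissonMass k (2 * Fintype.card ι) (Fintype.card V) lam * (lam / R) ^ (2 * t) *
        (Real.exp lam / truncExp k lam) ^ #S) := by
  have hI : Fintype.card (ι × Bool) = 2 * Fintype.card ι := by simp [mul_comm]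
  have hf := truncExp_pos k hl
  have hM := poissonMass_pos k (2 * Fintype.card ι) (Fintype.card V) hl
  refine card_spanning_le _ S t (fun Q τ hQ hτ => ?_) (by positivity)
  have := card_words_prescribed_le_poissonMass (V := V) k hl Q τ S hτ hR0 (by omega)
  rwa [hI, hQ] at this

/-- The variant for very small sets. It is relative to the number of words rather than to
`poissonMass`, so that passing to simple words will cost only n^(1/2); the price is a factor D for
each prescribed position. -/
theorem card_spanning_le_of_cnt_le (k : ℕ) (S : Finset V) (t D : ℕ)
    {R : ℕ} (hR0 : 0 < R) (hR : R + 2 * t ≤ 2 * Fintype.card ι) :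
    (#{x ∈ {x ∈ words (ι × Bool) V k | ∀ v, cnt x v ≤ D} |
        t ≤ #{i | x (i, false) ∈ S ∧ x (i, true) ∈ S}} : ℝ) ≤
      (Fintype.card ι).choose t * (#S : ℝ) ^ (2 * t) *
        (((D : ℝ) / R) ^ (2 * t) * #(words (ι × Bool) V k)) := by
  have hI : Fintype.card (ι × Bool) = 2 * Fintype.card ι := by simp [mul_comm]
  refine card_spanning_le _ S t (fun Q τ hQ hτ => ?_) (by positivity)
  have hinv : PermInvariant {x ∈ words (ι × Bool) V k | ∀ v, cnt x v ≤ D} := by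
    intro σ x hx
    rw [Finset.mem_filter, mem_words] at hx ⊢
    rw [cnt_comp_perm]
    exact hx
  have h := card_prescribed_mul_le hinv (fun x hx => (Finset.mem_filter.1 hx).2) Q τ R (by omega)
  rw [hQ] at h
  have hRR : (0 : ℝ) < R := by exact_mod_cast hR0
  rw [div_pow, div_mul_eq_mul_div, le_div_iff₀ (by positivity)]
  have h2 := h.trans (Nat.mul_le_mul_left _ (Finset.card_le_card (Finset.filter_subset _ _)))
  exact_mod_cast h2

theorem card_exists_cnt_gt_le (k : ℕ) {lam : ℝ} (hl : 0 < lam) (D : ℕ) :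
    (#{x ∈ words ι V k | ¬ ∀ v, cnt x v ≤ D} : ℝ) ≤
      Fintype.card V * (poissonMass k (Fintype.card ι) (Fintype.card V) lam *
        (2 ^ k * Real.exp lam) * (1 / 2) ^ D) := by
  have h1 : #{x ∈ words ι V k | ¬ ∀ v, cnt x v ≤ D} ≤
      ∑ v : V, #{x ∈ words ι V k | ((D : ℝ)) ≤ ((∑ w ∈ {v}, cnt x w : ℕ) : ℝ)} := by
    refine le_trans (Finset.card_le_card ?_) Finset.card_biUnion_le
    intro x hx
    rw [Finset.mem_filter] at hx
    obtain ⟨hx1, hx2⟩ := hx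
    push Not at hx2
    obtain ⟨v, hv⟩ := hx2
    rw [Finset.mem_biUnion]
    refine ⟨v, mem_univ v, Finset.mem_filter.2 ⟨hx1, ?_⟩⟩
    rw [Finset.sum_singleton]
    exact_mod_cast hv.le
  refine (Nat.cast_le.2 h1).trans ?_
  push_cast
  refine (Finset.sum_le_card_nsmul _ _ (poissonMass k (Fintype.card ι) (Fintype.card V) lam *
        (2 ^ k * Real.exp lam) * (1 / 2) ^ D) fun v _ => ?_).trans_eq ?_
  · have := card_words_ge_le (I := ι) k hl ({v} : Finset V) D
    rw [Finset.card_singleton, pow_one, Real.rpow_neg (by norm_num), Real.rpow_natCast] at this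
    rw [one_div, inv_pow]
    push_cast at this
    exact this
  · rw [nsmul_eq_mul, Finset.card_univ]

/-- No small set of letters has large total multiplicity. -/
theorem card_exists_sum_cnt_ge_le (k : ℕ) {lam y H : ℝ} (hl : 0 < lam) (hy : 0 < y) (hy1 : y ≤ 1)
    (hH : (2 * (k + lam) - Real.logb 2 y + 3) * (y * Fintype.card V) ≤ H) :
    (#{x ∈ words ι V k | ∃ S : Finset V, (#S : ℝ) ≤ y * Fintype.card V ∧
        H ≤ ((∑ v ∈ S, cnt x v : ℕ) : ℝ)} : ℝ) ≤
      poissonMass k (Fintype.card ι) (Fintype.card V) lam *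
        (2 : ℝ) ^ (-(y * Fintype.card V)) := by
  classical
  set a := y * Fintype.card V with ha
  set n := Fintype.card V
  set M0 := poissonMass k (Fintype.card ι) n lam
  have hM0 : 0 < M0 := poissonMass_pos _ _ _ hl
  set ρ := (2 : ℝ) ^ k * Real.exp lam with hρ
  have ha0 : 0 ≤ a := by positivity
  have hρ1 : 1 ≤ ρ := by
    have := Real.one_le_exp hl.le
    have h2 : (1 : ℝ) ≤ 2 ^ k := one_le_pow₀ (by norm_num)
    nlinarith
  -- Rankin's trick: for #S ≤ a and y ≤ 1 the weight y^(#S - a) is at least 1. The restricted sum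
  -- over S can therefore be extended to all subsets, where it is (1 + y)^n ≤ e^a after y^(-a) is
  -- taken out.
  have h1 : (#{x ∈ words ι V k | ∃ S : Finset V, (#S : ℝ) ≤ a ∧
        H ≤ ((∑ v ∈ S, cnt x v : ℕ) : ℝ)} : ℝ) ≤
      ∑ S : Finset V, y ^ #S * (y ^ (-a) * (M0 * ρ ^ a * (2 : ℝ) ^ (-H))) := by
    have h2 : #{x ∈ words ι V k | ∃ S : Finset V, (#S : ℝ) ≤ a ∧
        H ≤ ((∑ v ∈ S, cnt x v : ℕ) : ℝ)} ≤
        ∑ S ∈ ({S | (#S : ℝ) ≤ a} : Finset (Finset V)),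
          #{x ∈ words ι V k | H ≤ ((∑ v ∈ S, cnt x v : ℕ) : ℝ)} := by
      refine le_trans (Finset.card_le_card ?_) Finset.card_biUnion_le
      intro x hx
      rw [Finset.mem_filter] at hx
      obtain ⟨hx1, S, hS, hH⟩ := hx
      rw [Finset.mem_biUnion]
      exact ⟨S, by simpa using hS, Finset.mem_filter.2 ⟨hx1, hH⟩⟩
    refine (Nat.cast_le.2 h2).trans ?_
    push_cast
    refine (Finset.sum_le_sum fun S hS => ?_).trans
      (Finset.sum_le_sum_of_subset_of_nonneg (subset_univ _) fun _ _ _ => by positivity)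
    have hSa : (#S : ℝ) ≤ a := by simpa using hS
    have h3 := card_words_ge_le (I := ι) k hl S H
    push_cast at h3
    refine h3.trans ?_
    have h4 : ρ ^ #S ≤ ρ ^ a := by
      rw [← Real.rpow_natCast]
      exact Real.rpow_le_rpow_of_exponent_le hρ1 hSa
    have h5 : 1 ≤ y ^ #S * y ^ (-a) := by
      rw [← Real.rpow_natCast, ← Real.rpow_add hy]
      exact Real.one_le_rpow_of_pos_of_le_one_of_nonpos hy hy1 (by linarith)
    calc _ ≤ M0 * ρ ^ a * (2 : ℝ) ^ (-H) := by gcongr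
      _ ≤ (y ^ #S * y ^ (-a)) * (M0 * ρ ^ a * (2 : ℝ) ^ (-H)) :=
        le_mul_of_one_le_left (by positivity) h5
      _ = _ := by ring
  refine h1.trans ?_
  rw [← Finset.sum_mul]
  have h6 : ∑ S : Finset V, y ^ #S ≤ Real.exp 1 ^ a := by
    have := Finset.sum_pow_mul_eq_add_pow y 1 (univ : Finset V)
    simp only [one_pow, mul_one, Finset.powerset_univ, Finset.card_univ] at this
    rw [this, Real.exp_one_rpow, ha]
    calc (y + 1) ^ n ≤ Real.exp y ^ n := pow_le_pow_left₀ (by positivity) (Real.add_one_le_exp y) _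
      _ = _ := by rw [← Real.exp_nat_mul]; congr 1; ring
  have h7 : (2 : ℝ) ^ (-H) ≤ ((4 : ℝ) ^ ((k : ℝ) + lam) * 8 / y) ^ (-a) := by
    have e : (4 : ℝ) ^ ((k : ℝ) + lam) * 8 / y = (2 : ℝ) ^ (2 * (k + lam) - Real.logb 2 y + 3) := by
      rw [Real.rpow_add two_pos (2 * (k + lam) - Real.logb 2 y) 3,
        Real.rpow_sub two_pos (2 * (k + lam)) (Real.logb 2 y), Real.rpow_mul two_pos.le,
        Real.rpow_logb two_pos (by norm_num) hy]
      norm_num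
      ring
    rw [e, ← Real.rpow_mul (by norm_num)]
    refine Real.rpow_le_rpow_of_exponent_le (by norm_num) ?_
    linarith
  -- From e ≤ 4 and 2^k e^lam ≤ 4^(k + lam) the base is at most half of the number whose power -a
  -- bounds 2^(-H). The hypothesis on H has room for this half, and it becomes the factor 2^(-a).
  have h8 : Real.exp 1 * ρ / y ≤ ((4 : ℝ) ^ ((k : ℝ) + lam) * 8 / y) * (1 / 2) := by
    have he : Real.exp 1 ≤ 4 := by have := Real.exp_one_lt_d9; linarith
    have h9 : ρ ≤ (4 : ℝ) ^ ((k : ℝ) + lam) := by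
      rw [Real.rpow_add (by norm_num), Real.rpow_natCast, hρ]
      gcongr
      · norm_num
      · rw [← Real.exp_one_rpow]
        exact Real.rpow_le_rpow (by positivity) he hl.le
    calc Real.exp 1 * ρ / y ≤ 4 * (4 : ℝ) ^ ((k : ℝ) + lam) / y := by gcongr
      _ = _ := by ring
  set Z := (4 : ℝ) ^ ((k : ℝ) + lam) * 8 / y
  have hZ : 0 < Z := by positivity
  calc (∑ S : Finset V, y ^ #S) * (y ^ (-a) * (M0 * ρ ^ a * (2 : ℝ) ^ (-H)))
      ≤ Real.exp 1 ^ a * (y ^ (-a) * (M0 * ρ ^ a * Z ^ (-a))) := by gcongr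
    _ = M0 * (Real.exp 1 * ρ / y) ^ a * Z ^ (-a) := by
      have e : (Real.exp 1 * ρ / y) ^ a = Real.exp 1 ^ a * ρ ^ a * y ^ (-a) := by
        rw [Real.div_rpow (by positivity) hy.le, Real.mul_rpow (by positivity) (by positivity),
          Real.rpow_neg hy.le, div_eq_mul_inv]
      rw [e]
      ring
    _ ≤ M0 * (Z * (1 / 2)) ^ a * Z ^ (-a) := by gcongr
    _ = M0 * (2 : ℝ) ^ (-a) := by
      rw [Real.mul_rpow hZ.le (by norm_num), one_div, Real.inv_rpow (by norm_num),
        Real.rpow_neg hZ.le, Real.rpow_neg (by norm_num)]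
      field_simp

end Events

/-! ### First moment of placed edge configurations. -/

section Conf
variable {ι V A : Type*} [Fintype ι] [DecidableEq ι] [Fintype V] [DecidableEq V]
  [Fintype A] [DecidableEq A]

/-- The ways to find the edges `w a`, `w (next a)`, for all `a`, at distinct places of a word. -/
def placements (next : A → A) (x : ι × Bool → V) : Finset ((A → ι × Bool) × (A → V)) :=
  {z | Function.Injective (fun a => (z.1 a).1) ∧
    ∀ a, x (z.1 a) = z.2 a ∧ x ((z.1 a).1, !(z.1 a).2) = z.2 (next a)}

/-- Every a contributes both one edge and one vertex: 2m places, n labels, (lam/R)² for the two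
half-edges and e^lam / f_k(lam) for the vertex. As m and R are of order n, the base remains bounded.
Labels may coincide, which only lowers the power of e^lam / f_k(lam) ≥ 1. -/
theorem sum_card_placements_le (next : A → A) (k : ℕ) {lam : ℝ} (hl : 0 < lam)
    {R : ℕ} (hR0 : 0 < R) (hR : R + 2 * Fintype.card A ≤ 2 * Fintype.card ι) :
    ((∑ x ∈ words (ι × Bool) V k, #(placements next x) : ℕ) : ℝ) ≤
      poissonMass k (2 * Fintype.card ι) (Fintype.card V) lam *
        (2 * Fintype.card ι * Fintype.card V * (lam / R) ^ 2 *
          (Real.exp lam / truncExp k lam)) ^ Fintype.card A := by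
  have hI : Fintype.card (ι × Bool) = 2 * Fintype.card ι := by simp [mul_comm]
  have hf := truncExp_pos k hl
  set M0 := poissonMass k (2 * Fintype.card ι) (Fintype.card V) lam
  have hM0 : 0 < M0 := poissonMass_pos _ _ _ hl
  have hq : 1 ≤ Real.exp lam / truncExp k lam := by
    rw [le_div_iff₀ hf, one_mul]; exact truncExp_le_exp k hl.le
  have h1 : ∑ x ∈ words (ι × Bool) V k, #(placements next x) =
      ∑ z : (A → ι × Bool) × (A → V), #{x ∈ words (ι × Bool) V k |
        Function.Injective (fun a => (z.1 a).1) ∧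
        ∀ a, x (z.1 a) = z.2 a ∧ x ((z.1 a).1, !(z.1 a).2) = z.2 (next a)} := by
    simp only [placements, Finset.card_filter]
    exact Finset.sum_comm
  rw [h1]
  push_cast
  have h2 : ∀ z ∈ (univ : Finset ((A → ι × Bool) × (A → V))),
      (#{x ∈ words (ι × Bool) V k | Function.Injective (fun a => (z.1 a).1) ∧
        ∀ a, x (z.1 a) = z.2 a ∧ x ((z.1 a).1, !(z.1 a).2) = z.2 (next a)} : ℝ) ≤
      M0 * (lam / R) ^ (2 * Fintype.card A) * (Real.exp lam / truncExp k lam) ^ Fintype.card A := by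
    rintro ⟨ρ, w⟩ _
    rcases Finset.eq_empty_or_nonempty {x ∈ words (ι × Bool) V k |
        Function.Injective (fun a => (ρ a).1) ∧
        ∀ a, x (ρ a) = w a ∧ x ((ρ a).1, !(ρ a).2) = w (next a)} with h | ⟨y, hy⟩
    · rw [h]; simp only [Finset.card_empty, Nat.cast_zero]; positivity
    · rw [Finset.mem_filter] at hy
      obtain ⟨-, hinj, hy⟩ := hy
      set Q : Finset (ι × Bool) := (univ.image fun a => (ρ a).1) ×ˢ univ
      have hQ : #Q = 2 * Fintype.card A := by
        rw [Finset.card_product, Finset.card_image_of_injective _ hinj, Finset.card_univ]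
        simp [mul_comm]
      have hval : ∀ x : ι × Bool → V,
          (∀ a, x (ρ a) = w a ∧ x ((ρ a).1, !(ρ a).2) = w (next a)) →
          ∀ a b, x ((ρ a).1, b) = if b = (ρ a).2 then w a else w (next a) := by
        intro x hx a b
        split_ifs with hb
        · rw [hb]; exact (hx a).1
        · have : b = !(ρ a).2 := by revert hb; cases b <;> cases (ρ a).2 <;> simp
          rw [this]; exact (hx a).2
      have hyS : ∀ p ∈ Q, y p ∈ univ.image w := by
        rintro ⟨i, b⟩ hp
        obtain ⟨a, -, rfl⟩ := Finset.mem_image.1 (Finset.mem_product.1 hp).1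
        rw [hval y hy a b]
        split_ifs
        · exact Finset.mem_image_of_mem _ (mem_univ _)
        · exact Finset.mem_image_of_mem _ (mem_univ _)
      have h3 := card_words_prescribed_le_poissonMass (V := V) k hl Q y (univ.image w) hyS hR0
        (by omega)
      rw [hI, hQ] at h3
      have h4 : #(univ.image w) ≤ Fintype.card A := Finset.card_image_le
      refine (Nat.cast_le.2 (Finset.card_le_card ?_)).trans (h3.trans ?_)
      · intro x hx
        rw [Finset.mem_filter] at hx ⊢
        refine ⟨hx.1, ?_⟩
        rintro ⟨i, b⟩ hp
        obtain ⟨a, -, rfl⟩ := Finset.mem_image.1 (Finset.mem_product.1 hp).1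
        rw [hval x hx.2.2, hval y hy]
      · gcongr
  refine (Finset.sum_le_card_nsmul _ _ _ h2).trans_eq ?_
  rw [nsmul_eq_mul, Finset.card_univ, Fintype.card_prod, Fintype.card_fun, Fintype.card_fun, hI]
  push_cast
  rw [pow_mul, mul_pow, mul_pow, mul_pow]
  ring

end Conf

/-! ### Many disjoint cycles contain many short ones of equal length. -/

section Cycles
variable {V : Type*} [Fintype V] [DecidableEq V] {G : SimpleGraph V}

/-- Among many disjoint cycles, many are short and have the same length. -/
theorem exists_cycles_same_length {t L : ℕ} (v : Fin t → V) (p : ∀ i, G.Walk (v i) (v i))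
    (hp : ∀ i, (p i).IsCycle) (hd : ∀ i j, i ≠ j → List.Disjoint (p i).support (p j).support)
    (hL : 1 ≤ L) :
    ∃ l ∈ Icc 1 L, t * (L + 1) ≤ Fintype.card V + #{i | (p i).length = l} * L * (L + 1) := by
  have hsum : ∑ i, (p i).length ≤ Fintype.card V := by
    have hc : ∀ i, #((p i).support.tail.toFinset) = (p i).length := fun i => by
      rw [List.toFinset_card_of_nodup (hp i).support_nodup]
      simp
    calc ∑ i, (p i).length = ∑ i, #((p i).support.tail.toFinset) :=
          Finset.sum_congr rfl fun i _ => (hc i).symm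
      _ = #(univ.biUnion fun i => (p i).support.tail.toFinset) := by
          rw [Finset.card_biUnion]
          intro i _ j _ hij
          rw [Function.onFun, Finset.disjoint_left]
          intro u hu hu'
          exact hd i j hij (List.mem_of_mem_tail (List.mem_toFinset.1 hu))
            (List.mem_of_mem_tail (List.mem_toFinset.1 hu'))
      _ ≤ Fintype.card V := Finset.card_le_univ _
  -- Disjoint cycles have total length at most the number of vertices, so few of them are longer
  -- than L; the others have at most L possible lengths and pigeonhole applies.
  have hlong : #{i | ¬ (p i).length ≤ L} * (L + 1) ≤ Fintype.card V := by
    refine le_trans ?_ hsum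
    rw [← smul_eq_mul]
    refine (Finset.card_nsmul_le_sum _ (fun i => (p i).length) _ fun i hi => ?_).trans
      (Finset.sum_le_sum_of_subset (Finset.filter_subset _ _))
    have := (Finset.mem_filter.1 hi).2
    omega
  have hsplit := Finset.card_filter_add_card_filter_not (s := (univ : Finset (Fin t)))
    (fun i => (p i).length ≤ L)
  rw [Finset.card_univ, Fintype.card_fin] at hsplit
  obtain ⟨l, hl, hle⟩ : ∃ l ∈ Icc 1 L,
      #{i | (p i).length ≤ L} ≤ #{i | (p i).length = l} * L := by
    by_contra hcon
    push Not at hcon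
    have hfib := Finset.card_eq_sum_card_fiberwise (f := fun i => (p i).length)
      (s := {i | (p i).length ≤ L}) (t := Icc 1 L) (by
        intro i hi
        rw [Finset.mem_coe, Finset.mem_filter] at hi
        rw [Finset.mem_coe, Finset.mem_Icc]
        exact ⟨le_trans (by norm_num) (hp i).three_le_length, hi.2⟩)
    have h1 : #{i | (p i).length ≤ L} * L < #{i | (p i).length ≤ L} * L := by
      calc #{i | (p i).length ≤ L} * L =
            ∑ l ∈ Icc 1 L, #{i ∈ ({i | (p i).length ≤ L} : Finset _) | (p i).length = l} * L := by
            rw [← Finset.sum_mul, ← hfib]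
        _ ≤ ∑ l ∈ Icc 1 L, #{i | (p i).length = l} * L := by
            refine Finset.sum_le_sum fun l _ => Nat.mul_le_mul_right _ (Finset.card_le_card ?_)
            intro i hi
            rw [Finset.mem_filter] at hi ⊢
            exact ⟨mem_univ _, hi.2⟩
        _ < ∑ l ∈ Icc 1 L, #{i | (p i).length ≤ L} :=
            Finset.sum_lt_sum_of_nonempty ⟨1, Finset.mem_Icc.2 ⟨le_rfl, hL⟩⟩ hcon
        _ = _ := by rw [Finset.sum_const, Nat.card_Icc, smul_eq_mul, mul_comm]; simp
    exact lt_irrefl _ h1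
  refine ⟨l, hl, ?_⟩
  calc t * (L + 1) = #{i | ¬ (p i).length ≤ L} * (L + 1) + #{i | (p i).length ≤ L} * (L + 1) := by
        rw [← add_mul]
        exact congrArg (· * (L + 1)) (by omega)
    _ ≤ _ := Nat.add_le_add hlong (Nat.mul_le_mul_right _ hle)

end Cycles

/-! ### Factorial moments of the number of short cycles. -/

section CyclePlacements
variable {ι V : Type*} [Fintype ι] [DecidableEq ι] [Fintype V] [DecidableEq V]

/-- The cyclic successor on the vertices of `r` cycles of length `l`. -/
def cycleNext (r l : ℕ) (a : Fin r × Fin l) : Fin r × Fin l :=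
  (a.1, ⟨(a.2 + 1) % l, Nat.mod_lt _ a.2.pos⟩)

/-- Each ordered choice of r cycles of length l yields a placement, by listing the edges of each
cycle in order from its base point. Disjointness puts the edges at distinct places, and the base
point alone identifies the cycle, so different choices give different placements. -/
theorem descFactorial_le_card_placements {x : ι × Bool → V} (hx : badSet x = ∅) {t : ℕ}
    (v : Fin t → V) (p : ∀ i, (graphOf x).Walk (v i) (v i))
    (hp : ∀ i, (p i).IsCycle) (hd : ∀ i j, i ≠ j → List.Disjoint (p i).support (p j).support)
    (r l : ℕ) (hl : 1 ≤ l) :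
    (#{i | (p i).length = l}).descFactorial r ≤ #(placements (cycleNext r l) x) := by
  set J : Finset (Fin t) := {i | (p i).length = l} with hJ
  have hlen : ∀ i : J, (p i).length = l := fun i => (Finset.mem_filter.1 i.2).2
  have hpos : ∀ (i : J) (j : Fin l), ∃ q : ι × Bool,
      x q = (p i).getVert j ∧ x (q.1, !q.2) = (p i).getVert (j + 1) := by
    intro i j
    have hadj := (p i).adj_getVert_succ (i := j) (by rw [hlen i]; exact j.2)
    rw [← SimpleGraph.mem_edgeSet, edgeSet_graphOf hx] at hadj
    obtain ⟨e, he⟩ := hadj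
    rw [edge, Sym2.eq_iff] at he
    rcases he with he | he
    · exact ⟨(e, false), he⟩
    · exact ⟨(e, true), he.2, he.1⟩
  choose pos hpos1 hpos2 using hpos
  have hedge : ∀ (i : J) (j : Fin l),
      edge x (pos i j).1 = s((p i).getVert j, (p i).getVert (j + 1)) := by
    intro i j
    rw [edge_eq_of_position, hpos1, hpos2]
  have hinj : ∀ (i i' : J) (j j' : Fin l), (pos i j).1 = (pos i' j').1 → i = i' ∧ j = j' := by
    intro i i' j j' h
    have h1 := hedge i j
    rw [h, hedge i' j'] at h1
    have hii : i = i' := by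
      by_contra hne
      have hdis := hd i i' (fun h => hne (Subtype.ext h))
      have hm : (p i).getVert j ∈ s((p i').getVert j', (p i').getVert (j' + 1)) := by
        rw [h1]; exact Sym2.mem_mk_left _ _
      rw [Sym2.mem_iff] at hm
      rcases hm with hm | hm
      · exact hdis ((p i).getVert_mem_support j) (hm ▸ (p i').getVert_mem_support j')
      · exact hdis ((p i).getVert_mem_support j) (hm ▸ (p i').getVert_mem_support (j' + 1))
    subst hii
    refine ⟨rfl, ?_⟩
    have hl1 : (j : ℕ) < (p i).edges.length := by
      rw [SimpleGraph.Walk.length_edges, hlen i]; exact j.2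
    have hl2 : (j' : ℕ) < (p i).edges.length := by
      rw [SimpleGraph.Walk.length_edges, hlen i]; exact j'.2
    have h2 : (p i).edges[(j : ℕ)] = (p i).edges[(j' : ℕ)] := by
      rw [SimpleGraph.Walk.getElem_edges, SimpleGraph.Walk.getElem_edges]
      exact h1.symm
    exact Fin.ext ((List.Nodup.getElem_inj_iff (hp i).edges_nodup).1 h2)
  have hcard : (#J).descFactorial r = #(univ : Finset (Fin r ↪ J)) := by
    rw [Finset.card_univ, Fintype.card_embedding_eq, Fintype.card_coe, Fintype.card_fin]
  rw [hcard]
  refine Finset.card_le_card_of_injOn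
    (fun θ => (fun a => pos (θ a.1) a.2, fun a => (p (θ a.1)).getVert a.2)) ?_ ?_
  · intro θ _
    rw [Finset.mem_coe, placements, Finset.mem_filter]
    refine ⟨mem_univ _, ?_, fun a => ⟨hpos1 _ _, ?_⟩⟩
    · rintro ⟨a, j⟩ ⟨a', j'⟩ h
      obtain ⟨h1, h2⟩ := hinj _ _ _ _ h
      exact Prod.ext (θ.injective h1) h2
    · simp only [cycleNext]
      rw [hpos2]
      rcases Nat.lt_or_ge (a.2 + 1) l with h | h
      · rw [Nat.mod_eq_of_lt h]
      · have h' : (a.2 : ℕ) + 1 = l := le_antisymm a.2.2 h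
        rw [h', Nat.mod_self, SimpleGraph.Walk.getVert_zero]
        have := (p (θ a.1)).getVert_length
        rwa [hlen (θ a.1)] at this
  · intro θ _ θ' _ h
    refine DFunLike.ext _ _ fun a => ?_
    have h1 := congrFun (Prod.mk.inj h).2 (a, ⟨0, hl⟩)
    simp only [SimpleGraph.Walk.getVert_zero] at h1
    by_contra hne
    refine hd (θ a) (θ' a) (fun h => hne (Subtype.ext h)) (SimpleGraph.Walk.start_mem_support _) ?_
    rw [h1]
    exact SimpleGraph.Walk.start_mem_support _

/-- The r-th factorial moment is used so that a polynomial gain of order q^r is available against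
the cost K^(rL); the sum over the unknown length l contributes the factor L. -/
theorem card_disjoint_cycles_le (k : ℕ) {lam : ℝ} (hlam : 0 < lam) {L q r : ℕ} (hL : 1 ≤ L)
    {R : ℕ} (hR0 : 0 < R) (hR : R + 2 * (r * L) ≤ 2 * Fintype.card ι)
    {K : ℝ} (hK1 : 1 ≤ K) (hK : 2 * Fintype.card ι * Fintype.card V * (lam / R) ^ 2 *
          (Real.exp lam / truncExp k lam) ≤ K) (X : Finset (ι × Bool → V))
    (hX : X ⊆ simpleWords ι V k)
    (hcyc : ∀ x ∈ X, ∃ t, Fintype.card V + q * L * (L + 1) ≤ t * (L + 1) ∧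
      HasDisjointCycles (graphOf x) t) :
    (#X : ℝ) * q.descFactorial r ≤
      L * (poissonMass k (2 * Fintype.card ι) (Fintype.card V) lam * K ^ (r * L)) := by
  have hM0 := poissonMass_pos k (2 * Fintype.card ι) (Fintype.card V) hlam
  have h1 : ∀ x ∈ X, ∃ l ∈ Icc 1 L, q.descFactorial r ≤ #(placements (cycleNext r l) x) := by
    intro x hx
    obtain ⟨t, ht, v, p, hp, hd⟩ := hcyc x hx
    have hb := (mem_simpleWords.1 (hX hx)).2
    obtain ⟨l, hl, hle⟩ := exists_cycles_same_length v p hp hd hL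
    refine ⟨l, hl, le_trans (Nat.descFactorial_le r ?_)
      (descFactorial_le_card_placements hb v p hp hd r l (Finset.mem_Icc.1 hl).1)⟩
    have h2 : q * (L * (L + 1)) ≤ #{i | (p i).length = l} * (L * (L + 1)) := by
      rw [← mul_assoc, ← mul_assoc]; omega
    exact Nat.le_of_mul_le_mul_right h2 (Nat.mul_pos (by omega) (by omega))
  have h2 : #X * q.descFactorial r ≤
      ∑ l ∈ Icc 1 L, ∑ x ∈ words (ι × Bool) V k, #(placements (cycleNext r l) x) := by
    rw [Finset.sum_comm]
    refine le_trans ?_ (Finset.sum_le_sum_of_subset (fun x hx => (mem_simpleWords.1 (hX hx)).1))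
    rw [← smul_eq_mul]
    refine Finset.card_nsmul_le_sum _ _ _ fun x hx => ?_
    obtain ⟨l, hl, h⟩ := h1 x hx
    exact h.trans (Finset.single_le_sum
      (f := fun l => #(placements (cycleNext r l) x)) (fun _ _ => Nat.zero_le _) hl)
  have h3 : ∀ l ∈ Icc 1 L,
      ((∑ x ∈ words (ι × Bool) V k, #(placements (cycleNext r l) x) : ℕ) : ℝ) ≤
      poissonMass k (2 * Fintype.card ι) (Fintype.card V) lam * K ^ (r * L) := by
    intro l hl
    have hlL : r * l ≤ r * L := Nat.mul_le_mul_left r (Finset.mem_Icc.1 hl).2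
    have hc : Fintype.card (Fin r × Fin l) = r * l := by simp
    have h4 := sum_card_placements_le (ι := ι) (V := V) (cycleNext r l) k hlam hR0
      (by rw [hc]; omega)
    refine h4.trans ?_
    rw [hc]
    have hf := truncExp_pos k hlam
    refine mul_le_mul_of_nonneg_left ?_ hM0.le
    calc _ ≤ K ^ (r * l) := pow_le_pow_left₀ (by positivity) hK _
      _ ≤ K ^ (r * L) := pow_le_pow_right₀ hK1 hlL
  calc (#X : ℝ) * q.descFactorial r = ((#X * q.descFactorial r : ℕ) : ℝ) := by push_cast; rfl
    _ ≤ ((∑ l ∈ Icc 1 L, ∑ x ∈ words (ι × Bool) V k, #(placements (cycleNext r l) x) : ℕ) : ℝ) :=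
      Nat.cast_le.2 h2
    _ ≤ _ := by
      rw [Nat.cast_sum]
      refine (Finset.sum_le_card_nsmul _ _ _ h3).trans_eq ?_
      rw [nsmul_eq_mul, Nat.card_Icc, Nat.add_sub_cancel]

end CyclePlacements

/-! ### Consequences of the density condition and first-moment estimates. -/

theorem choose_le_exp_mul_div_pow (n s : ℕ) (hs : 1 ≤ s) :
    (n.choose s : ℝ) ≤ (Real.exp 1 * n / s) ^ s := by
  have h1 : (n.choose s : ℝ) ≤ (n : ℝ) ^ s / s.factorial := Nat.choose_le_pow_div s n
  have h2 := Real.pow_div_factorial_le_exp (s : ℝ) (Nat.cast_nonneg s) s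
  have hs0 : (0 : ℝ) < s := by exact_mod_cast hs
  have hf : (0 : ℝ) < s.factorial := by exact_mod_cast s.factorial_pos
  refine h1.trans ?_
  rw [div_pow, mul_pow, ← Real.exp_nat_mul, mul_one, div_le_div_iff₀ hf (by positivity)]
  rw [div_le_iff₀ hf] at h2
  calc (n : ℝ) ^ s * s ^ s ≤ n ^ s * (Real.exp s * s.factorial) := by gcongr
    _ = _ := by ring

section Parameters
variable {k : ℕ} {lam c γ : ℝ}

theorem lam_le_of_mean (hl : 0 < lam)
    (hb : lam * truncExp (k - 1) lam / truncExp k lam = 2 * c) : lam ≤ 2 * c := by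
  have hf := truncExp_pos k hl
  have h := truncExp_anti (Nat.sub_le k 1) hl.le
  rw [← hb, le_div_iff₀ hf]
  exact mul_le_mul_of_nonneg_left h hl.le

theorem truncExp_le_pow_of_le_one (hl : 0 < lam) (hl1 : lam ≤ 1) :
    truncExp k lam ≤ lam ^ k * Real.exp 1 := by
  have h1 := (hasSum_truncExp k 1).mul_left (lam ^ k)
  refine (hasSum_le (fun j => ?_) (hasSum_truncExp k lam) h1).trans
    (mul_le_mul_of_nonneg_left (truncExp_le_exp k zero_le_one) (by positivity))
  by_cases hj : k ≤ j
  · rw [if_pos hj, if_pos hj, one_pow, ← mul_div_assoc, mul_one]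
    exact div_le_div_of_nonneg_right (pow_le_pow_of_le_one hl.le hl1 hj) (by positivity)
  · rw [if_neg hj, if_neg hj, mul_zero]

theorem one_le_exp_div_truncExp (hl : 0 < lam) : 1 ≤ Real.exp lam / truncExp k lam := by
  rw [le_div_iff₀ (truncExp_pos k hl), one_mul]
  exact truncExp_le_exp k hl.le

theorem density_condition_iff :
    9 * Real.exp (1 + lam) * lam ^ 2 / (c * truncExp k lam) * (γ * lam ^ 2 / c) ^ (1 / 10 : ℝ) =
      9 * Real.exp 1 * (lam ^ 2 / c * (Real.exp lam / truncExp k lam) *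
        (γ * lam ^ 2 / c) ^ (1 / 10 : ℝ)) := by
  rw [Real.exp_add, div_mul_div_comm]
  ring

/-- The density condition keeps `lam` away from zero, hence bounds the expected number of
edges at a prescribed pair of vertices. -/
theorem exists_density_bound (hk : 3 ≤ k) (C : ℝ) (hγ : 0 < γ) :
    ∃ K : ℝ, 1 ≤ K ∧ ∀ c lam : ℝ, 0 < c → c ≤ C → 0 < lam →
      9 * Real.exp (1 + lam) * lam ^ 2 / (c * truncExp k lam) *
        (γ * lam ^ 2 / c) ^ (1 / 10 : ℝ) < 1 / 2 →
      2 * (lam ^ 2 / c) * (Real.exp lam / truncExp k lam) ≤ K := by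
  by_cases hC : 0 < C
  swap
  · exact ⟨1, le_rfl, fun c lam h1 h2 => absurd (h1.trans_le h2) hC⟩
  -- Lower bounds for lam² and for the tenth root. If lam ≤ 1 then f_k(lam) ≤ e lam³, and the
  -- density condition forces (γ lam²/c)^(1/10) ≤ c lam. Raising this to the tenth power gives γ ≤
  -- c^11 lam^8, hence lam² ≥ γ/C^11.
  set ν := min 1 (γ / C ^ 11) with hν
  have hν0 : 0 < ν := lt_min one_pos (by positivity)
  set w0 := (γ * ν / C) ^ (1 / 10 : ℝ) with hw0
  have hw00 : 0 < w0 := by positivity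
  refine ⟨max 1 (1 / w0), le_max_left _ _, fun c lam hc hcC hl h => ?_⟩
  rw [density_condition_iff] at h
  have hf := truncExp_pos k hl
  set Z := lam ^ 2 / c * (Real.exp lam / truncExp k lam) with hZ
  set w := (γ * lam ^ 2 / c) ^ (1 / 10 : ℝ) with hw
  have hw' : 0 < w := by positivity
  have hZ0 : 0 < Z := by positivity
  have he : 2 ≤ Real.exp 1 := by have := Real.add_one_le_exp (1 : ℝ); linarith
  have hZw : Z * w ≤ 1 / 36 := by nlinarith [mul_pos hZ0 hw']
  have hlam : ν ≤ lam ^ 2 := by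
    rcases le_total 1 lam with h1 | h1
    · exact (min_le_left _ _).trans (by nlinarith)
    · refine (min_le_right _ _).trans ?_
      have hf2 : truncExp k lam ≤ lam ^ 3 * Real.exp 1 :=
        (truncExp_le_pow_of_le_one hl h1).trans
          (mul_le_mul_of_nonneg_right (pow_le_pow_of_le_one hl.le h1 hk) (by positivity))
      have hZ1 : 1 / (c * lam * 4) ≤ Z := by
        have e3 : Real.exp 1 ≤ 4 := by have := Real.exp_one_lt_d9; linarith
        have : 1 / (lam ^ 3 * 4) ≤ Real.exp lam / truncExp k lam :=
          div_le_div₀ (Real.exp_pos _).le (Real.one_le_exp hl.le) hf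
            (hf2.trans (by gcongr))
        calc 1 / (c * lam * 4) = lam ^ 2 / c * (1 / (lam ^ 3 * 4)) := by field_simp
          _ ≤ Z := by rw [hZ]; gcongr
      have hwle : w ≤ c * lam := by
        have h2 : 1 / (c * lam * 4) * w ≤ 1 / 36 :=
          (mul_le_mul_of_nonneg_right hZ1 hw'.le).trans hZw
        rw [div_mul_eq_mul_div, one_mul, div_le_iff₀ (by positivity)] at h2
        nlinarith [mul_pos hc hl]
      have h10 : w ^ 10 = γ * lam ^ 2 / c := by
        rw [hw, ← Real.rpow_natCast, ← Real.rpow_mul (by positivity)]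
        norm_num
      have h11 : γ * lam ^ 2 / c ≤ (c * lam) ^ 10 := by
        rw [← h10]; exact pow_le_pow_left₀ hw'.le hwle 10
      rw [div_le_iff₀ hc] at h11
      have h12 : γ ≤ c ^ 11 * lam ^ 8 := by
        have : γ * lam ^ 2 ≤ c ^ 11 * lam ^ 8 * lam ^ 2 := by linarith
        exact le_of_mul_le_mul_right this (by positivity)
      rw [div_le_iff₀ (by positivity)]
      calc γ ≤ c ^ 11 * lam ^ 8 := h12
        _ ≤ C ^ 11 * lam ^ 2 := by
          have : lam ^ 8 ≤ lam ^ 2 := pow_le_pow_of_le_one hl.le h1 (by norm_num)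
          gcongr
        _ = _ := by ring
  have hww : w0 ≤ w := by
    rw [hw0, hw]
    refine Real.rpow_le_rpow (by positivity) ?_ (by norm_num)
    gcongr
  refine le_trans ?_ (le_max_right _ _)
  rw [le_div_iff₀ hw00]
  calc 2 * (lam ^ 2 / c) * (Real.exp lam / truncExp k lam) * w0 = 2 * (Z * w0) := by rw [hZ]; ring
    _ ≤ 2 * (Z * w) := by gcongr
    _ ≤ 1 := by linarith

/-- The first-moment estimate for linear sized sets spanning too many edges. -/
theorem spanning_term_le {n m s t : ℕ} (hγ : 0 < γ) (hγ1 : γ < 1 / 10) (hl : 0 < lam)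
    (hm : (m : ℝ) = c * n) (hc : 3 / 2 < c) (hn : 200 ≤ n)
    (hden : 9 * Real.exp (1 + lam) * lam ^ 2 / (c * truncExp k lam) *
        (γ * lam ^ 2 / c) ^ (1 / 10 : ℝ) < 1 / 2)
    (hs : 1 ≤ s) (hsγ : (s : ℝ) ≤ γ * n) (ht1 : 11 / 10 * (s : ℝ) + 1 ≤ t)
    (ht2 : (t : ℝ) ≤ 11 / 10 * s + 2) :
    (n.choose s : ℝ) * (m.choose t * (s : ℝ) ^ (2 * t) *
      ((lam / (2 * m - 2 * t : ℕ)) ^ (2 * t) * (Real.exp lam / truncExp k lam) ^ s)) ≤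
      (1 / 2) ^ s := by
  have hf := truncExp_pos k hl
  have hn0 : (200 : ℝ) ≤ n := by exact_mod_cast hn
  have hs0 : (1 : ℝ) ≤ s := by exact_mod_cast hs
  have hc0 : 0 < c := by linarith
  have hmn : 3 / 2 * (n : ℝ) ≤ m := by rw [hm]; gcongr
  have hsn : (s : ℝ) ≤ 1 / 10 * n := hsγ.trans (by gcongr)
  -- Here n ≥ 200 is used: t ≤ 0.11n + 2 ≤ 0.12n, and m ≥ 1.5n. It follows that R is at least 1.84m.
  have htm : (t : ℝ) ≤ 8 / 100 * m := by linarith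
  have ht0 : 1 ≤ t := by
    have : (1 : ℝ) ≤ t := by linarith
    exact_mod_cast this
  have htR : (0 : ℝ) < t := by linarith
  have hm0 : (0 : ℝ) < m := by linarith
  set R := 2 * m - 2 * t with hR
  have hRR : 184 / 100 * (m : ℝ) ≤ R := by
    have h1 : 2 * t ≤ 2 * m := by
      have : (t : ℝ) ≤ m := by linarith
      have : t ≤ m := by exact_mod_cast this
      omega
    rw [hR, Nat.cast_sub h1]
    push_cast
    linarith
  have hR0 : (0 : ℝ) < R := by linarith
  clear_value R
  set g := γ * lam ^ 2 / c with hg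
  have hg0 : 0 < g := by positivity
  rw [density_condition_iff, ← hg] at hden
  have hE := one_le_exp_div_truncExp (k := k) hl
  set E := Real.exp lam / truncExp k lam with hEdef
  have he1 := Real.exp_one_gt_d9
  have he2 := Real.exp_one_lt_d9
  have hmain : lam ^ 2 / c * E * g ^ (1 / 10 : ℝ) ≤ 1 / 36 := by
    have h0 : 0 < lam ^ 2 / c * E * g ^ (1 / 10 : ℝ) := by positivity
    have h3 : 2 * (lam ^ 2 / c * E * g ^ (1 / 10 : ℝ)) ≤
        Real.exp 1 * (lam ^ 2 / c * E * g ^ (1 / 10 : ℝ)) :=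
      mul_le_mul_of_nonneg_right (by linarith) h0.le
    linarith
  -- Needed to replace the exponent t by the smaller 11/10·s below. If g exceeded 1, then lam²/c ≥
  -- 10 because γ < 1/10, and the product just bounded by 1/36 would be at least 10.
  have hg1 : g ≤ 1 := by
    by_contra hcon
    push Not at hcon
    have h1 : 1 ≤ g ^ (1 / 10 : ℝ) := Real.one_le_rpow hcon.le (by norm_num)
    have h2 : 10 ≤ lam ^ 2 / c := by
      have : g = γ * (lam ^ 2 / c) := by rw [hg]; ring
      have h3 : 0 < lam ^ 2 / c := by positivity
      have h4 := mul_le_mul_of_nonneg_right hγ1.le h3.le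
      linarith
    have h3 : 10 ≤ lam ^ 2 / c * E * g ^ (1 / 10 : ℝ) := by
      calc (10 : ℝ) = 10 * 1 * 1 := by norm_num
        _ ≤ _ := by gcongr
    linarith
  set z := (s : ℝ) * lam ^ 2 / (c * n) with hz
  have hz0 : 0 < z := by positivity
  have hzg : z ≤ g := by
    rw [hz, hg, div_le_div_iff₀ (by positivity) hc0]
    calc (s : ℝ) * lam ^ 2 * c ≤ γ * n * lam ^ 2 * c := by gcongr
      _ = _ := by ring
  have h1 : (n.choose s : ℝ) ≤ (Real.exp 1 * n / s) ^ s := choose_le_exp_mul_div_pow n s hs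
  have h2 : (m.choose t : ℝ) ≤ (Real.exp 1 * m / t) ^ t := choose_le_exp_mul_div_pow m t ht0
  -- The numerical margin is e ≤ 1.1 · 3.38, with 1.1 from t ≥ 1.1s and 3.38 below 1.84².
  have hbase : Real.exp 1 * m / t * (s : ℝ) ^ 2 * (lam / R) ^ 2 ≤ z := by
    have hR2 : (338 / 100 : ℝ) * m ^ 2 ≤ (R : ℝ) ^ 2 := by
      have := pow_le_pow_left₀ (by positivity) hRR 2
      refine le_trans ?_ this
      rw [mul_pow]
      gcongr
      norm_num
    have ht3 : 11 / 10 * (s : ℝ) ≤ t := by linarith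
    have e1 : Real.exp 1 * m / t * (s : ℝ) ^ 2 * (lam / R) ^ 2 =
        Real.exp 1 * m * (s : ℝ) ^ 2 * lam ^ 2 / (t * (R : ℝ) ^ 2) := by
      rw [div_pow]; ring
    rw [e1, hz, ← hm, div_le_div_iff₀ (by positivity) hm0]
    calc Real.exp 1 * m * (s : ℝ) ^ 2 * lam ^ 2 * m
        = (s * lam ^ 2) * (Real.exp 1 * (s * m ^ 2)) := by ring
      _ ≤ (s * lam ^ 2) * (11 / 10 * s * (338 / 100 * m ^ 2)) := by
          have h0 : 0 < (s : ℝ) * m ^ 2 := by positivity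
          have h3 : Real.exp 1 * (s * m ^ 2) ≤ 11 / 10 * (338 / 100) * (s * m ^ 2) :=
            mul_le_mul_of_nonneg_right (by linarith) h0.le
          refine mul_le_mul_of_nonneg_left (h3.trans_eq (by ring)) (by positivity)
      _ ≤ (s * lam ^ 2) * (t * (R : ℝ) ^ 2) := by gcongr
  have hzt : z ^ t ≤ (z * z ^ (1 / 10 : ℝ)) ^ s := by
    have e1 : z * z ^ (1 / 10 : ℝ) = z ^ (11 / 10 : ℝ) := by
      rw [show (11 / 10 : ℝ) = 1 + 1 / 10 by norm_num, Real.rpow_add hz0, Real.rpow_one]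
    rw [e1, ← Real.rpow_natCast z t, ← Real.rpow_natCast (z ^ (11 / 10 : ℝ)) s,
      ← Real.rpow_mul hz0.le]
    exact Real.rpow_le_rpow_of_exponent_ge hz0 (hzg.trans hg1) (by linarith)
  calc _ ≤ (Real.exp 1 * n / s) ^ s * ((Real.exp 1 * m / t) ^ t * (s : ℝ) ^ (2 * t) *
      ((lam / R) ^ (2 * t) * E ^ s)) := by gcongr
    _ = (Real.exp 1 * n / s * E) ^ s * (Real.exp 1 * m / t * (s : ℝ) ^ 2 * (lam / R) ^ 2) ^ t := by
        rw [pow_mul, pow_mul, mul_pow _ E, mul_pow _ ((lam / R) ^ 2), mul_pow _ ((s : ℝ) ^ 2)]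
        ring
    _ ≤ (Real.exp 1 * n / s * E) ^ s * z ^ t := by gcongr
    _ ≤ (Real.exp 1 * n / s * E) ^ s * (z * z ^ (1 / 10 : ℝ)) ^ s := by gcongr
    _ = (Real.exp 1 * (lam ^ 2 / c * E * z ^ (1 / 10 : ℝ))) ^ s := by
        rw [← mul_pow]
        congr 1
        rw [hz]
        field_simp
    _ ≤ (1 / 2) ^ s := by
        have h3 : lam ^ 2 / c * E * z ^ (1 / 10 : ℝ) ≤ lam ^ 2 / c * E * g ^ (1 / 10 : ℝ) := by
          gcongr
        have h4 : 0 ≤ lam ^ 2 / c * E * z ^ (1 / 10 : ℝ) := by positivity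
        refine pow_le_pow_left₀ (by positivity) ?_ s
        calc _ ≤ 3 * (1 / 36 : ℝ) :=
              mul_le_mul (by linarith) (h3.trans hmain) h4 (by norm_num)
          _ ≤ 1 / 2 := by norm_num

/-- The first-moment estimate for small sets spanning too many edges. -/
theorem small_spanning_term_le {n m s t D : ℕ} (hn : 1 ≤ n) (hnm : n ≤ m)
    (hs : s ≤ D) (ht1 : 11 / 10 * (s : ℝ) + 1 ≤ t) (hst : s + 2 ≤ t)
    (hD : (D : ℝ) ^ 4 ≤ (n : ℝ) ^ (1 / 100 : ℝ)) :
    (n.choose s : ℝ) * (m.choose t * (s : ℝ) ^ (2 * t) * ((D : ℝ) / m) ^ (2 * t)) ≤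
      (n : ℝ) ^ (-17 / 10 : ℝ) := by
  have hn0 : (0 : ℝ) < n := by exact_mod_cast hn
  have hn1 : (1 : ℝ) ≤ n := by exact_mod_cast hn
  have hnmR : (n : ℝ) ≤ m := by exact_mod_cast hnm
  have hm0 : (0 : ℝ) < m := by linarith
  have hsD : (s : ℝ) ≤ D := by exact_mod_cast hs
  have h1 : (n.choose s : ℝ) ≤ (n : ℝ) ^ s := by exact_mod_cast Nat.choose_le_pow n s
  have h2 : (m.choose t : ℝ) ≤ (m : ℝ) ^ t := by exact_mod_cast Nat.choose_le_pow m t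
  have hbase : (m : ℝ) * (s : ℝ) ^ 2 * (D / m) ^ 2 ≤ (n : ℝ) ^ (-99 / 100 : ℝ) := by
    calc (m : ℝ) * (s : ℝ) ^ 2 * (D / m) ^ 2 = (s : ℝ) ^ 2 * D ^ 2 / m := by field_simp
      _ ≤ (D : ℝ) ^ 2 * D ^ 2 / n := by gcongr
      _ = (D : ℝ) ^ 4 / n := by ring
      _ ≤ (n : ℝ) ^ (1 / 100 : ℝ) / n := by gcongr
      _ = _ := by
        nth_rewrite 2 [← Real.rpow_one (n : ℝ)]
        rw [← Real.rpow_sub hn0]; norm_num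
  calc _ ≤ (n : ℝ) ^ s * ((m : ℝ) ^ t * (s : ℝ) ^ (2 * t) * ((D : ℝ) / m) ^ (2 * t)) := by gcongr
    _ = (n : ℝ) ^ s * ((m : ℝ) * (s : ℝ) ^ 2 * (D / m) ^ 2) ^ t := by
        rw [pow_mul, pow_mul, mul_pow, mul_pow]
    _ ≤ (n : ℝ) ^ s * ((n : ℝ) ^ (-99 / 100 : ℝ)) ^ t := by gcongr
    _ = (n : ℝ) ^ ((s : ℝ) + -99 / 100 * t) := by
        rw [Real.rpow_add hn0, Real.rpow_natCast, Real.rpow_mul hn0.le, Real.rpow_natCast]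
    _ ≤ _ := by
        refine Real.rpow_le_rpow_of_exponent_le hn1 ?_
        have hst' : (s : ℝ) + 2 ≤ t := by exact_mod_cast hst
        -- The exponent is s - 0.99t. For s ≤ 20 the integer bound t ≥ s + 2 gives 0.01s - 1.98; for
        -- larger s the proportional excess t ≥ 1.1s + 1 makes it smaller still.
        rcases le_total s 20 with h | h
        · have : (s : ℝ) ≤ 20 := by exact_mod_cast h
          linarith
        · have : (20 : ℝ) ≤ s := by exact_mod_cast h
          linarith

end Parameters

/-! ### Asymptotic comparisons valid for all large n. -/

section Asymptotics
open Filter Topology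

/-- The cut-off for vertex degrees and for small sets. -/
noncomputable def degreeCutoff (n : ℕ) : ℕ := ⌈Real.log n ^ 2⌉₊

/-- The cut-off for the lengths of short cycles. -/
noncomputable def cycleCutoff (n : ℕ) : ℕ := ⌊Real.log (Real.log n) ^ 6⌋₊

theorem tendsto_log_natCast : Tendsto (fun n : ℕ => Real.log n) atTop atTop :=
  Real.tendsto_log_atTop.comp tendsto_natCast_atTop_atTop

theorem eventually_le_rpow (M : ℝ) {θ : ℝ} (hθ : 0 < θ) : ∀ᶠ n : ℕ in atTop, M ≤ (n : ℝ) ^ θ :=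
  ((tendsto_rpow_atTop hθ).comp tendsto_natCast_atTop_atTop).eventually_ge_atTop M

theorem eventually_log_sq_le {θ : ℝ} (hθ : 0 < θ) :
    ∀ᶠ n : ℕ in atTop, Real.log n ^ 2 ≤ (n : ℝ) ^ θ := by
  have h := (isLittleO_log_rpow_rpow_atTop 2 hθ).bound one_pos
  filter_upwards [tendsto_natCast_atTop_atTop.eventually h] with n hn
  rw [one_mul, Real.norm_of_nonneg (Real.rpow_nonneg (Nat.cast_nonneg n) θ)] at hn
  have := (le_abs_self _).trans hn
  rwa [show (2 : ℝ) = ((2 : ℕ) : ℝ) by norm_num, Real.rpow_natCast] at this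

theorem eventually_degreeCutoff_le {θ : ℝ} (hθ : 0 < θ) :
    ∀ᶠ n : ℕ in atTop, (degreeCutoff n : ℝ) + 1 ≤ (n : ℝ) ^ θ := by
  filter_upwards [eventually_log_sq_le (half_pos hθ), eventually_le_rpow 3 (half_pos hθ),
    eventually_ge_atTop 1] with n h1 h2 h3
  have h4 : (degreeCutoff n : ℝ) < Real.log n ^ 2 + 1 := Nat.ceil_lt_add_one (sq_nonneg _)
  have hn : (0 : ℝ) < n := by exact_mod_cast h3
  have h5 : (n : ℝ) ^ θ = (n : ℝ) ^ (θ / 2) * (n : ℝ) ^ (θ / 2) := by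
    rw [← Real.rpow_add hn]; congr 1; ring
  nlinarith

/-- A quadratic in log n dominates every linear function of it. This is why the cut-off D is of
order log² n: exponential decay in D beats every polynomial loss. -/
theorem eventually_rpow_mul_exp_le (a : ℝ) {η : ℝ} (hη : 0 < η) {g : ℕ → ℝ}
    (hg : ∀ᶠ n : ℕ in atTop, 1 / 2 * Real.log n ^ 2 ≤ g n) :
    ∀ᶠ n : ℕ in atTop, (n : ℝ) ^ a * Real.exp (-g n) ≤ η := by
  filter_upwards [hg, tendsto_log_natCast.eventually_ge_atTop (2 * (a + 1)),
    tendsto_log_natCast.eventually_ge_atTop (-Real.log η), eventually_ge_atTop 1,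
    tendsto_log_natCast.eventually_ge_atTop 0] with n h1 h2 h3 h4 h5
  have hn : (0 : ℝ) < n := by exact_mod_cast h4
  rw [Real.rpow_def_of_pos hn, ← Real.exp_add, ← Real.le_log_iff_exp_le hη]
  nlinarith

theorem eventually_rpow_mul_half_pow_le (a : ℝ) {η : ℝ} (hη : 0 < η) :
    ∀ᶠ n : ℕ in atTop, (n : ℝ) ^ a * (1 / 2) ^ degreeCutoff n ≤ η := by
  have hlog := Real.log_two_gt_d9
  have h := eventually_rpow_mul_exp_le a hη (g := fun n => Real.log 2 * degreeCutoff n)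
    (Eventually.of_forall fun n => by
      have h1 : Real.log n ^ 2 ≤ degreeCutoff n := Nat.le_ceil _
      nlinarith [sq_nonneg (Real.log n)])
  filter_upwards [h] with n hn
  have e : (1 / 2 : ℝ) ^ degreeCutoff n = Real.exp (-(Real.log 2 * degreeCutoff n)) := by
    rw [Real.exp_neg, mul_comm, Real.exp_nat_mul, Real.exp_log two_pos, one_div, inv_pow]
  rw [e]; exact hn

theorem eventually_rpow_mul_exp_div_le (a : ℝ) {η : ℝ} (hη : 0 < η) :
    ∀ᶠ n : ℕ in atTop, (n : ℝ) ^ a * Real.exp (-((n : ℝ) / degreeCutoff n)) ≤ η := by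
  refine eventually_rpow_mul_exp_le a hη ?_
  filter_upwards [eventually_degreeCutoff_le (θ := 1 / 2) (by norm_num),
    eventually_log_sq_le (θ := 1 / 2) (by norm_num), eventually_ge_atTop 1,
    tendsto_log_natCast.eventually_ge_atTop 1] with n h1 h2 h3 h4
  have hD : (0 : ℝ) < degreeCutoff n := by
    have : Real.log n ^ 2 ≤ degreeCutoff n := Nat.le_ceil _
    nlinarith
  have hn : (0 : ℝ) < n := by exact_mod_cast h3
  have h5 : (n : ℝ) ^ (1 / 2 : ℝ) * (n : ℝ) ^ (1 / 2 : ℝ) = n := by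
    rw [← Real.rpow_add hn]; norm_num
  rw [le_div_iff₀ hD]
  have h6 : (0 : ℝ) ≤ Real.log n ^ 2 := sq_nonneg _
  have h7 : 0 ≤ (n : ℝ) ^ (1 / 2 : ℝ) := by positivity
  calc 1 / 2 * Real.log n ^ 2 * degreeCutoff n ≤ Real.log n ^ 2 * degreeCutoff n := by
        nlinarith [mul_nonneg h6 hD.le]
    _ ≤ (n : ℝ) ^ (1 / 2 : ℝ) * (n : ℝ) ^ (1 / 2 : ℝ) := by
        apply mul_le_mul h2 (by linarith) hD.le h7
    _ = n := h5

theorem eventually_rpow_mul_two_rpow_le (a : ℝ) {η y : ℝ} (hη : 0 < η) (hy : 0 < y) :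
    ∀ᶠ n : ℕ in atTop, (n : ℝ) ^ a * (2 : ℝ) ^ (-(y * n)) ≤ η := by
  have hlog := Real.log_two_gt_d9
  have h := eventually_rpow_mul_exp_le a hη (g := fun n => Real.log 2 * (y * n)) (by
    filter_upwards [eventually_log_sq_le (θ := 1 / 2) (by norm_num), eventually_ge_atTop 1,
      eventually_le_rpow (1 / y) (θ := 1 / 2) (by norm_num)] with n h1 h2 h3
    have hn : (0 : ℝ) < n := by exact_mod_cast h2
    have h5 : (n : ℝ) ^ (1 / 2 : ℝ) * (n : ℝ) ^ (1 / 2 : ℝ) = n := by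
      rw [← Real.rpow_add hn]; norm_num
    rw [div_le_iff₀ hy] at h3
    have h7 : 0 ≤ (n : ℝ) ^ (1 / 2 : ℝ) := by positivity
    have h6 : (n : ℝ) ^ (1 / 2 : ℝ) ≤ y * n := by
      calc (n : ℝ) ^ (1 / 2 : ℝ) = 1 * (n : ℝ) ^ (1 / 2 : ℝ) := (one_mul _).symm
        _ ≤ (n : ℝ) ^ (1 / 2 : ℝ) * y * (n : ℝ) ^ (1 / 2 : ℝ) := mul_le_mul_of_nonneg_right h3 h7
        _ = y * ((n : ℝ) ^ (1 / 2 : ℝ) * (n : ℝ) ^ (1 / 2 : ℝ)) := by ring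
        _ = y * n := by rw [h5]
    calc 1 / 2 * Real.log n ^ 2 ≤ 1 / 2 * (y * n) := by linarith
      _ ≤ Real.log 2 * (y * n) := by gcongr; linarith)
  filter_upwards [h] with n hn
  have e : (2 : ℝ) ^ (-(y * n)) = Real.exp (-(Real.log 2 * (y * n))) := by
    rw [Real.rpow_def_of_pos two_pos]; congr 1; ring
  rw [e]; exact hn

theorem eventually_cycleCutoff_le {δ : ℝ} (hδ : 0 < δ) :
    ∀ᶠ n : ℕ in atTop, (cycleCutoff n : ℝ) ≤ δ * Real.log n := by
  have h := (isLittleO_log_rpow_rpow_atTop 6 one_pos).bound hδ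
  filter_upwards [tendsto_log_natCast.eventually h,
    tendsto_log_natCast.eventually_ge_atTop 1] with n hn h1
  rw [Real.rpow_one, Real.norm_of_nonneg (by linarith : (0 : ℝ) ≤ Real.log n)] at hn
  have h2 := (le_abs_self _).trans hn
  rw [show (6 : ℝ) = ((6 : ℕ) : ℝ) by norm_num, Real.rpow_natCast] at h2
  exact (Nat.floor_le (by positivity)).trans h2

theorem eventually_one_le_cycleCutoff : ∀ᶠ n : ℕ in atTop, 1 ≤ cycleCutoff n := by
  filter_upwards [(Real.tendsto_log_atTop.comp tendsto_log_natCast).eventually_ge_atTop 1] with n hn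
  rw [cycleCutoff, Nat.one_le_floor_iff]
  exact one_le_pow₀ hn

/-- The cycle cut-off is o(log n), so an exponential in it is smaller than any fixed positive power
of n. -/
theorem eventually_cycle_factor_le {K θ : ℝ} (hK : 1 ≤ K) (hθ : 0 < θ) (r : ℕ) :
    ∀ᶠ n : ℕ in atTop, (cycleCutoff n : ℝ) * K ^ (r * cycleCutoff n) ≤ (n : ℝ) ^ θ := by
  have hlK := Real.log_nonneg hK
  have hpos : 0 < 1 + r * Real.log K := by positivity
  filter_upwards [eventually_cycleCutoff_le (δ := θ / (1 + r * Real.log K)) (by positivity),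
    eventually_ge_atTop 1] with n h1 h2
  have hn : (0 : ℝ) < n := by exact_mod_cast h2
  set l := cycleCutoff n
  have e1 : (l : ℝ) ≤ Real.exp l := by have := Real.add_one_le_exp (l : ℝ); linarith
  have e2 : K ^ (r * l) = Real.exp (r * l * Real.log K) := by
    rw [← Real.exp_log (by linarith : 0 < K), ← Real.exp_nat_mul, Real.log_exp]
    push_cast; rfl
  rw [e2, Real.rpow_def_of_pos hn]
  calc (l : ℝ) * Real.exp (r * l * Real.log K) ≤ Real.exp l * Real.exp (r * l * Real.log K) := by
        gcongr
    _ = Real.exp (l * (1 + r * Real.log K)) := by rw [← Real.exp_add]; congr 1; ring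
    _ ≤ Real.exp (θ / (1 + r * Real.log K) * Real.log n * (1 + r * Real.log K)) := by gcongr
    _ = _ := by congr 1; field_simp

theorem eventually_cycleCutoff_add_one_sq_le {θ : ℝ} (hθ : 0 < θ) :
    ∀ᶠ n : ℕ in atTop, ((cycleCutoff n : ℝ) + 1) ^ 2 ≤ (n : ℝ) ^ θ := by
  filter_upwards [eventually_cycleCutoff_le (δ := θ / 2) (by positivity),
    eventually_ge_atTop 1] with n h1 h2
  have hn : (0 : ℝ) < n := by exact_mod_cast h2
  rw [Real.rpow_def_of_pos hn]
  calc ((cycleCutoff n : ℝ) + 1) ^ 2 ≤ Real.exp (cycleCutoff n) ^ 2 := by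
        have := Real.add_one_le_exp (cycleCutoff n : ℝ)
        gcongr
    _ = Real.exp (2 * cycleCutoff n) := by rw [← Real.exp_nat_mul]; norm_num
    _ ≤ _ := by
        refine Real.exp_le_exp.2 ?_
        linarith

end Asymptotics

/-! ### Union bounds over vertex sets. -/

section Unions
variable {n m k D : ℕ} {lam c γ : ℝ}

/-- The number of edges required of a set of `s` vertices. -/
noncomputable def edgeQuota (s : ℕ) : ℕ := ⌈11 / 10 * (s : ℝ) + 1⌉₊

theorem le_edgeQuota (s : ℕ) : 11 / 10 * (s : ℝ) + 1 ≤ edgeQuota s := Nat.le_ceil _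

theorem edgeQuota_le (s : ℕ) : (edgeQuota s : ℝ) ≤ 11 / 10 * s + 2 := by
  have := Nat.ceil_lt_add_one (show 0 ≤ 11 / 10 * (s : ℝ) + 1 by positivity)
  unfold edgeQuota
  linarith

/-- Integrality turns the excess above s + 1 into an excess of two edges over vertices, which gives
tiny sets probability close to n^(-2) and not merely n^(-1). -/
theorem add_two_le_edgeQuota {s : ℕ} (hs : 1 ≤ s) : s + 2 ≤ edgeQuota s := by
  have h := le_edgeQuota s
  have hs' : (1 : ℝ) ≤ s := by exact_mod_cast hs
  have : (s : ℝ) + 1 < edgeQuota s := by linarith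
  have : s + 1 < edgeQuota s := by exact_mod_cast this
  omega

theorem card_exists_spanning_le (X : Finset (Fin m × Bool → Fin n)) (U : Finset ℕ) (B : ℕ → ℝ)
    (hB : ∀ s ∈ U, ∀ S : Finset (Fin n), #S = s →
      (#{x ∈ X | edgeQuota s ≤ #{i | x (i, false) ∈ S ∧ x (i, true) ∈ S}} : ℝ) ≤ B s) :
    (#{x ∈ X | ∃ S : Finset (Fin n), #S ∈ U ∧
      11 / 10 * (#S : ℝ) + 1 ≤ (#{i | x (i, false) ∈ S ∧ x (i, true) ∈ S} : ℝ)} : ℝ) ≤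
      ∑ s ∈ U, (n.choose s : ℝ) * B s := by
  classical
  have h1 : #{x ∈ X | ∃ S : Finset (Fin n), #S ∈ U ∧
      11 / 10 * (#S : ℝ) + 1 ≤ (#{i | x (i, false) ∈ S ∧ x (i, true) ∈ S} : ℝ)} ≤
      ∑ s ∈ U, ∑ S ∈ powersetCard s (univ : Finset (Fin n)),
        #{x ∈ X | edgeQuota s ≤ #{i | x (i, false) ∈ S ∧ x (i, true) ∈ S}} := by
    refine le_trans (Finset.card_le_card ?_) (Finset.card_biUnion_le.trans
      (Finset.sum_le_sum fun s _ => Finset.card_biUnion_le))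
    intro x hx
    rw [Finset.mem_filter] at hx
    obtain ⟨hx, S, hS, h⟩ := hx
    rw [Finset.mem_biUnion]
    refine ⟨#S, hS, ?_⟩
    rw [Finset.mem_biUnion]
    exact ⟨S, Finset.mem_powersetCard.2 ⟨subset_univ _, rfl⟩,
      Finset.mem_filter.2 ⟨hx, Nat.ceil_le.2 h⟩⟩
  refine (Nat.cast_le.2 h1).trans ?_
  rw [Nat.cast_sum]
  refine Finset.sum_le_sum fun s hs => ?_
  rw [Nat.cast_sum]
  refine (Finset.sum_le_card_nsmul _ _ _ fun S hS =>
    hB s hs S (Finset.mem_powersetCard.1 hS).2).trans_eq ?_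
  rw [nsmul_eq_mul, Finset.card_powersetCard, Finset.card_univ, Fintype.card_fin]

theorem card_small_spanning_le (k : ℕ) (hn : 1 ≤ n) (hnm : n ≤ m) (hDm : 5 * D + 4 ≤ m)
    (hD : (D : ℝ) ^ 4 ≤ (n : ℝ) ^ (1 / 100 : ℝ)) :
    (#{x ∈ {x ∈ words (Fin m × Bool) (Fin n) k | ∀ v, cnt x v ≤ D} |
      ∃ S : Finset (Fin n), #S ∈ Icc 1 D ∧
      11 / 10 * (#S : ℝ) + 1 ≤ (#{i | x (i, false) ∈ S ∧ x (i, true) ∈ S} : ℝ)} : ℝ) ≤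
      D * (n : ℝ) ^ (-17 / 10 : ℝ) * #(words (Fin m × Bool) (Fin n) k) := by
  set W := words (Fin m × Bool) (Fin n) k
  have h := card_exists_spanning_le {x ∈ W | ∀ v, cnt x v ≤ D} (Icc 1 D)
    (fun s => (m.choose (edgeQuota s) : ℝ) * (s : ℝ) ^ (2 * edgeQuota s) *
        (((D : ℝ) / m) ^ (2 * edgeQuota s) * #W)) (by
      intro s hs S hS
      rw [Finset.mem_Icc] at hs
      have hq : (2 * edgeQuota s : ℕ) ≤ m := by
        have h1 := edgeQuota_le s
        have h2 : (s : ℝ) ≤ D := by exact_mod_cast hs.2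
        have h3 : (5 * D + 4 : ℝ) ≤ m := by exact_mod_cast hDm
        have : (2 * edgeQuota s : ℝ) ≤ m := by
          have : (0 : ℝ) ≤ D := Nat.cast_nonneg D
          linarith
        exact_mod_cast this
      have := card_spanning_le_of_cnt_le (ι := Fin m) k S (edgeQuota s) D (R := m) (by omega)
        (by rw [Fintype.card_fin]; omega)
      rw [Fintype.card_fin, hS] at this
      convert this)
  refine h.trans ?_
  have h2 : ∀ s ∈ Icc 1 D, (n.choose s : ℝ) * ((m.choose (edgeQuota s) : ℝ) *
      (s : ℝ) ^ (2 * edgeQuota s) * (((D : ℝ) / m) ^ (2 * edgeQuota s) * #W)) ≤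
      (n : ℝ) ^ (-17 / 10 : ℝ) * #W := by
    intro s hs
    rw [Finset.mem_Icc] at hs
    have := small_spanning_term_le hn hnm hs.2 (le_edgeQuota s) (add_two_le_edgeQuota hs.1) hD
    calc _ = ((n.choose s : ℝ) * ((m.choose (edgeQuota s) : ℝ) *
      (s : ℝ) ^ (2 * edgeQuota s) * ((D : ℝ) / m) ^ (2 * edgeQuota s))) * #W := by ring
      _ ≤ _ := by gcongr
  refine (Finset.sum_le_card_nsmul _ _ _ h2).trans_eq ?_
  rw [nsmul_eq_mul, Nat.card_Icc, Nat.add_sub_cancel, mul_assoc]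

theorem card_large_spanning_le (hγ : 0 < γ) (hγ1 : γ < 1 / 10) (hl : 0 < lam)
    (hm : (m : ℝ) = c * n) (hc : 3 / 2 < c) (hn : 200 ≤ n)
    (hden : 9 * Real.exp (1 + lam) * lam ^ 2 / (c * truncExp k lam) *
        (γ * lam ^ 2 / c) ^ (1 / 10 : ℝ) < 1 / 2) (U : Finset ℕ)
    (hU : ∀ s ∈ U, D < s ∧ (s : ℝ) ≤ γ * n) :
    (#{x ∈ words (Fin m × Bool) (Fin n) k | ∃ S : Finset (Fin n), #S ∈ U ∧
      11 / 10 * (#S : ℝ) + 1 ≤ (#{i | x (i, false) ∈ S ∧ x (i, true) ∈ S} : ℝ)} : ℝ) ≤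
      #U * (poissonMass k (2 * m) n lam * (1 / 2) ^ D) := by
  set W := words (Fin m × Bool) (Fin n) k
  set M0 := poissonMass k (2 * m) n lam
  have hM0 : 0 < M0 := poissonMass_pos _ _ _ hl
  have h := card_exists_spanning_le W U
    (fun s => (m.choose (edgeQuota s) : ℝ) * (s : ℝ) ^ (2 * edgeQuota s) *
        (M0 * (lam / (2 * m - 2 * edgeQuota s : ℕ)) ^ (2 * edgeQuota s) *
        (Real.exp lam / truncExp k lam) ^ s)) (by
      intro s hs S hS
      have hq : edgeQuota s < m := by
        have h1 := edgeQuota_le s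
        have h2 := (hU s hs).2
        have hn' : (200 : ℝ) ≤ n := by exact_mod_cast hn
        have : (edgeQuota s : ℝ) < m := by
          rw [hm]
          nlinarith
        exact_mod_cast this
      have := card_spanning_le_poissonMass (ι := Fin m) k hl S (edgeQuota s)
        (R := 2 * m - 2 * edgeQuota s) (by omega) (by rw [Fintype.card_fin]; omega)
      rwa [Fintype.card_fin, Fintype.card_fin, hS] at this)
  refine h.trans ?_
  rw [← nsmul_eq_mul]
  refine Finset.sum_le_card_nsmul _ _ _ fun s hs => ?_
  have hs1 : 1 ≤ s := by have := (hU s hs).1; omega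
  have h3 := spanning_term_le hγ hγ1 hl hm hc hn hden hs1 (hU s hs).2 (le_edgeQuota s)
    (edgeQuota_le s)
  calc _ = M0 * ((n.choose s : ℝ) * (m.choose (edgeQuota s) * (s : ℝ) ^ (2 * edgeQuota s) *
      ((lam / (2 * m - 2 * edgeQuota s : ℕ)) ^ (2 * edgeQuota s) *
        (Real.exp lam / truncExp k lam) ^ s))) := by ring
    _ ≤ M0 * (1 / 2) ^ s := by gcongr
    _ ≤ M0 * (1 / 2) ^ D := by
      have h5 : (1 / 2 : ℝ) ^ s ≤ (1 / 2) ^ D :=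
        pow_le_pow_of_le_one (by norm_num) (by norm_num) (hU s hs).1.le
      gcongr

end Unions

/-! ### Comparison of all words with simple words. -/

section Comparison
variable {n m k D : ℕ} {lam c C : ℝ}

theorem poissonMass_le_sq_mul_card_words (hk : 3 ≤ k) (hn : 1 ≤ n) (hl : 0 < lam)
    (hm : (m : ℝ) = c * n) (hkc : (k : ℝ) / 2 < c) (hcC : c ≤ C)
    (hb : lam * truncExp (k - 1) lam / truncExp k lam = 2 * c)
    (hnC : Real.exp 1 * (2 * C + 1) ≤ n) :
    poissonMass k (2 * m) n lam ≤ (n : ℝ) ^ 2 * #(words (Fin m × Bool) (Fin n) k) := by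
  have hI : Fintype.card (Fin m × Bool) = 2 * m := by simp [mul_comm]
  have hn1 : (1 : ℝ) ≤ n := by exact_mod_cast hn
  have h := poissonMass_le_card_words (I := Fin m × Bool) (V := Fin n) (k := k) (by omega)
    (by rw [Fintype.card_fin]; omega) (by
      rw [Fintype.card_fin, hI]
      have : (k * n : ℝ) ≤ 2 * m := by rw [hm]; nlinarith
      exact_mod_cast this) hl (by
      rw [hb, Fintype.card_fin, hI]
      push_cast
      rw [hm]; field_simp)
  rw [hI, Fintype.card_fin] at h
  refine h.trans ?_
  push_cast
  gcongr
  calc Real.exp 1 * (2 * m + 1) ≤ Real.exp 1 * ((2 * C + 1) * n) := by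
        gcongr; rw [hm]; nlinarith
    _ = (Real.exp 1 * (2 * C + 1)) * n := by ring
    _ ≤ n * n := by gcongr
    _ = (n : ℝ) ^ 2 := by ring

/-- The words with a multiplicity above D, and those within D but with too large a sum of squares,
each make up at most a quarter. The margin +1 in A turns the second exponent into -n/D. -/
theorem card_words_le_two_mul_card_good {ρ A : ℝ} (hl : 0 < lam) (hD : 1 ≤ D)
    (hM : poissonMass k (2 * m) n lam ≤ (n : ℝ) ^ 2 * #(words (Fin m × Bool) (Fin n) k))
    (hρ : 2 ^ k * Real.exp lam ≤ ρ)
    (hK : Real.exp 2 ^ k * Real.exp ((Real.exp 2 - 1) * lam) + 1 ≤ A)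
    (h3 : (n : ℝ) ^ (3 : ℝ) * (1 / 2) ^ D ≤ 1 / (4 * ρ))
    (h2 : (n : ℝ) ^ (2 : ℝ) * Real.exp (-((n : ℝ) / D)) ≤ 1 / 4) :
    #(words (Fin m × Bool) (Fin n) k) ≤ 2 * #{x ∈ words (Fin m × Bool) (Fin n) k |
      (∀ v, cnt x v ≤ D) ∧ ∑ v, cnt x v ^ 2 ≤ ⌊A * n⌋₊} := by
  have hI : Fintype.card (Fin m × Bool) = 2 * m := by simp [mul_comm]
  have b1 := card_exists_cnt_gt_le (ι := Fin m × Bool) (V := Fin n) k hl D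
  have b2 := card_words_sq_le (I := Fin m × Bool) (V := Fin n) k hl hD A
  rw [hI, Fintype.card_fin] at b1 b2
  have hM0 := poissonMass_pos k (2 * m) n hl
  generalize poissonMass k (2 * m) n lam = M0 at *
  generalize words (Fin m × Bool) (Fin n) k = W at *
  have hsplit : #W ≤ #{x ∈ W | (∀ v, cnt x v ≤ D) ∧ ∑ v, cnt x v ^ 2 ≤ ⌊A * n⌋₊} +
      (#{x ∈ W | ¬ ∀ v, cnt x v ≤ D} +
      #{x ∈ W | (∀ v, cnt x v ≤ D) ∧ A * n < ((∑ v, cnt x v ^ 2 : ℕ) : ℝ)}) := by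
    refine le_trans (Finset.card_le_card ?_) ((Finset.card_union_le _ _).trans
      (Nat.add_le_add_left (Finset.card_union_le _ _) _))
    intro x hx
    simp only [Finset.mem_union, Finset.mem_filter, hx, true_and]
    by_cases ha : ∀ v, cnt x v ≤ D
    · by_cases hb : A * n < ((∑ v, cnt x v ^ 2 : ℕ) : ℝ)
      · exact Or.inr (Or.inr ⟨ha, hb⟩)
      · exact Or.inl ⟨ha, Nat.le_floor (not_lt.1 hb)⟩
    · exact Or.inr (Or.inl ha)
  have hρ0 : 0 < ρ := lt_of_lt_of_le (by positivity) hρ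
  have c1 : (#{x ∈ W | ¬ ∀ v, cnt x v ≤ D} : ℝ) ≤ 1 / 4 * #W := by
    calc _ ≤ n * (M0 * (2 ^ k * Real.exp lam) * (1 / 2) ^ D) := by convert b1
      _ ≤ n * ((n : ℝ) ^ 2 * #W * ρ * (1 / 2) ^ D) := by gcongr
      _ = ρ * ((n : ℝ) ^ (3 : ℝ) * (1 / 2) ^ D) * #W := by
        rw [show (3 : ℝ) = ((3 : ℕ) : ℝ) by norm_num, Real.rpow_natCast]; ring
      _ ≤ ρ * (1 / (4 * ρ)) * #W := by gcongr
      _ = 1 / 4 * #W := by field_simp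
  have c2 : (#{x ∈ W | (∀ v, cnt x v ≤ D) ∧ A * n < ((∑ v, cnt x v ^ 2 : ℕ) : ℝ)} : ℝ)
      ≤ 1 / 4 * #W := by
    have he : Real.exp ((Real.exp 2 ^ k * Real.exp ((Real.exp 2 - 1) * lam) - A) * n / D) ≤
        Real.exp (-((n : ℝ) / D)) := by
      rw [Real.exp_le_exp, ← neg_div]
      gcongr
      nlinarith [Nat.cast_nonneg (α := ℝ) n]
    calc _ ≤ M0 * Real.exp ((Real.exp 2 ^ k * Real.exp ((Real.exp 2 - 1) * lam) - A) * n / D) := by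
          convert b2
      _ ≤ ((n : ℝ) ^ 2 * #W) * Real.exp (-((n : ℝ) / D)) :=
          mul_le_mul hM he (Real.exp_pos _).le (by positivity)
      _ = (n : ℝ) ^ (2 : ℝ) * Real.exp (-((n : ℝ) / D)) * #W := by
        rw [show (2 : ℝ) = ((2 : ℕ) : ℝ) by norm_num, Real.rpow_natCast]; ring
      _ ≤ 1 / 4 * #W := by gcongr
  have hsplit' : (#W : ℝ) ≤ #{x ∈ W | (∀ v, cnt x v ≤ D) ∧ ∑ v, cnt x v ^ 2 ≤ ⌊A * n⌋₊} +
      ((#{x ∈ W | ¬ ∀ v, cnt x v ≤ D} : ℝ) +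
      #{x ∈ W | (∀ v, cnt x v ≤ D) ∧ A * n < ((∑ v, cnt x v ^ 2 : ℕ) : ℝ)}) := by
    exact_mod_cast hsplit
  have : (#W : ℝ) ≤ 2 * #{x ∈ W | (∀ v, cnt x v ≤ D) ∧ ∑ v, cnt x v ^ 2 ≤ ⌊A * n⌋₊} := by
    linarith
  exact_mod_cast this

theorem switching_size_le {B : ℕ} (hn : 1 ≤ n) (hD : (D : ℝ) + 1 ≤ (n : ℝ) ^ (1 / 4 : ℝ))
    (hB : (2 * B + 6 : ℝ) ≤ (n : ℝ) ^ (1 / 2 : ℝ)) :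
    2 * (B + (D + 2) * D + (D + 1) * D) ≤ n := by
  have hn0 : (0 : ℝ) < n := by exact_mod_cast hn
  have h1 : ((D : ℝ) + 1) ^ 2 ≤ (n : ℝ) ^ (1 / 2 : ℝ) := by
    calc ((D : ℝ) + 1) ^ 2 ≤ ((n : ℝ) ^ (1 / 4 : ℝ)) ^ 2 := by gcongr
      _ = _ := by rw [← Real.rpow_natCast, ← Real.rpow_mul hn0.le]; norm_num
  have h5 : (n : ℝ) ^ (1 / 2 : ℝ) * (n : ℝ) ^ (1 / 2 : ℝ) = n := by
    rw [← Real.rpow_add hn0]; norm_num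
  have hD0 : (0 : ℝ) ≤ D := Nat.cast_nonneg D
  have hB0 : (0 : ℝ) ≤ B := Nat.cast_nonneg B
  generalize (n : ℝ) ^ (1 / 2 : ℝ) = q at *
  have hq1 : 1 ≤ q := by linarith
  have h6 : (2 * (B + (D + 2) * D + (D + 1) * D) : ℝ) ≤ 2 * B + 6 * q := by nlinarith
  have h7 : 2 * (B : ℝ) + 6 * q ≤ (2 * B + 6) * q := by nlinarith
  have h8 : (2 * (B : ℝ) + 6) * q ≤ q * q := by gcongr
  have : (2 * (B + (D + 2) * D + (D + 1) * D) : ℝ) ≤ n := by linarith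
  exact_mod_cast this

/-- The exponent 1/(8(B + 1)) is chosen so that (D + 1)^(2B) is at most n^(1/4); the constant 4·3^B
takes the other n^(1/4). -/
theorem switching_factor_le {B : ℕ} (hn : 1 ≤ n)
    (hD : (D : ℝ) + 1 ≤ (n : ℝ) ^ (1 / (8 * ((B : ℝ) + 1))))
    (hB : (4 * 3 ^ B : ℝ) ≤ (n : ℝ) ^ (1 / 4 : ℝ)) :
    (4 * (2 * ((D + 1) * D) + 1) ^ B : ℝ) ≤ (n : ℝ) ^ (1 / 2 : ℝ) := by
  have hn1 : (1 : ℝ) ≤ n := by exact_mod_cast hn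
  have hn0 : (0 : ℝ) < n := by linarith
  have hD0 : (0 : ℝ) ≤ D := Nat.cast_nonneg D
  have h1 : (2 * (((D : ℝ) + 1) * D) + 1 : ℝ) ≤ 3 * (D + 1) ^ 2 := by nlinarith
  have h2 : (((D : ℝ) + 1) ^ 2) ^ B ≤ (n : ℝ) ^ (1 / 4 : ℝ) := by
    calc (((D : ℝ) + 1) ^ 2) ^ B = ((D : ℝ) + 1) ^ (2 * B) := by rw [pow_mul]
      _ ≤ ((n : ℝ) ^ (1 / (8 * ((B : ℝ) + 1)))) ^ (2 * B) := by gcongr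
      _ = (n : ℝ) ^ (1 / (8 * ((B : ℝ) + 1)) * (2 * B : ℕ)) := by
        rw [Real.rpow_mul hn0.le, Real.rpow_natCast]
      _ ≤ (n : ℝ) ^ (1 / 4 : ℝ) := by
        refine Real.rpow_le_rpow_of_exponent_le hn1 ?_
        push_cast
        rw [div_mul_eq_mul_div, one_mul, div_le_iff₀ (by positivity)]
        linarith
  calc (4 * (2 * ((D + 1) * D) + 1) ^ B : ℝ) ≤ 4 * (3 * ((D : ℝ) + 1) ^ 2) ^ B := by gcongr
    _ = (4 * 3 ^ B) * (((D : ℝ) + 1) ^ 2) ^ B := by rw [mul_pow]; ring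
    _ ≤ (n : ℝ) ^ (1 / 4 : ℝ) * (n : ℝ) ^ (1 / 4 : ℝ) := by gcongr
    _ = _ := by rw [← Real.rpow_add hn0]; norm_num

/-- The number of all words, and their Poisson weight, exceed the number of simple words by
at most a power of `n`. -/
theorem eventually_card_words_le (k : ℕ) (hk : 3 ≤ k) (C : ℝ) :
    ∀ᶠ n : ℕ in Filter.atTop, ∀ (m : ℕ) (c lam : ℝ), (m : ℝ) = c * n → (k : ℝ) / 2 < c → c ≤ C →
      0 < lam → lam * truncExp (k - 1) lam / truncExp k lam = 2 * c →
      (#(words (Fin m × Bool) (Fin n) k) : ℝ) ≤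
        (n : ℝ) ^ (1 / 2 : ℝ) * #(simpleWords (Fin m) (Fin n) k) ∧
      poissonMass k (2 * m) n lam ≤ (n : ℝ) ^ 3 * #(simpleWords (Fin m) (Fin n) k) := by
  -- The constants depend only on k and C: since lam ≤ 2c ≤ 2C, all lam-dependent bounds are
  -- replaced by their values at 2C. This is the source of uniformity in c.
  obtain ⟨ρ, hρ⟩ : ∃ ρ, ρ = (2 : ℝ) ^ k * Real.exp (2 * C) := ⟨_, rfl⟩
  obtain ⟨A, hA⟩ : ∃ A, A = Real.exp 2 ^ k * Real.exp ((Real.exp 2 - 1) * (2 * C)) + 1 := ⟨_, rfl⟩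
  obtain ⟨B, hB⟩ : ∃ B, B = ⌈2 * (A + 6 * A ^ 2)⌉₊ := ⟨_, rfl⟩
  have hA0 : 0 < A := by rw [hA]; positivity
  have hρ0 : 0 < ρ := by rw [hρ]; positivity
  have hBle : 2 * (A + 6 * A ^ 2) ≤ B := by rw [hB]; exact Nat.le_ceil _
  have hθ : (0 : ℝ) < 1 / (8 * (B + 1)) := by positivity
  filter_upwards [eventually_le_rpow (Real.exp 1 * (2 * C + 1)) one_pos,
    eventually_rpow_mul_half_pow_le 3 (η := 1 / (4 * ρ)) (by positivity),
    eventually_rpow_mul_exp_div_le 2 (η := 1 / 4) (by norm_num),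
    eventually_degreeCutoff_le hθ, eventually_le_rpow (4 * 3 ^ B) (θ := 1 / 4) (by norm_num),
    eventually_degreeCutoff_le (θ := 1 / 4) (by norm_num),
    eventually_le_rpow (2 * B + 6) (θ := 1 / 2) (by norm_num),
    Filter.eventually_ge_atTop 2, tendsto_log_natCast.eventually_ge_atTop 1]
    with n e1 e2 e3 e4 e5 e6 e7 e8 e9
  intro m c lam hm hkc hcC hl hb
  have hD1 : 1 ≤ degreeCutoff n := by
    rw [degreeCutoff, Nat.one_le_ceil_iff]; positivity
  generalize degreeCutoff n = D at *
  have hk3 : (3 : ℝ) ≤ k := by exact_mod_cast hk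
  have hc0 : 3 / 2 < c := by linarith
  rw [Real.rpow_one] at e1
  have hn2 : (2 : ℝ) ≤ n := by exact_mod_cast e8
  have hnm : n ≤ m := by
    have : (n : ℝ) ≤ m := by rw [hm]; nlinarith
    exact_mod_cast this
  have hlam : lam ≤ 2 * C := (lam_le_of_mean hl hb).trans (by linarith)
  have hMW := poissonMass_le_sq_mul_card_words hk (by omega) hl hm hkc hcC hb e1
  have hgood := card_words_le_two_mul_card_good (ρ := ρ) (A := A) hl hD1 hMW
    (by rw [hρ]; gcongr) (by
      have : (1 : ℝ) ≤ Real.exp 2 := Real.one_le_exp (by norm_num)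
      rw [hA]
      gcongr) e2 e3
  have hTA : ((⌊A * n⌋₊ : ℕ) : ℝ) ≤ A * (2 * Fintype.card (Fin m)) := by
    rw [Fintype.card_fin]
    have : (n : ℝ) ≤ m := by exact_mod_cast hnm
    calc ((⌊A * n⌋₊ : ℕ) : ℝ) ≤ A * n := Nat.floor_le (by positivity)
      _ ≤ A * (2 * m) := by gcongr; linarith
  have hmain := card_words_le_card_simpleWords (ι := Fin m) (V := Fin n) (k := k) (D := D) (B := B)
    (A := A) hA0.le hTA (by linarith)
    (by rw [Fintype.card_fin]; exact (switching_size_le (by omega) e6 e7).trans hnm)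
    (by rw [Fintype.card_fin]; omega) (by convert hgood)
  have hWS : (#(words (Fin m × Bool) (Fin n) k) : ℝ) ≤
      (n : ℝ) ^ (1 / 2 : ℝ) * #(simpleWords (Fin m) (Fin n) k) := by
    have : (#(words (Fin m × Bool) (Fin n) k) : ℝ) ≤ (4 * (2 * ((D + 1) * D) + 1) ^ B : ℝ) *
        #(simpleWords (Fin m) (Fin n) k) := by exact_mod_cast hmain
    exact this.trans (mul_le_mul_of_nonneg_right (switching_factor_le (by omega) e4 e5)
      (Nat.cast_nonneg _))
  refine ⟨hWS, hMW.trans ?_⟩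
  have h6 : (n : ℝ) ^ (1 / 2 : ℝ) ≤ n := by
    calc (n : ℝ) ^ (1 / 2 : ℝ) ≤ (n : ℝ) ^ (1 : ℝ) :=
          Real.rpow_le_rpow_of_exponent_le (by linarith) (by norm_num)
      _ = n := Real.rpow_one _
  calc (n : ℝ) ^ 2 * (#(words (Fin m × Bool) (Fin n) k) : ℝ) ≤
        (n : ℝ) ^ 2 * (n * #(simpleWords (Fin m) (Fin n) k)) :=
        mul_le_mul_of_nonneg_left (hWS.trans (mul_le_mul_of_nonneg_right h6 (Nat.cast_nonneg _)))
          (by positivity)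
    _ = _ := by ring

end Comparison

/-! ### Each exceptional class is at most η/n of a multiple s of the right order. -/

section ErrorTerms
variable {n m k D : ℕ} {lam c γ η s : ℝ}

theorem card_exists_cnt_gt_le_div {ρ : ℝ} (hn : 1 ≤ n) (hl : 0 < lam)
    (hM : poissonMass k (2 * m) n lam ≤ (n : ℝ) ^ 3 * s) (hs : 0 ≤ s)
    (hρ : 2 ^ k * Real.exp lam ≤ ρ) (hD : (n : ℝ) ^ (5 : ℝ) * (1 / 2) ^ D ≤ η / ρ) :
    (#{x ∈ words (Fin m × Bool) (Fin n) k | ¬ ∀ v, cnt x v ≤ D} : ℝ) ≤ η / n * s := by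
  have hI : Fintype.card (Fin m × Bool) = 2 * m := by simp [mul_comm]
  have b1 := card_exists_cnt_gt_le (ι := Fin m × Bool) (V := Fin n) k hl D
  rw [hI, Fintype.card_fin] at b1
  have hM0 := poissonMass_pos k (2 * m) n hl
  have hn0 : (0 : ℝ) < n := by exact_mod_cast hn
  have hρ0 : 0 < ρ := lt_of_lt_of_le (by positivity) hρ
  rw [show (5 : ℝ) = ((5 : ℕ) : ℝ) by norm_num, Real.rpow_natCast, le_div_iff₀ hρ0] at hD
  calc _ ≤ n * (poissonMass k (2 * m) n lam * (2 ^ k * Real.exp lam) * (1 / 2) ^ D) := by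
        convert b1
    _ ≤ n * ((n : ℝ) ^ 3 * s * ρ * (1 / 2) ^ D) := by gcongr
    _ = (n : ℝ) ^ 5 * (1 / 2) ^ D * ρ / n * s := by field_simp
    _ ≤ η / n * s := by gcongr

/-- The powers are D·n^(-1.7)·n^(1/2) ≤ n^(-1.1); the spare n^(-0.1) absorbs 1/η. -/
theorem card_small_spanning_le_div (k : ℕ) (hn : 1 ≤ n) (hnm : n ≤ m) (hDm : 5 * D + 4 ≤ m)
    (hD : (D : ℝ) ^ 4 ≤ (n : ℝ) ^ (1 / 100 : ℝ)) (hη : 0 < η)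
    (hW : (#(words (Fin m × Bool) (Fin n) k) : ℝ) ≤ (n : ℝ) ^ (1 / 2 : ℝ) * s) (hs : 0 ≤ s)
    (hD' : (D : ℝ) + 1 ≤ (n : ℝ) ^ (1 / 10 : ℝ)) (hη' : 1 / η ≤ (n : ℝ) ^ (1 / 10 : ℝ)) :
    (#{x ∈ {x ∈ words (Fin m × Bool) (Fin n) k | ∀ v, cnt x v ≤ D} |
      ∃ S : Finset (Fin n), #S ∈ Icc 1 D ∧
      11 / 10 * (#S : ℝ) + 1 ≤ (#{i | x (i, false) ∈ S ∧ x (i, true) ∈ S} : ℝ)} : ℝ) ≤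
      η / n * s := by
  have hn0 : (0 : ℝ) < n := by exact_mod_cast hn
  refine (card_small_spanning_le k hn hnm hDm hD).trans ?_
  have h1 : 1 ≤ η * (n : ℝ) ^ (1 / 10 : ℝ) := by rwa [div_le_iff₀' hη] at hη'
  calc (D : ℝ) * (n : ℝ) ^ (-17 / 10 : ℝ) * (#(words (Fin m × Bool) (Fin n) k) : ℝ)
      ≤ (n : ℝ) ^ (1 / 10 : ℝ) * (n : ℝ) ^ (-17 / 10 : ℝ) * ((n : ℝ) ^ (1 / 2 : ℝ) * s) :=
        mul_le_mul (mul_le_mul_of_nonneg_right (by linarith) (by positivity)) hW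
          (Nat.cast_nonneg _) (by positivity)
    _ = 1 * ((n : ℝ) ^ (1 / 10 : ℝ) * (n : ℝ) ^ (-17 / 10 : ℝ) * (n : ℝ) ^ (1 / 2 : ℝ)) * s := by
        ring
    _ ≤ η * (n : ℝ) ^ (1 / 10 : ℝ) *
        ((n : ℝ) ^ (1 / 10 : ℝ) * (n : ℝ) ^ (-17 / 10 : ℝ) * (n : ℝ) ^ (1 / 2 : ℝ)) * s := by
        gcongr
    _ = η * ((n : ℝ) ^ (1 / 10 : ℝ) * ((n : ℝ) ^ (1 / 10 : ℝ) * (n : ℝ) ^ (-17 / 10 : ℝ) *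
        (n : ℝ) ^ (1 / 2 : ℝ))) * s := by ring
    _ = η * (n : ℝ) ^ (-1 : ℝ) * s := by
        rw [← Real.rpow_add hn0, ← Real.rpow_add hn0, ← Real.rpow_add hn0]; norm_num
    _ = η / n * s := by rw [Real.rpow_neg_one]; ring

theorem card_large_spanning_le_div (hγ : 0 < γ) (hγ1 : γ < 1 / 10) (hl : 0 < lam)
    (hm : (m : ℝ) = c * n) (hc : 3 / 2 < c) (hn : 200 ≤ n)
    (hden : 9 * Real.exp (1 + lam) * lam ^ 2 / (c * truncExp k lam) *
        (γ * lam ^ 2 / c) ^ (1 / 10 : ℝ) < 1 / 2)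
    (hM : poissonMass k (2 * m) n lam ≤ (n : ℝ) ^ 3 * s) (hs : 0 ≤ s)
    (hD : (n : ℝ) ^ (5 : ℝ) * (1 / 2) ^ D ≤ η / 2) :
    (#{x ∈ words (Fin m × Bool) (Fin n) k | ∃ S : Finset (Fin n), (D < #S ∧ (#S : ℝ) ≤ γ * n) ∧
      11 / 10 * (#S : ℝ) + 1 ≤ (#{i | x (i, false) ∈ S ∧ x (i, true) ∈ S} : ℝ)} : ℝ) ≤
      η / n * s := by
  classical
  have hn1 : (1 : ℝ) ≤ n := by exact_mod_cast (by omega : 1 ≤ n)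
  have hM0 := poissonMass_pos k (2 * m) n hl
  have h := card_large_spanning_le hγ hγ1 hl hm hc hn hden
    {t ∈ range (n + 1) | D < t ∧ (t : ℝ) ≤ γ * n} (fun t ht => (Finset.mem_filter.1 ht).2)
  have hU : (#{t ∈ range (n + 1) | D < t ∧ (t : ℝ) ≤ γ * n} : ℝ) ≤ 2 * n := by
    have h1 : #{t ∈ range (n + 1) | D < t ∧ (t : ℝ) ≤ γ * n} ≤ n + 1 :=
      (Finset.card_filter_le _ _).trans_eq (Finset.card_range _)
    have h2 : (#{t ∈ range (n + 1) | D < t ∧ (t : ℝ) ≤ γ * n} : ℝ) ≤ n + 1 := by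
      exact_mod_cast h1
    linarith
  rw [show (5 : ℝ) = ((5 : ℕ) : ℝ) by norm_num, Real.rpow_natCast] at hD
  refine le_trans (Nat.cast_le.2 (Finset.card_le_card ?_)) (h.trans ?_)
  · intro x hx
    rw [Finset.mem_filter] at hx ⊢
    obtain ⟨hx, S, hS, h⟩ := hx
    refine ⟨hx, S, Finset.mem_filter.2 ⟨Finset.mem_range.2 ?_, hS⟩, h⟩
    have := Finset.card_le_univ S
    rw [Fintype.card_fin] at this
    omega
  · calc _ ≤ (2 * n : ℝ) * ((n : ℝ) ^ 3 * s * (1 / 2) ^ D) :=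
          mul_le_mul hU (mul_le_mul_of_nonneg_right hM (by positivity)) (by positivity)
            (by positivity)
      _ = 2 * ((n : ℝ) ^ 5 * (1 / 2) ^ D) / n * s := by field_simp
      _ ≤ 2 * (η / 2) / n * s := by gcongr
      _ = η / n * s := by ring

theorem card_exists_sum_cnt_ge_le_div {y H : ℝ} (hn : 1 ≤ n) (hl : 0 < lam) (hy : 0 < y)
    (hy1 : y ≤ 1) (hH : (2 * (k + lam) - Real.logb 2 y + 3) * (y * n) ≤ H)
    (hM : poissonMass k (2 * m) n lam ≤ (n : ℝ) ^ 3 * s) (hs : 0 ≤ s)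
    (hn4 : (n : ℝ) ^ (4 : ℝ) * (2 : ℝ) ^ (-(y * n)) ≤ η) :
    (#{x ∈ words (Fin m × Bool) (Fin n) k | ∃ S : Finset (Fin n), (#S : ℝ) ≤ y * n ∧
        H ≤ ((∑ v ∈ S, cnt x v : ℕ) : ℝ)} : ℝ) ≤ η / n * s := by
  have hI : Fintype.card (Fin m × Bool) = 2 * m := by simp [mul_comm]
  have hn0 : (0 : ℝ) < n := by exact_mod_cast hn
  have h := card_exists_sum_cnt_ge_le (ι := Fin m × Bool) (V := Fin n) k (H := H) hl hy hy1
    (by rwa [Fintype.card_fin])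
  rw [hI, Fintype.card_fin] at h
  rw [show (4 : ℝ) = ((4 : ℕ) : ℝ) by norm_num, Real.rpow_natCast] at hn4
  calc _ ≤ poissonMass k (2 * m) n lam * (2 : ℝ) ^ (-(y * n)) := by convert h
    _ ≤ (n : ℝ) ^ 3 * s * (2 : ℝ) ^ (-(y * n)) := by gcongr
    _ = (n : ℝ) ^ 4 * (2 : ℝ) ^ (-(y * n)) / n * s := by field_simp
    _ ≤ η / n * s := by gcongr

/-- The quotient by L(L + 1) costs at most n^(1/20), and the rounding and shifts are covered by a
second n^(1/20), so each of the six factors is at least n^(0.9). -/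
theorem rpow_le_descFactorial {L : ℕ} (hn : 1 ≤ n) (hL : 1 ≤ L)
    (hL2 : ((L : ℝ) + 1) ^ 2 ≤ (n : ℝ) ^ (1 / 20 : ℝ)) (h7 : 7 ≤ (n : ℝ) ^ (1 / 20 : ℝ)) :
    (n : ℝ) ^ (27 / 5 : ℝ) ≤ (n / (L * (L + 1))).descFactorial 6 := by
  have hn1 : (1 : ℝ) ≤ n := by exact_mod_cast hn
  have hn0 : (0 : ℝ) < n := by linarith
  set q := n / (L * (L + 1)) with hq
  have hL1 : (1 : ℝ) ≤ L := by exact_mod_cast hL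
  have h1 : (n : ℝ) < (q + 1) * (L * (L + 1)) := by
    have h := Nat.lt_div_mul_add (a := n) (b := L * (L + 1)) (by positivity)
    have h' : n < (q + 1) * (L * (L + 1)) := by rw [add_mul, one_mul]; exact h
    exact_mod_cast h'
  have h2 : (n : ℝ) ^ (19 / 20 : ℝ) ≤ q + 1 := by
    have e : (n : ℝ) ^ (19 / 20 : ℝ) * (n : ℝ) ^ (1 / 20 : ℝ) = n := by
      rw [← Real.rpow_add hn0]; norm_num
    have hp : 0 < (n : ℝ) ^ (1 / 20 : ℝ) := by positivity
    have h3 : (n : ℝ) ^ (19 / 20 : ℝ) * (n : ℝ) ^ (1 / 20 : ℝ) ≤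
        (q + 1) * (n : ℝ) ^ (1 / 20 : ℝ) := by
      rw [e]
      refine h1.le.trans (mul_le_mul_of_nonneg_left ?_ (by positivity))
      nlinarith
    exact le_of_mul_le_mul_right h3 hp
  have h4 : (n : ℝ) ^ (9 / 10 : ℝ) + 6 ≤ (n : ℝ) ^ (19 / 20 : ℝ) := by
    have e : (n : ℝ) ^ (19 / 20 : ℝ) = (n : ℝ) ^ (9 / 10 : ℝ) * (n : ℝ) ^ (1 / 20 : ℝ) := by
      rw [← Real.rpow_add hn0]; norm_num
    have : 1 ≤ (n : ℝ) ^ (9 / 10 : ℝ) := Real.one_le_rpow hn1 (by norm_num)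
    rw [e]
    nlinarith
  have h5 : (n : ℝ) ^ (9 / 10 : ℝ) + 5 ≤ q := by linarith
  have hq5 : 5 ≤ q := by
    have : (5 : ℝ) ≤ q := by
      have : 0 ≤ (n : ℝ) ^ (9 / 10 : ℝ) := by positivity
      linarith
    exact_mod_cast this
  have h6 := Nat.pow_sub_le_descFactorial q 6
  have h8 : ((q : ℝ) - 5) ^ 6 ≤ q.descFactorial 6 := by
    have e : ((q + 1 - 6 : ℕ) : ℝ) = (q : ℝ) - 5 := by
      rw [show q + 1 - 6 = q - 5 by omega, Nat.cast_sub hq5]; norm_num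
    rw [← e]
    exact_mod_cast h6
  refine le_trans ?_ h8
  calc (n : ℝ) ^ (27 / 5 : ℝ) = ((n : ℝ) ^ (9 / 10 : ℝ)) ^ 6 := by
        rw [← Real.rpow_natCast, ← Real.rpow_mul hn0.le]; norm_num
    _ ≤ _ := by gcongr; linarith

/-- Six cycles are ample: n^5.4 beats n³ from `poissonMass`, n from the error rate, and n^0.2 for
the cycle factor and 1/η. -/
theorem card_disjoint_cycles_le_div {L : ℕ} {K r : ℝ} (hn : 1 ≤ n) (hnm : n ≤ m) (hl : 0 < lam)
    (hm : (m : ℝ) = c * n) (hc : 0 < c) (hL : 1 ≤ L) (hr : 0 < r) (hLr : r ≤ L + 1)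
    (hK1 : 1 ≤ K) (hK : 2 * (lam ^ 2 / c) * (Real.exp lam / truncExp k lam) ≤ K)
    (hL2 : ((L : ℝ) + 1) ^ 2 ≤ (n : ℝ) ^ (1 / 20 : ℝ)) (h12 : 12 ≤ (n : ℝ) ^ (1 / 20 : ℝ))
    (hfac : (L : ℝ) * K ^ (6 * L) ≤ (n : ℝ) ^ (1 / 10 : ℝ))
    (hη : 0 < η) (hη' : 1 / η ≤ (n : ℝ) ^ (1 / 10 : ℝ))
    (hM : poissonMass k (2 * m) n lam ≤ (n : ℝ) ^ 3 * s) (hs : 0 ≤ s)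
    (X : Finset (Fin m × Bool → Fin n)) (hX : X ⊆ simpleWords (Fin m) (Fin n) k)
    (hcyc : ∀ x ∈ X, ∃ t : ℕ, 2 * (n : ℝ) / r ≤ t ∧ HasDisjointCycles (graphOf x) t) :
    (#X : ℝ) ≤ η / n * s := by
  have hn1 : (1 : ℝ) ≤ n := by exact_mod_cast hn
  have hn0 : (0 : ℝ) < n := by linarith
  have hm0 : 0 < m := by omega
  have hmR : (0 : ℝ) < m := by exact_mod_cast hm0
  have hM0 := poissonMass_pos k (2 * m) n hl
  have hLm : 12 * L ≤ m := by
    refine le_trans ?_ hnm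
    have h1 : (L : ℝ) ≤ (n : ℝ) ^ (1 / 20 : ℝ) := by
      have : (0 : ℝ) ≤ L := Nat.cast_nonneg L
      nlinarith
    have : (12 * L : ℝ) ≤ n := by
      calc (12 * L : ℝ) ≤ (n : ℝ) ^ (1 / 20 : ℝ) * (n : ℝ) ^ (1 / 20 : ℝ) := by gcongr
        _ = (n : ℝ) ^ (1 / 10 : ℝ) := by rw [← Real.rpow_add hn0]; norm_num
        _ ≤ (n : ℝ) ^ (1 : ℝ) := Real.rpow_le_rpow_of_exponent_le hn1 (by norm_num)
        _ = n := Real.rpow_one _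
    exact_mod_cast this
  -- From t ≥ 2n/r and r ≤ L + 1 follows t(L + 1) ≥ 2n. One n pays for the long cycles; the other
  -- leaves q = n/(L(L + 1)) short cycles of one length. With R = m the base of the moment bound is
  -- exactly the quantity controlled by the density condition.
  have h := card_disjoint_cycles_le (ι := Fin m) (V := Fin n) k hl (L := L)
    (q := n / (L * (L + 1))) (r := 6) hL (R := m) hm0 (by rw [Fintype.card_fin]; omega) (K := K) hK1
    (by
      rw [Fintype.card_fin, Fintype.card_fin]
      refine le_of_eq_of_le ?_ hK
      rw [hm]
      field_simp) X hX (fun x hx => by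
      obtain ⟨t, ht, hd⟩ := hcyc x hx
      refine ⟨t, ?_, hd⟩
      rw [Fintype.card_fin]
      have h1 : n / (L * (L + 1)) * L * (L + 1) ≤ n := by
        rw [mul_assoc]; exact Nat.div_mul_le_self _ _
      have h2 : (2 * n : ℝ) ≤ t * (L + 1) := by
        rw [div_le_iff₀ hr] at ht
        exact ht.trans (by gcongr)
      have h3 : 2 * n ≤ t * (L + 1) := by exact_mod_cast h2
      omega)
  rw [Fintype.card_fin, Fintype.card_fin] at h
  have hq := rpow_le_descFactorial hn hL hL2 (by linarith)
  have hpos : 0 < (n : ℝ) ^ (27 / 5 : ℝ) := by positivity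
  have h1 : 1 ≤ η * (n : ℝ) ^ (1 / 10 : ℝ) := by rwa [div_le_iff₀' hη] at hη'
  have h2 : (#X : ℝ) * (n : ℝ) ^ (27 / 5 : ℝ) ≤ η / n * s * (n : ℝ) ^ (27 / 5 : ℝ) := by
    calc (#X : ℝ) * (n : ℝ) ^ (27 / 5 : ℝ) ≤ L * (poissonMass k (2 * m) n lam * K ^ (6 * L)) :=
          (mul_le_mul_of_nonneg_left hq (Nat.cast_nonneg _)).trans h
      _ = (L * K ^ (6 * L)) * poissonMass k (2 * m) n lam := by ring
      _ ≤ (n : ℝ) ^ (1 / 10 : ℝ) * ((n : ℝ) ^ 3 * s) := by gcongr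
      _ = 1 * ((n : ℝ) ^ (1 / 10 : ℝ) * (n : ℝ) ^ (3 : ℝ)) * s := by
          rw [show (3 : ℝ) = ((3 : ℕ) : ℝ) by norm_num, Real.rpow_natCast]; ring
      _ ≤ η * (n : ℝ) ^ (1 / 10 : ℝ) * ((n : ℝ) ^ (1 / 10 : ℝ) * (n : ℝ) ^ (3 : ℝ)) * s := by
          gcongr
      _ = η * ((n : ℝ) ^ (1 / 10 : ℝ) * ((n : ℝ) ^ (1 / 10 : ℝ) * (n : ℝ) ^ (3 : ℝ))) * s := by
          ring
      _ ≤ η * (n : ℝ) ^ (22 / 5 : ℝ) * s := by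
          rw [← Real.rpow_add hn0, ← Real.rpow_add hn0]
          have := Real.rpow_le_rpow_of_exponent_le hn1
            (show (1 / 10 + (1 / 10 + 3) : ℝ) ≤ 22 / 5 by norm_num)
          gcongr
      _ = η / n * s * (n : ℝ) ^ (27 / 5 : ℝ) := by
          have : (n : ℝ) ^ (27 / 5 : ℝ) = (n : ℝ) ^ (22 / 5 : ℝ) * n := by
            rw [show (27 / 5 : ℝ) = 22 / 5 + 1 by norm_num, Real.rpow_add_one hn0.ne']
          rw [this]
          field_simp
  exact le_of_mul_le_mul_right h2 hpos

end ErrorTerms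

/-! ### Assembly of the error terms. -/

section Main
variable {n m k : ℕ}

/-- The three conclusions about a graph with vertex set `Fin n`. -/
def IsTypical (β γ : ℝ) (G : SimpleGraph (Fin n)) : Prop :=
  (∀ S : Finset (Fin n), (S.card : ℝ) ≤ γ * n →
    (edgesSpanned G S : ℝ) < 11 / 10 * S.card + 1) ∧
  (∀ S : Finset (Fin n), (S.card : ℝ) ≤ β * γ * n →
    (edgesIncident G S : ℝ) < 2 * (1 - β) * γ * n) ∧
  (∀ t : ℕ, 2 * (n : ℝ) / Real.log (Real.log n) ^ 6 ≤ t → ¬ HasDisjointCycles G t)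

-- A deterministic covering: the multiplicity bound D and the size threshold D split the failures of
-- the first conclusion, and the other two conclusions give one class each. The empty set is set
-- aside, since it spans 0 < 1 edges.
open Classical in
theorem atypical_subset (β γ : ℝ) (D : ℕ) :
    {x ∈ simpleWords (Fin m) (Fin n) k | ¬ IsTypical β γ (graphOf x)} ⊆
      {x ∈ words (Fin m × Bool) (Fin n) k | ¬ ∀ v, cnt x v ≤ D} ∪
      ({x ∈ {x ∈ words (Fin m × Bool) (Fin n) k | ∀ v, cnt x v ≤ D} |
        ∃ S : Finset (Fin n), #S ∈ Icc 1 D ∧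
        11 / 10 * (#S : ℝ) + 1 ≤ (#{i | x (i, false) ∈ S ∧ x (i, true) ∈ S} : ℝ)} ∪
      ({x ∈ words (Fin m × Bool) (Fin n) k | ∃ S : Finset (Fin n),
        (D < #S ∧ (#S : ℝ) ≤ γ * n) ∧
        11 / 10 * (#S : ℝ) + 1 ≤ (#{i | x (i, false) ∈ S ∧ x (i, true) ∈ S} : ℝ)} ∪
      ({x ∈ words (Fin m × Bool) (Fin n) k | ∃ S : Finset (Fin n), (#S : ℝ) ≤ β * γ * n ∧
        2 * (1 - β) * γ * n ≤ ((∑ v ∈ S, cnt x v : ℕ) : ℝ)} ∪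
      {x ∈ simpleWords (Fin m) (Fin n) k | ∃ t : ℕ,
        2 * (n : ℝ) / Real.log (Real.log n) ^ 6 ≤ t ∧ HasDisjointCycles (graphOf x) t}))) := by
  intro x hx
  obtain ⟨hxS, hx⟩ := Finset.mem_filter.1 hx
  obtain ⟨hxW, hbad⟩ := mem_simpleWords.1 hxS
  simp only [Finset.mem_union, Finset.mem_filter, hxS, hxW, true_and]
  by_cases hD : ∀ v, cnt x v ≤ D
  · by_contra hcon
    push Not at hcon
    obtain ⟨-, h1, h2, h3, h4⟩ := hcon
    refine hx ⟨fun S hS => ?_, fun S hS => ?_, fun t ht => h4 t ht⟩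
    · have he : (edgesSpanned (graphOf x) S : ℝ) ≤
          #{i | x (i, false) ∈ S ∧ x (i, true) ∈ S} := by
        exact_mod_cast edgesSpanned_graphOf_le hbad S
      refine he.trans_lt ?_
      rcases Nat.eq_zero_or_pos #S with h0 | h0
      · rw [Finset.card_eq_zero] at h0
        subst h0
        simp
      · rcases le_or_gt #S D with hSD | hSD
        · exact h1 hD S (Finset.mem_Icc.2 ⟨h0, hSD⟩)
        · exact h2 S ⟨hSD, hS⟩
    · have he : (edgesIncident (graphOf x) S : ℝ) ≤ ((∑ v ∈ S, cnt x v : ℕ) : ℝ) := by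
        exact_mod_cast edgesIncident_graphOf_le hbad S
      exact he.trans_lt (h3 S hS)
  · exact Or.inl hD

open Classical in
theorem eventually_card_atypical_le (hk : 3 ≤ k) {C β γ η : ℝ} (hβ : 0 < β) (hβ1 : β < 1)
    (hγ : 0 < γ) (hγ1 : γ < 1 / 10) (hη : 0 < η) :
    ∀ᶠ n : ℕ in Filter.atTop, ∀ (m : ℕ) (c lam : ℝ),
      (m : ℝ) = c * n → (k : ℝ) / 2 < c → c ≤ C → 0 < lam →
      lam * truncExp (k - 1) lam / truncExp k lam = 2 * c →
      9 * Real.exp (1 + lam) * lam ^ 2 / (c * truncExp k lam) *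
        (γ * lam ^ 2 / c) ^ (1 / 10 : ℝ) < 1 / 2 →
      (2 * (k + lam) - Real.logb 2 (β * γ) + 3) * β < 2 * (1 - β) →
      0 < #(simpleWords (Fin m) (Fin n) k) ∧
      (#{x ∈ simpleWords (Fin m) (Fin n) k | ¬ IsTypical β γ (graphOf x)} : ℝ) ≤
        5 * (η / n) * #(simpleWords (Fin m) (Fin n) k) := by
  obtain ⟨ρ, hρ⟩ : ∃ ρ, ρ = (2 : ℝ) ^ k * Real.exp (2 * C) := ⟨_, rfl⟩
  have hρ0 : 0 < ρ := by rw [hρ]; positivity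
  obtain ⟨K, hK1, hK⟩ := exists_density_bound hk C hγ
  filter_upwards [eventually_card_words_le k hk C, Filter.eventually_ge_atTop 200,
    eventually_rpow_mul_half_pow_le 5 (η := η / ρ) (by positivity),
    eventually_rpow_mul_half_pow_le 5 (η := η / 2) (by positivity),
    eventually_degreeCutoff_le (θ := 1 / 400) (by norm_num),
    eventually_degreeCutoff_le (θ := 1 / 10) (by norm_num),
    eventually_le_rpow (1 / η) (θ := 1 / 10) (by norm_num),
    eventually_le_rpow 5 (θ := 1 / 10) (by norm_num),
    eventually_rpow_mul_two_rpow_le 4 hη (mul_pos hβ hγ),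
    eventually_one_le_cycleCutoff,
    eventually_cycleCutoff_add_one_sq_le (θ := 1 / 20) (by norm_num),
    eventually_le_rpow 12 (θ := 1 / 20) (by norm_num),
    eventually_cycle_factor_le hK1 (θ := 1 / 10) (by norm_num) 6]
    with n ew e200 e1 e2 e3 e4 e5 e6 e7 e8 e9 e10 e11
  intro m c lam hm hkc hcC hl hb hden hinc
  obtain ⟨hW, hM⟩ := ew m c lam hm hkc hcC hl hb
  have hk3 : (3 : ℝ) ≤ k := by exact_mod_cast hk
  have hc0 : 3 / 2 < c := by linarith
  have hn200 : (200 : ℝ) ≤ n := by exact_mod_cast e200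
  have hn0 : (0 : ℝ) < n := by linarith
  have hnm : n ≤ m := by
    have : (n : ℝ) ≤ m := by rw [hm]; nlinarith
    exact_mod_cast this
  have hlam : lam ≤ 2 * C := (lam_le_of_mean hl hb).trans (by linarith)
  have hs : (0 : ℝ) ≤ #(simpleWords (Fin m) (Fin n) k) := Nat.cast_nonneg _
  have hM0 := poissonMass_pos k (2 * m) n hl
  refine ⟨?_, ?_⟩
  · have : (0 : ℝ) < #(simpleWords (Fin m) (Fin n) k) := by
      by_contra hcon
      have : (#(simpleWords (Fin m) (Fin n) k) : ℝ) = 0 := le_antisymm (not_lt.1 hcon) hs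
      rw [this, mul_zero] at hM
      linarith
    exact_mod_cast this
  have b1 := card_exists_cnt_gt_le_div (ρ := ρ) (by omega) hl hM hs (by rw [hρ]; gcongr) e1
  have hD4 : (degreeCutoff n : ℝ) ^ 4 ≤ (n : ℝ) ^ (1 / 100 : ℝ) := by
    calc (degreeCutoff n : ℝ) ^ 4 ≤ ((n : ℝ) ^ (1 / 400 : ℝ)) ^ 4 := by gcongr; linarith
      _ = (n : ℝ) ^ (1 / 100 : ℝ) := by
        rw [← Real.rpow_natCast, ← Real.rpow_mul hn0.le]; norm_num
  have hDm : 5 * degreeCutoff n + 4 ≤ m := by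
    refine le_trans ?_ hnm
    have : (5 * degreeCutoff n + 4 : ℝ) ≤ n := by
      calc (5 * degreeCutoff n + 4 : ℝ) ≤ 5 * (degreeCutoff n + 1) := by linarith
        _ ≤ (n : ℝ) ^ (1 / 10 : ℝ) * (n : ℝ) ^ (1 / 10 : ℝ) := by gcongr
        _ = (n : ℝ) ^ (1 / 5 : ℝ) := by rw [← Real.rpow_add hn0]; norm_num
        _ ≤ (n : ℝ) ^ (1 : ℝ) := Real.rpow_le_rpow_of_exponent_le (by linarith) (by norm_num)
        _ = n := Real.rpow_one _
    exact_mod_cast this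
  have b2 := card_small_spanning_le_div k (by omega) hnm hDm hD4 hη hW hs e4 e5
  have b3 := card_large_spanning_le_div hγ hγ1 hl hm hc0 e200 hden hM hs e2
  have b4 := card_exists_sum_cnt_ge_le_div (k := k) (y := β * γ) (H := 2 * (1 - β) * γ * n)
    (by omega) hl (by positivity) (by nlinarith) (by
      calc _ = ((2 * (k + lam) - Real.logb 2 (β * γ) + 3) * β) * (γ * n) := by ring
        _ ≤ (2 * (1 - β)) * (γ * n) := by gcongr
        _ = _ := by ring) hM hs e7
  have hr1 : 1 ≤ Real.log (Real.log n) ^ 6 := (Nat.one_le_floor_iff _).1 e8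
  have b5 := card_disjoint_cycles_le_div (by omega) hnm hl hm (by linarith) e8
    (r := Real.log (Real.log n) ^ 6) (by linarith) (Nat.lt_floor_add_one _).le hK1
    (hK c lam (by linarith) hcC hl hden) e9 e10 e11 hη e5 hM hs
    {x ∈ simpleWords (Fin m) (Fin n) k | ∃ t : ℕ,
        2 * (n : ℝ) / Real.log (Real.log n) ^ 6 ≤ t ∧ HasDisjointCycles (graphOf x) t}
    (Finset.filter_subset _ _) (fun x hx => (Finset.mem_filter.1 hx).2)
  have hsub := (Finset.card_le_card (atypical_subset (m := m) (n := n) (k := k) β γ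
    (degreeCutoff n))).trans ((Finset.card_union_le _ _).trans (Nat.add_le_add_left
    ((Finset.card_union_le _ _).trans (Nat.add_le_add_left ((Finset.card_union_le _ _).trans
    (Nat.add_le_add_left (Finset.card_union_le _ _) _)) _)) _))
  refine (Nat.cast_le.2 hsub).trans ?_
  rw [Nat.cast_add, Nat.cast_add, Nat.cast_add, Nat.cast_add, show ∀ a b : ℝ,
    5 * a * b = a * b + (a * b + (a * b + (a * b + a * b))) from fun a b => by ring]
  refine add_le_add ?_ (add_le_add ?_ (add_le_add ?_ (add_le_add ?_ b5)))
  · convert b1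
  · convert b2
  · convert b3
  · convert b4

end Main

end MinDegGraph

theorem mainTheorem6 (k : ℕ) (hk : 3 ≤ k) (C β₁ γ₁ : ℝ)
    (hβ : β₁ ∈ Set.Ioo (0 : ℝ) (1 / 10)) (hγ : γ₁ ∈ Set.Ioo (0 : ℝ) (1 / 10)) :
    ∀ ε : ℝ, 0 < ε → ∃ N : ℕ, ∀ n : ℕ, N ≤ n → ∀ (m : ℕ) (c lam : ℝ),
      (m : ℝ) = c * n → (k : ℝ) / 2 < c → c ≤ C →
      0 < lam →
      lam * MinDegGraph.truncExp (k - 1) lam / MinDegGraph.truncExp k lam = 2 * c →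
      9 * Real.exp (1 + lam) * lam ^ 2 / (c * MinDegGraph.truncExp k lam) *
        (γ₁ * lam ^ 2 / c) ^ (1 / 10 : ℝ) < 1 / 2 →
      (2 * (k + lam) - Real.logb 2 (β₁ * γ₁) + 3) * β₁ < 2 * (1 - β₁) →
      1 - ε / n ≤ MinDegGraph.prob n m k (fun G =>
        (∀ S : Finset (Fin n), (S.card : ℝ) ≤ γ₁ * n →
          (MinDegGraph.edgesSpanned G S : ℝ) < 11 / 10 * S.card + 1) ∧
        (∀ S : Finset (Fin n), (S.card : ℝ) ≤ β₁ * γ₁ * n →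
          (MinDegGraph.edgesIncident G S : ℝ) < 2 * (1 - β₁) * γ₁ * n) ∧
        (∀ t : ℕ, 2 * (n : ℝ) / Real.log (Real.log n) ^ 6 ≤ t →
          ¬ MinDegGraph.HasDisjointCycles G t)) := by
  classical
  intro ε hε
  -- The value ε/5 shares the error equally among the five exceptional classes.
  obtain ⟨N, hN⟩ := Filter.eventually_atTop.1 (MinDegGraph.eventually_card_atypical_le (C := C) hk
    hβ.1 (by linarith [hβ.2]) hγ.1 hγ.2 (η := ε / 5) (by positivity))
  refine ⟨N, fun n hn m c lam hm hkc hcC hl hb hden hinc => ?_⟩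
  obtain ⟨h0, h1⟩ := hN n hn m c lam hm hkc hcC hl hb hden hinc
  change _ ≤ MinDegGraph.prob n m k (MinDegGraph.IsTypical β₁ γ₁)
  rw [MinDegGraph.prob_eq]
  have h0' : (0 : ℝ) < (MinDegGraph.simpleWords (Fin m) (Fin n) k).card := by exact_mod_cast h0
  have h2 := Finset.card_filter_add_card_filter_not (s := MinDegGraph.simpleWords (Fin m) (Fin n) k)
    (fun x => MinDegGraph.IsTypical β₁ γ₁ (MinDegGraph.graphOf x))
  have h3 : (((MinDegGraph.simpleWords (Fin m) (Fin n) k).filter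
      fun x => MinDegGraph.IsTypical β₁ γ₁ (MinDegGraph.graphOf x)).card : ℝ) +
      ((MinDegGraph.simpleWords (Fin m) (Fin n) k).filter
      fun x => ¬ MinDegGraph.IsTypical β₁ γ₁ (MinDegGraph.graphOf x)).card =
      (MinDegGraph.simpleWords (Fin m) (Fin n) k).card := by exact_mod_cast h2
  rw [le_div_iff₀ h0']
  rw [show 5 * (ε / 5 / (n : ℝ)) = ε / n by ring] at h1
  linarith
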